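/- **Setting.** Let $M$ be a smooth (Hausdorff, second countable) real $3$-manifold with a flag structure: two smooth complex line subbundles $T^1,T^2\subset TM\otimes\mathbb C$ with $T^1\cap T^2=0$ such that locally there is a smooth complex-valued $1$-form $\theta$ with $\ker\theta=T^1\oplus T^2$ and $\theta\wedge d\theta\neq0$ everywhere. Let $E\to M$ be the $\mathbb C^*$-bundle of all forms $\theta$ with kernel $T^1\oplus T^2$, with tautological form $\omega$. Let $Y$ be the bundle of coframes $(\omega,\omega^1,\omega^2,\varphi)$ on $E$ where, at a point of $E$, $\omega^1,\omega^2$ are lifted from $M$, $\omega^1$ vanishes on $T^2$ and not on $T^1$, $\omega^2$ vanishes on $T^1$ and not on $T^2$, and $d\omega=\omega\wedge\varphi+\omega^1\wedge\omega^2$. Denote by the same letters the tautological forms on $Y$, and let $\omega_1^1,\varphi^1,\varphi^2,\psi$ be the complex-valued $1$-forms on $Y$ determined by the structure equations $$d\omega=\omega\wedge\varphi+\omega^1\wedge\omega^2,\quad d\omega^1=\tfrac12\omega^1\wedge\varphi+\omega^1\wedge\omega_1^1+\omega\wedge\varphi^1,\quad d\omega^2=\tfrac12\omega^2\wedge\varphi-\omega^2\wedge\omega_1^1+\omega\wedge\varphi^2,$$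 $$d\varphi=\omega^1\wedge\varphi^2-\omega^2\wedge\varphi^1+\omega\wedge\psi,\qquad d\omega_1^1=\tfrac32\omega^2\wedge\varphi^1+\tfrac32\omega^1\wedge\varphi^2,$$ $$d\varphi^1-\varphi^1\wedge\omega_1^1-\tfrac12\omega^1\wedge\psi-\tfrac12\varphi\wedge\varphi^1=Q^1\,\omega\wedge\omega^2\quad\text{for some function }Q^1 .$$ The adapted connection is the $\mathfrak{sl}(3,\mathbb C)$-valued form $$\pi=\begin{pmatrix}-\frac12\varphi-\frac13\omega_1^1&-\varphi^2&-\frac14\psi\\ \omega^1&\frac23\omega_1^1&\frac12\varphi^1\\ 2\omega&2\omega^2&\frac12\varphi-\frac13\omega_1^1\end{pmatrix},\qquad TC_2(\pi)=\frac1{24\pi^2}\operatorname{tr}(\pi\wedge\pi\wedge\pi).$$ The group $B\subset SL(3,\mathbb C)$ of upper triangular matrices acts on $Y$ on the right over $M$: for $h=\begin{pmatrix}a&c&e\\0&\frac1{ab}&d\\0&0&b\end{pmatrix}$ the map $R_h$ multiplies the row $(\omega,\omega^1,\omega^2,\varphi)$ by $$\begin{pmatrix}\frac ab&-2a^2d&\frac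 cb&\frac{4e}b-2acd\\0&a^2b&0&abc\\0&0&\frac1{ab^2}&\frac{2d}b\\0&0&0&1\end{pmatrix}$$ (the base point $\theta\in E$ moves to $\frac ab\theta$, and the tangent spaces of $E$ at these points are identified by multiplication by $\frac ab$ in the fibres of $E$). **Proposition 6.2.** Suppose that $Y\to M$ is trivial, and let $s,\tilde s:M\to Y$ be two smooth sections. Then every point of $M$ has an open neighbourhood $U$ with a smooth function $h:U\to B$ such that $\tilde s=R_h\circ s$ on $U$; the $2$-forms $s^*\operatorname{tr}(h^{-1}\pi\wedge dh)$ given by all such pairs $(U,h)$ are the restrictions of one smooth complex-valued $2$-form on $M$, also denoted $s^*\operatorname{tr}(h^{-1}\pi\wedge dh)$; and $$\tilde s^*TC_2(\pi)-s^*TC_2(\pi)=-\frac1{8\pi^2}\,d\,\bigl(s^*\operatorname{tr}(h^{-1}\pi\wedge dh)\bigr).$$ Hence, if $M$ is compact (without boundary) and oriented, $\int_M\tilde s^*TC_2(\pi)=\int_Ms^*TC_2(\pi)$, so that $\mu=\int_Ms^*TC_2(\pi)\in\mathbb C$ does not depend on the section. -/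

import Mathlib

open scoped Manifold ContDiff Topology TensorProduct
open Bundle Diffeology

namespace FlagGeometry

noncomputable section

/-! ## Differential forms on diffeological spaces

A complex valued differential `k`-form on a space `X` with a smooth structure is given by its
pullbacks along all smooth maps `ℝⁿ → X` (the plots of `X`), subject to compatibility with smooth
changes of the parameters.  On a smooth manifold these are the usual smooth differential forms.
Exterior products and exterior derivatives are normalised by
`(α ∧ β)(u, v) = α u * β v - α v * β u` and `dα(u, v) = u (α v) - v (α u)` for constant `u`, `v`. -/

section Pointwise

variable {E : Type*} [NormedAddCommGroup E] [NormedSpace ℝ E]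

/-- A covector, regarded as an alternating form of degree one. -/
def oneForm (a : E →L[ℝ] ℂ) : E [⋀^Fin 1]→L[ℝ] ℂ :=
  ContinuousAlternatingMap.ofSubsingletonLIE (𝕜 := ℝ) (E := E) (F := ℂ) (0 : Fin 1) a

/-- The exterior product of an alternating form of degree one with one of degree `k`; see
`wedgeAlt_apply` for the formula. -/
def wedgeAlt {k : ℕ} (a : E [⋀^Fin 1]→L[ℝ] ℂ) (b : E [⋀^Fin k]→L[ℝ] ℂ) :
    E [⋀^Fin (k + 1)]→L[ℝ] ℂ :=
  ContinuousAlternatingMap.alternatizeUncurryFin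
    (((ContinuousLinearMap.lsmul ℝ ℂ (E := E [⋀^Fin k]→L[ℝ] ℂ)).flip b).comp
      ((ContinuousAlternatingMap.ofSubsingletonLIE
        (𝕜 := ℝ) (E := E) (F := ℂ) (0 : Fin 1)).symm a))

theorem oneForm_apply (a : E →L[ℝ] ℂ) (v : Fin 1 → E) : oneForm a v = a (v 0) := rfl

theorem wedgeAlt_apply {k : ℕ} (a : E [⋀^Fin 1]→L[ℝ] ℂ) (b : E [⋀^Fin k]→L[ℝ] ℂ)
    (v : Fin (k + 1) → E) :
    wedgeAlt a b v
      = ∑ i : Fin (k + 1), (-1) ^ (i : ℕ) • (a (fun _ => v i) * b (i.removeNth v)) := by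
  rw [wedgeAlt, ContinuousAlternatingMap.alternatizeUncurryFin_apply]
  rfl

theorem wedgeAlt_comp {E' : Type*} [NormedAddCommGroup E'] [NormedSpace ℝ E'] {k : ℕ}
    (a : E [⋀^Fin 1]→L[ℝ] ℂ) (b : E [⋀^Fin k]→L[ℝ] ℂ) (f : E' →L[ℝ] E) :
    wedgeAlt (a.compContinuousLinearMap f) (b.compContinuousLinearMap f)
      = (wedgeAlt a b).compContinuousLinearMap f := by
  ext v
  rw [ContinuousAlternatingMap.compContinuousLinearMap_apply, wedgeAlt_apply, wedgeAlt_apply]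
  rfl

theorem contDiff_wedgeAlt {k : ℕ} {D : Type*} [NormedAddCommGroup D] [NormedSpace ℝ D]
    {a : D → E [⋀^Fin 1]→L[ℝ] ℂ} {b : D → E [⋀^Fin k]→L[ℝ] ℂ}
    (ha : ContDiff ℝ ∞ a) (hb : ContDiff ℝ ∞ b) :
    ContDiff ℝ ∞ (fun t => wedgeAlt (a t) (b t)) := by
  have h1 : ContDiff ℝ ∞ fun t =>
      (ContinuousLinearMap.lsmul ℝ ℂ (E := E [⋀^Fin k]→L[ℝ] ℂ)).flip (b t) :=
    (ContinuousLinearMap.contDiff _).comp hb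
  have h2 : ContDiff ℝ ∞ fun t => (ContinuousAlternatingMap.ofSubsingletonLIE
      (𝕜 := ℝ) (E := E) (F := ℂ) (0 : Fin 1)).symm (a t) :=
    (LinearIsometryEquiv.contDiff _).comp ha
  exact (ContinuousLinearMap.contDiff (𝕜 := ℝ) (E := E →L[ℝ] E [⋀^Fin k]→L[ℝ] ℂ)
    (F := E [⋀^Fin (k + 1)]→L[ℝ] ℂ)
    (ContinuousAlternatingMap.alternatizeUncurryFinCLM ℝ E ℂ)).comp (h1.clm_comp h2)

end Pointwise

/-- Complex valued differential forms of degree `k` on a diffeological space, given by their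
pullbacks along plots. -/
@[ext]
structure DiffForm (X : Type*) [DiffeologicalSpace X] (k : ℕ) where
  /-- The pullback of the form along a plot. -/
  onPlot : ∀ {n : ℕ} (p : EuclideanSpace ℝ (Fin n) → X), IsPlot p →
    EuclideanSpace ℝ (Fin n) → EuclideanSpace ℝ (Fin n) [⋀^Fin k]→L[ℝ] ℂ
  contDiff : ∀ {n : ℕ} (p : EuclideanSpace ℝ (Fin n) → X) (hp : IsPlot p),
    ContDiff ℝ ∞ (onPlot p hp)
  reparam : ∀ {n m : ℕ} (p : EuclideanSpace ℝ (Fin n) → X) (hp : IsPlot p)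
    (f : EuclideanSpace ℝ (Fin m) → EuclideanSpace ℝ (Fin n)) (hf : ContDiff ℝ ∞ f)
    (t : EuclideanSpace ℝ (Fin m)),
    onPlot (p ∘ f) (isPlot_reparam hp hf) t
      = (onPlot p hp (f t)).compContinuousLinearMap (fderiv ℝ f t)

namespace DiffForm

variable {X Y : Type*} [DiffeologicalSpace X] [DiffeologicalSpace Y] {k : ℕ}

instance : Zero (DiffForm X k) :=
  ⟨{ onPlot := fun _ _ _ => 0
     contDiff := fun _ _ => contDiff_const
     reparam := fun _ _ _ _ _ => rfl }⟩

instance : Add (DiffForm X k) :=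
  ⟨fun α β =>
   { onPlot := fun p hp t => α.onPlot p hp t + β.onPlot p hp t
     contDiff := fun p hp => (α.contDiff p hp).add (β.contDiff p hp)
     reparam := fun p hp f hf t => by rw [α.reparam p hp f hf, β.reparam p hp f hf]; rfl }⟩

instance : Neg (DiffForm X k) :=
  ⟨fun α =>
   { onPlot := fun p hp t => -α.onPlot p hp t
     contDiff := fun p hp => (α.contDiff p hp).neg
     reparam := fun p hp f hf t => by rw [α.reparam p hp f hf]; rfl }⟩

instance : SMul ℂ (DiffForm X k) :=
  ⟨fun c α =>
   { onPlot := fun p hp t => c • α.onPlot p hp t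
     contDiff := fun p hp => (α.contDiff p hp).const_smul c
     reparam := fun p hp f hf t => by rw [α.reparam p hp f hf]; rfl }⟩

@[simp] theorem zero_onPlot {n : ℕ} (p : EuclideanSpace ℝ (Fin n) → X) (hp : IsPlot p)
    (t : EuclideanSpace ℝ (Fin n)) : (0 : DiffForm X k).onPlot p hp t = 0 := rfl

@[simp] theorem add_onPlot (α β : DiffForm X k) {n : ℕ} (p : EuclideanSpace ℝ (Fin n) → X)
    (hp : IsPlot p) (t : EuclideanSpace ℝ (Fin n)) :
    (α + β).onPlot p hp t = α.onPlot p hp t + β.onPlot p hp t := rfl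

@[simp] theorem neg_onPlot (α : DiffForm X k) {n : ℕ} (p : EuclideanSpace ℝ (Fin n) → X)
    (hp : IsPlot p) (t : EuclideanSpace ℝ (Fin n)) :
    (-α).onPlot p hp t = -α.onPlot p hp t := rfl

@[simp] theorem smul_onPlot (c : ℂ) (α : DiffForm X k) {n : ℕ}
    (p : EuclideanSpace ℝ (Fin n) → X) (hp : IsPlot p) (t : EuclideanSpace ℝ (Fin n)) :
    (c • α).onPlot p hp t = c • α.onPlot p hp t := rfl

theorem ext_onPlot {α β : DiffForm X k}
    (h : ∀ {n : ℕ} (p : EuclideanSpace ℝ (Fin n) → X) (hp : IsPlot p)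
      (t : EuclideanSpace ℝ (Fin n)), α.onPlot p hp t = β.onPlot p hp t) : α = β := by
  ext n p hp t v
  rw [h p hp t]

instance : AddCommGroup (DiffForm X k) where
  add_assoc α β γ := ext_onPlot fun p hp t => by simp [add_assoc]
  zero_add α := ext_onPlot fun p hp t => by simp
  add_zero α := ext_onPlot fun p hp t => by simp
  add_comm α β := ext_onPlot fun p hp t => by simp [add_comm]
  neg_add_cancel α := ext_onPlot fun p hp t => by simp
  nsmul := nsmulRec
  zsmul := zsmulRec

instance : Module ℂ (DiffForm X k) where
  one_smul α := ext_onPlot fun p hp t => by simp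
  mul_smul c c' α := ext_onPlot fun p hp t => by simp [mul_smul]
  smul_zero c := ext_onPlot fun p hp t => by ext v; exact mul_zero c
  smul_add c α β := ext_onPlot fun p hp t => by simp
  add_smul c c' α := ext_onPlot fun p hp t => by ext v; exact add_mul c c' _
  zero_smul α := ext_onPlot fun p hp t => by ext v; exact zero_mul _

/-- The exterior product of a form of degree one with a form of degree `k`. -/
def wedge (α : DiffForm X 1) (β : DiffForm X k) : DiffForm X (k + 1) where
  onPlot p hp t := wedgeAlt (α.onPlot p hp t) (β.onPlot p hp t)
  contDiff p hp := contDiff_wedgeAlt (α.contDiff p hp) (β.contDiff p hp)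
  reparam p hp f hf t := by
    rw [α.reparam p hp f hf, β.reparam p hp f hf, wedgeAlt_comp]

/-- The exterior derivative. -/
def d (α : DiffForm X k) : DiffForm X (k + 1) where
  onPlot p hp t := extDeriv (α.onPlot p hp) t
  contDiff p hp := by
    unfold extDeriv
    exact (ContinuousAlternatingMap.alternatizeUncurryFinCLM ℝ _ ℂ).contDiff.comp
      ((α.contDiff p hp).fderiv_right (m := ∞) (by simp))
  reparam p hp f hf t := by
    have h : α.onPlot (p ∘ f) (isPlot_reparam hp hf) =
        fun t => (α.onPlot p hp (f t)).compContinuousLinearMap (fderiv ℝ f t) :=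
      funext fun t => α.reparam p hp f hf t
    rw [h]
    exact extDeriv_pullback (r := ∞)
      ((α.contDiff p hp).differentiable (by simp) _) hf.contDiffAt
      (by rw [minSmoothness_of_isRCLikeNormedField]; exact WithTop.coe_le_coe.2 (le_top (a := (2 : ℕ∞))))

/-- The pullback `f^* α` of a form along a smooth map. -/
def pullback (f : X → Y) (hf : DSmooth f) (α : DiffForm Y k) : DiffForm X k where
  onPlot p hp := α.onPlot (f ∘ p) (hf _ p hp)
  contDiff p hp := α.contDiff (f ∘ p) (hf _ p hp)
  reparam p hp g hg t := α.reparam (f ∘ p) (hf _ p hp) g hg t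

end DiffForm

/-! ## Three-manifolds with a flag structure -/

/-- The model space of three-manifolds. -/
abbrev E3 : Type := EuclideanSpace ℝ (Fin 3)

/-- The total space of the bundle of complex valued real-linear forms on the tangent spaces of `M`,
that is, of the complexified cotangent bundle. -/
abbrev CotC (M : Type*) [TopologicalSpace M] [ChartedSpace E3 M] [IsManifold (𝓡 3) ∞ M] : Type _ :=
  TotalSpace (E3 →L[ℝ] ℂ) (fun x : M => TangentSpace (𝓡 3) x →L[ℝ] ℂ)

/-- The vector space on which the complexified cotangent bundle is modelled. -/
abbrev CotVec : Type := E3 × (E3 →L[ℝ] ℂ)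

/-- The model with corners of the complexified cotangent bundle. -/
abbrev cotModel : ModelWithCorners ℝ CotVec (ModelProd E3 (E3 →L[ℝ] ℂ)) :=
  (𝓡 3).prod 𝓘(ℝ, E3 →L[ℝ] ℂ)

section Manifold

variable {M : Type*} [TopologicalSpace M] [ChartedSpace E3 M] [IsManifold (𝓡 3) ∞ M]

/-- The smooth structure of `M`, given by the smooth maps `ℝⁿ → M`. -/
instance manifoldDiffeology : DiffeologicalSpace M :=
  .ofCorePlotsOn {
    isPlotOn := fun {n u} _ p => ContMDiffOn (𝓡 n) (𝓡 3) ∞ p u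
    isPlotOn_congr := fun _ _ _ h => contMDiffOn_congr h
    isPlot := fun {n} p => ContMDiff (𝓡 n) (𝓡 3) ∞ p
    isPlotOn_univ := contMDiffOn_univ
    isPlot_const := fun _ => contMDiff_const
    isPlotOn_reparam := fun _ _ _ h hp hf => hp.comp hf.contMDiffOn h
    locality := fun _ _ h x hxu => by
      obtain ⟨v, hv, hxv, hv'⟩ := h x hxu
      exact ((hv' x hxv).contMDiffAt (hv.mem_nhds hxv)).contMDiffWithinAt }

/-- The extension of a complex valued form on a real vector space to a complex linear form on the
complexification. -/
def complexExt {x : M} (θ : TangentSpace (𝓡 3) x →L[ℝ] ℂ) :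
    (ℂ ⊗[ℝ] TangentSpace (𝓡 3) x) →ₗ[ℂ] ℂ :=
  LinearMap.liftBaseChange ℂ (θ : TangentSpace (𝓡 3) x →ₗ[ℝ] ℂ)

/-- Smooth complex line subbundles of the complexified tangent bundle: locally they are spanned by a
nowhere vanishing smooth section `X + i Y`, with `X`, `Y` smooth vector fields. -/
def IsSmoothLineField (T : ∀ x : M, Submodule ℂ (ℂ ⊗[ℝ] TangentSpace (𝓡 3) x)) : Prop :=
  ∀ x : M, ∃ U : Set M, IsOpen U ∧ x ∈ U ∧
    ∃ V W : ∀ y : M, TangentSpace (𝓡 3) y,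
      ContMDiffOn (𝓡 3) (𝓡 3).tangent ∞ (fun y => (⟨y, V y⟩ : TangentBundle (𝓡 3) M)) U ∧
      ContMDiffOn (𝓡 3) (𝓡 3).tangent ∞ (fun y => (⟨y, W y⟩ : TangentBundle (𝓡 3) M)) U ∧
      ∀ y ∈ U, (1 : ℂ) ⊗ₜ[ℝ] V y + Complex.I ⊗ₜ[ℝ] W y ≠ 0 ∧
        T y = Submodule.span ℂ {(1 : ℂ) ⊗ₜ[ℝ] V y + Complex.I ⊗ₜ[ℝ] W y}

/-- The value at a point `z = (x, θ)` of the tautological form `ω` of the complexified cotangent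
bundle.  A tangent vector is a pair `(u, ξ)`, in the coordinates of the preferred chart at `x`. -/
def tautForm (z : CotC M) (w : CotVec) : ℂ := z.2 w.1

/-- The exterior derivative `dω` of the tautological form.  In the cotangent coordinates
`(x, p)` given by a chart one has `ω = ∑ pⱼ dxⱼ` and `dω = ∑ dpⱼ ∧ dxⱼ`. -/
def dTautForm (w w' : CotVec) : ℂ := w.2 w'.1 - w'.2 w.1

/-- The velocity of a section `θ` of the complexified cotangent bundle in the direction `u`. -/
def sectionVelocity (θ : ∀ y : M, TangentSpace (𝓡 3) y →L[ℝ] ℂ) (x : M)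
    (u : TangentSpace (𝓡 3) x) : CotVec :=
  mfderiv (𝓡 3) cotModel (fun y => (⟨y, θ y⟩ : CotC M)) x u

/-- The exterior derivative of a form `θ` of degree one on `M`, as the pullback of `dω` by the
section `θ`. -/
def dSection (θ : ∀ y : M, TangentSpace (𝓡 3) y →L[ℝ] ℂ) (x : M)
    (u v : TangentSpace (𝓡 3) x) : ℂ :=
  dTautForm (sectionVelocity θ x u) (sectionVelocity θ x v)

variable (M) in
/-- A flag structure: two smooth complex line fields `T₁`, `T₂` in the complexified tangent bundle
with trivial intersection, such that `T₁ ⊕ T₂` is a contact distribution. -/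
structure FlagStructure where
  T₁ : ∀ x : M, Submodule ℂ (ℂ ⊗[ℝ] TangentSpace (𝓡 3) x)
  T₂ : ∀ x : M, Submodule ℂ (ℂ ⊗[ℝ] TangentSpace (𝓡 3) x)
  smooth₁ : IsSmoothLineField T₁
  smooth₂ : IsSmoothLineField T₂
  inf_eq_bot : ∀ x, T₁ x ⊓ T₂ x = ⊥
  contact : ∀ x : M, ∃ U : Set M, IsOpen U ∧ x ∈ U ∧
    ∃ θ : ∀ y : M, TangentSpace (𝓡 3) y →L[ℝ] ℂ,
      ContMDiffOn (𝓡 3) cotModel ∞ (fun y => (⟨y, θ y⟩ : CotC M)) U ∧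
      ∀ y ∈ U, LinearMap.ker (complexExt (θ y)) = T₁ y ⊔ T₂ y ∧
        ∃ u v w : TangentSpace (𝓡 3) y,
          θ y u * dSection θ y v w - θ y v * dSection θ y u w + θ y w * dSection θ y u v ≠ 0

variable (F : FlagStructure M)

/-- The `ℂ^*`-bundle `E` of the forms with kernel `T₁ ⊕ T₂`, inside the complexified cotangent
bundle. -/
def FlagStructure.contactForms : Set (CotC M) :=
  {z | LinearMap.ker (complexExt (x := z.proj) z.2) = F.T₁ z.proj ⊔ F.T₂ z.proj}

/-- The tangent space of `E` at a point: the span of the velocities of smooth curves in `E`. -/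
def FlagStructure.tangentE (z : CotC M) : Submodule ℝ CotVec :=
  Submodule.span ℝ {w | ∃ γ : ℝ → CotC M, ContMDiff 𝓘(ℝ, ℝ) cotModel ∞ γ ∧
    (∀ t, γ t ∈ F.contactForms) ∧ γ 0 = z ∧
    w = mfderiv 𝓘(ℝ, ℝ) cotModel γ 0 (1 : ℝ)}

/-- A point of the coframe bundle `Y`: a point `θ` of `E` together with forms
`ω = θ`, `ω¹ = θ₁`, `ω² = θ₂` and `φ` on the tangent space of `E` at `θ`, where the first three
are lifted from `M`, such that `ω¹` has kernel `T₂` and `ω²` has kernel `T₁` on `T₁ ⊕ T₂`, and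
`dω = ω ∧ φ + ω¹ ∧ ω²`.  By the last equation the restriction of `φ` to the fibre of `E` is
`- dλ / λ`. -/
structure AdaptedCoframe where
  base : CotC M
  base_mem : base ∈ F.contactForms
  θ₁ : TangentSpace (𝓡 3) base.proj →L[ℝ] ℂ
  θ₂ : TangentSpace (𝓡 3) base.proj →L[ℝ] ℂ
  θ₁_eq_zero : ∀ z ∈ F.T₂ base.proj, complexExt θ₁ z = 0
  θ₁_ne_zero : ∀ z ∈ F.T₁ base.proj, z ≠ 0 → complexExt θ₁ z ≠ 0
  θ₂_eq_zero : ∀ z ∈ F.T₁ base.proj, complexExt θ₂ z = 0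
  θ₂_ne_zero : ∀ z ∈ F.T₂ base.proj, z ≠ 0 → complexExt θ₂ z ≠ 0
  φ : F.tangentE base →ₗ[ℝ] ℂ
  structure_eq : ∀ w w' : F.tangentE base,
    dTautForm w.1 w'.1
      = (tautForm base w.1 * φ w' - tautForm base w'.1 * φ w)
        + (θ₁ w.1.1 * θ₂ w'.1.1 - θ₁ w'.1.1 * θ₂ w.1.1)

namespace AdaptedCoframe

variable {F}

/-- The projection of `Y` to `M`. -/
def pt (y : AdaptedCoframe F) : M := y.base.proj

open Classical in
/-- The value of the form `φ` of a coframe on a vector tangent to `E` (and `0` on vectors which are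
not tangent to `E`). -/
def phiAt (y : AdaptedCoframe F) (w : CotVec) : ℂ :=
  if h : w ∈ F.tangentE y.base then y.φ ⟨w, h⟩ else 0

/-- Smoothness on an open set `u ⊆ ℝⁿ` of a family of coframes: `ω`, `ω¹`, `ω²` are smooth
families of points of the complexified cotangent bundle, and the values of `φ` are smooth on all
smooth families of vectors tangent to `E` (also after smooth changes of the parameters). -/
def IsSmoothFamily {n : ℕ} (u : Set (EuclideanSpace ℝ (Fin n)))
    (p : EuclideanSpace ℝ (Fin n) → AdaptedCoframe F) : Prop :=
  ContMDiffOn (𝓡 n) cotModel ∞ (fun t => (p t).base) u ∧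
  ContMDiffOn (𝓡 n) cotModel ∞ (fun t => (⟨(p t).base.proj, (p t).θ₁⟩ : CotC M)) u ∧
  ContMDiffOn (𝓡 n) cotModel ∞ (fun t => (⟨(p t).base.proj, (p t).θ₂⟩ : CotC M)) u ∧
  ∀ (m : ℕ) (v : Set (EuclideanSpace ℝ (Fin m))), IsOpen v →
    ∀ f : EuclideanSpace ℝ (Fin m) → EuclideanSpace ℝ (Fin n),
    ContDiffOn ℝ ∞ f v → Set.MapsTo f v u →
    ∀ w : EuclideanSpace ℝ (Fin m) → CotVec,
    (∀ t ∈ v, w t ∈ F.tangentE (p (f t)).base) →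
    ContMDiffOn (𝓡 m) cotModel.tangent ∞
      (fun t => (⟨(p (f t)).base, w t⟩ : TangentBundle cotModel (CotC M))) v →
    ContDiffOn ℝ ∞ (fun t => (p (f t)).phiAt (w t)) v

theorem IsSmoothFamily.congr {n : ℕ} {u : Set (EuclideanSpace ℝ (Fin n))}
    {p q : EuclideanSpace ℝ (Fin n) → AdaptedCoframe F} (hp : IsSmoothFamily u p)
    (h : Set.EqOn p q u) : IsSmoothFamily u q := by
  obtain ⟨h0, h1, h2, h3⟩ := hp
  refine ⟨h0.congr fun t ht => by rw [h ht], h1.congr fun t ht => by rw [h ht],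
    h2.congr fun t ht => by rw [h ht], fun m v hv f hf hfv w hw hws => ?_⟩
  exact (h3 m v hv f hf hfv w (fun t ht => by rw [h (hfv ht)]; exact hw t ht)
    (hws.congr fun t ht => by rw [h (hfv ht)])).congr fun t ht => by rw [h (hfv ht)]

/-- The smooth structure of `Y`. -/
instance : DiffeologicalSpace (AdaptedCoframe F) :=
  .ofCorePlotsOn {
    isPlotOn := fun {_ u} _ p => IsSmoothFamily u p
    isPlotOn_congr := fun _ _ _ h => ⟨fun hp => hp.congr h, fun hq => hq.congr h.symm⟩
    isPlot_const := by
      intro n y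
      refine ⟨contMDiffOn_const, contMDiffOn_const, contMDiffOn_const,
        fun m v hv f hf hfv w hw hws => ?_⟩
      have hw' : ContDiffOn ℝ ∞ w v := by
        rw [← contMDiffOn_iff_contDiffOn]
        intro t ht
        have h2 := (contMDiffWithinAt_totalSpace.1 (hws t ht)).2
        have key : ∀ s, (trivializationAt CotVec (TangentSpace cotModel) y.base
            (⟨y.base, w s⟩ : TangentBundle cotModel (CotC M))).2 = w s := by
          intro s
          exact (tangentBundleCore cotModel (CotC M)).coordChange_self _ _
            (mem_chart_source _ y.base) (w s)
        exact h2.congr (fun s _ => (key s).symm) (key t).symm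
      obtain ⟨g, hg⟩ := LinearMap.exists_extend y.φ
      refine ((LinearMap.toContinuousLinearMap g).contDiff.comp_contDiffOn hw').congr ?_
      intro t ht
      have := LinearMap.congr_fun hg ⟨w t, hw t ht⟩
      rw [phiAt, dif_pos (hw t ht), ← this]
      rfl
    isPlotOn_reparam := by
      rintro n m u v hu hv p f h ⟨h0, h1, h2, h3⟩ hf
      refine ⟨h0.comp hf.contMDiffOn h, h1.comp hf.contMDiffOn h, h2.comp hf.contMDiffOn h,
        fun k w hw g hg hgw X hX hXs => ?_⟩
      exact h3 k w hw (f ∘ g) (hf.comp hg hgw) (h.comp hgw) X hX hXs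
    locality := by
      intro n u hu p h
      refine ⟨?_, ?_, ?_, ?_⟩
      · intro x hx
        obtain ⟨v, hv, hxv, hv'⟩ := h x hx
        exact (hv'.1.contMDiffAt (hv.mem_nhds hxv)).contMDiffWithinAt
      · intro x hx
        obtain ⟨v, hv, hxv, hv'⟩ := h x hx
        exact (hv'.2.1.contMDiffAt (hv.mem_nhds hxv)).contMDiffWithinAt
      · intro x hx
        obtain ⟨v, hv, hxv, hv'⟩ := h x hx
        exact (hv'.2.2.1.contMDiffAt (hv.mem_nhds hxv)).contMDiffWithinAt
      · intro m v hv f hf hfv w hw hws t ht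
        obtain ⟨v', hv', hxv', h'⟩ := h (f t) (hfv ht)
        have ho : IsOpen (v ∩ f ⁻¹' v') := hf.continuousOn.isOpen_inter_preimage hv hv'
        exact ((h'.2.2.2 m _ ho f (hf.mono Set.inter_subset_left) (fun s hs => hs.2) w
          (fun s hs => hw s hs.1) (hws.mono Set.inter_subset_left)).contDiffAt
          (ho.mem_nhds ⟨ht, hxv'⟩)).contDiffWithinAt }

/-- The velocity in the direction `u` of the family of points of `E` underlying a family of
coframes. -/
def velocity {n : ℕ} (p : EuclideanSpace ℝ (Fin n) → AdaptedCoframe F)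
    (t u : EuclideanSpace ℝ (Fin n)) : CotVec :=
  mfderiv (𝓡 n) cotModel (fun r => (p r).base) t u

theorem velocity_mem {n : ℕ} (p : EuclideanSpace ℝ (Fin n) → AdaptedCoframe F) (hp : IsPlot p)
    (t u : EuclideanSpace ℝ (Fin n)) : velocity p t u ∈ F.tangentE (p t).base := by
  have hb : ContMDiff (𝓡 n) cotModel ∞ (fun r => (p r).base) := contMDiffOn_univ.1 hp.1
  have hl : ContDiff ℝ ∞ (fun r : ℝ => t + r • u) := by fun_prop
  refine Submodule.subset_span ⟨fun r => (p (t + r • u)).base, hb.comp hl.contMDiff,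
    fun r => (p _).base_mem, by simp, ?_⟩
  have h0 : t + (0 : ℝ) • u = t := by simp
  have hd : HasFDerivAt (fun r : ℝ => t + r • u)
      ((ContinuousLinearMap.id ℝ ℝ).smulRight u) 0 :=
    ((hasFDerivAt_id (0 : ℝ)).smul_const u).const_add t
  have hm : HasMFDerivAt (𝓡 n) cotModel (fun r => (p r).base) (t + (0 : ℝ) • u)
      (mfderiv (𝓡 n) cotModel (fun r => (p r).base) (t + (0 : ℝ) • u)) :=
    ((hb _).mdifferentiableAt (by simp)).hasMFDerivAt
  have hc := (HasMFDerivAt.comp (0 : ℝ) hm hd.hasMFDerivAt).mfderiv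
  have hc' := congrArg (fun L : ℝ →L[ℝ] CotVec => L 1) hc
  refine Eq.trans ?_ hc'.symm
  change velocity p t u = velocity p (t + (0 : ℝ) • u) ((1 : ℝ) • u)
  rw [h0, one_smul]

end AdaptedCoframe

/-! ## The adapted connection -/

/-- The canonical forms of a flag structure on the coframe bundle `Y`: the tautological forms
`ω`, `ω¹`, `ω²`, `φ` (whose values at a coframe `y` are the members of `y`, lifted to `Y`) and
forms `ω₁¹`, `φ¹`, `φ²`, `ψ` which satisfy the structure equations. These equations
(including the last two, which normalise the curvature) determine the forms uniquely.  The fields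
`om`, `om₁`, `om₂`, `om₁₁`, `φ₁`, `φ₂` are `ω`, `ω¹`, `ω²`, `ω₁¹`, `φ¹`, `φ²`. -/
structure CanonicalForms where
  om : DiffForm (AdaptedCoframe F) 1
  om₁ : DiffForm (AdaptedCoframe F) 1
  om₂ : DiffForm (AdaptedCoframe F) 1
  φ : DiffForm (AdaptedCoframe F) 1
  om₁₁ : DiffForm (AdaptedCoframe F) 1
  φ₁ : DiffForm (AdaptedCoframe F) 1
  φ₂ : DiffForm (AdaptedCoframe F) 1
  ψ : DiffForm (AdaptedCoframe F) 1
  om_taut : ∀ {n : ℕ} (p : EuclideanSpace ℝ (Fin n) → AdaptedCoframe F) (hp : IsPlot p)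
    (t : EuclideanSpace ℝ (Fin n)) (v : Fin 1 → EuclideanSpace ℝ (Fin n)),
    om.onPlot p hp t v = tautForm (p t).base (AdaptedCoframe.velocity p t (v 0))
  om₁_taut : ∀ {n : ℕ} (p : EuclideanSpace ℝ (Fin n) → AdaptedCoframe F) (hp : IsPlot p)
    (t : EuclideanSpace ℝ (Fin n)) (v : Fin 1 → EuclideanSpace ℝ (Fin n)),
    om₁.onPlot p hp t v = (p t).θ₁ (AdaptedCoframe.velocity p t (v 0)).1
  om₂_taut : ∀ {n : ℕ} (p : EuclideanSpace ℝ (Fin n) → AdaptedCoframe F) (hp : IsPlot p)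
    (t : EuclideanSpace ℝ (Fin n)) (v : Fin 1 → EuclideanSpace ℝ (Fin n)),
    om₂.onPlot p hp t v = (p t).θ₂ (AdaptedCoframe.velocity p t (v 0)).1
  φ_taut : ∀ {n : ℕ} (p : EuclideanSpace ℝ (Fin n) → AdaptedCoframe F) (hp : IsPlot p)
    (t : EuclideanSpace ℝ (Fin n)) (v : Fin 1 → EuclideanSpace ℝ (Fin n)),
    φ.onPlot p hp t v = (p t).phiAt (AdaptedCoframe.velocity p t (v 0))
  d_om : om.d = om.wedge φ + om₁.wedge om₂
  d_om₁ : om₁.d = (1 / 2 : ℂ) • om₁.wedge φ + om₁.wedge om₁₁ + om.wedge φ₁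
  d_om₂ : om₂.d = (1 / 2 : ℂ) • om₂.wedge φ - om₂.wedge om₁₁ + om.wedge φ₂
  d_φ : φ.d = om₁.wedge φ₂ - om₂.wedge φ₁ + om.wedge ψ
  d_om₁₁ : om₁₁.d = (3 / 2 : ℂ) • om₂.wedge φ₁ + (3 / 2 : ℂ) • om₁.wedge φ₂
  d_φ₁ : ∃ Q : AdaptedCoframe F → ℂ,
    ∀ {n : ℕ} (p : EuclideanSpace ℝ (Fin n) → AdaptedCoframe F) (hp : IsPlot p)
      (t : EuclideanSpace ℝ (Fin n)),
      (φ₁.d - φ₁.wedge om₁₁ - (1 / 2 : ℂ) • om₁.wedge ψ - (1 / 2 : ℂ) • φ.wedge φ₁).onPlot p hp t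
        = Q (p t) • (om.wedge om₂).onPlot p hp t

variable {F}

/-- The adapted connection `π`, a matrix of forms on `Y` with values in `sl(3, ℂ)`. -/
def CanonicalForms.connection (c : CanonicalForms F) :
    Matrix (Fin 3) (Fin 3) (DiffForm (AdaptedCoframe F) 1) :=
  !![(-(1 / 2) : ℂ) • c.φ - (1 / 3 : ℂ) • c.om₁₁, -c.φ₂, (-(1 / 4) : ℂ) • c.ψ;
     c.om₁, (2 / 3 : ℂ) • c.om₁₁, (1 / 2 : ℂ) • c.φ₁;
     (2 : ℂ) • c.om, (2 : ℂ) • c.om₂, (1 / 2 : ℂ) • c.φ - (1 / 3 : ℂ) • c.om₁₁]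

/-- The form `tr (A ∧ A ∧ A)` of a matrix `A` of forms of degree one. -/
def traceCube {X : Type*} [DiffeologicalSpace X] (A : Matrix (Fin 3) (Fin 3) (DiffForm X 1)) :
    DiffForm X 3 :=
  ∑ i, ∑ j, ∑ k, (A i j).wedge ((A j k).wedge (A k i))

/-- The form `TC₂(π) = (1 / 24π²) tr (π ∧ π ∧ π)` on `Y`. -/
def CanonicalForms.TC₂ (c : CanonicalForms F) : DiffForm (AdaptedCoframe F) 3 :=
  (1 / (24 * (Real.pi : ℂ) ^ 2)) • traceCube c.connection

/-! ## Sections of the coframe bundle and the action of the structure group -/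

variable (F) in
/-- A global smooth section of `Y → M`. -/
structure GlobalSection where
  toFun : M → AdaptedCoframe F
  smooth : DSmooth toFun
  pt_eq : ∀ x, (toFun x).pt = x

/-- The Borel group `B` of upper triangular matrices in `SL(3, ℂ)`. -/
def borel : Set (Matrix (Fin 3) (Fin 3) ℂ) :=
  {g | g 1 0 = 0 ∧ g 2 0 = 0 ∧ g 2 1 = 0 ∧ g.det = 1}

/-- The right action of `B` on `Y`: `IsRightTranslate y g y'` says that `y' = R_g y`.  For
`g = !![a, c, e; 0, 1 / (a * b), d; 0, 0, b]` the coframe `y'` lies over the point `(a / b) θ` of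
`E`, where `θ` is the point of `E` below `y`, and, under the identification of the tangent
spaces of `E` at these two points by the fibrewise multiplication by `a / b`, it is the row
`(ω, ω¹, ω², φ)` of `y` multiplied by
`!![a / b, -2 * a ^ 2 * d, c / b, 4 * e / b - 2 * a * c * d; 0, a ^ 2 * b, 0, a * b * c;
0, 0, 1 / (a * b ^ 2), 2 * d / b; 0, 0, 0, 1]`. -/
def IsRightTranslate (y : AdaptedCoframe F) (g : Matrix (Fin 3) (Fin 3) ℂ)
    (y' : AdaptedCoframe F) : Prop :=
  let a := g 0 0
  let b := g 2 2
  let c := g 0 1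
  let d := g 1 2
  let e := g 0 2
  y'.base = ⟨y.base.proj, (a / b) • y.base.2⟩ ∧
  (∀ u : E3, y'.θ₁ u = a ^ 2 * b * y.θ₁ u - 2 * a ^ 2 * d * y.base.2 u) ∧
  (∀ u : E3, y'.θ₂ u = 1 / (a * b ^ 2) * y.θ₂ u + c / b * y.base.2 u) ∧
  ∀ w ∈ F.tangentE y.base, y'.phiAt (w.1, (a / b) • w.2)
    = y.phiAt w + a * b * c * y.θ₁ w.1 + 2 * d / b * y.θ₂ w.1
      + (4 * e / b - 2 * a * c * d) * y.base.2 w.1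

/-- `h` is a smooth function on `U` with values in `B` such that `s' = R_h s` on `U`. -/
def IsGaugeOn (s s' : GlobalSection F) (U : Set M) (h : M → Matrix (Fin 3) (Fin 3) ℂ) : Prop :=
  (∀ i j, ContMDiffOn (𝓡 3) 𝓘(ℝ, ℂ) ∞ (fun x => h x i j) U) ∧
  ∀ x ∈ U, h x ∈ borel ∧ IsRightTranslate (s.toFun x) (h x) (s'.toFun x)

/-- The pullback `s^* tr (h⁻¹ π ∧ dh)`, evaluated along a smooth map `q : ℝⁿ → M`. -/
def gaugeTrace (c : CanonicalForms F) (s : GlobalSection F) (h : M → Matrix (Fin 3) (Fin 3) ℂ)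
    {n : ℕ} (q : EuclideanSpace ℝ (Fin n) → M) (hq : IsPlot q) (t : EuclideanSpace ℝ (Fin n)) :
    EuclideanSpace ℝ (Fin n) [⋀^Fin 2]→L[ℝ] ℂ :=
  ∑ i, ∑ j, ∑ k, (h (q t))⁻¹ i j •
    wedgeAlt (((c.connection j k).pullback s.toFun s.smooth).onPlot q hq t)
      (oneForm (fderiv ℝ (fun r => h (q r) k i) t))

/-! ## Integration over compact oriented three-manifolds -/

variable (M) in
/-- An orientation of `M`, given by an atlas of smooth charts onto `ℝ³` whose coordinate changes
have positive Jacobian determinants. -/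
structure OrientedAtlas where
  charts : Set (OpenPartialHomeomorph M E3)
  smooth : charts ⊆ IsManifold.maximalAtlas (𝓡 3) ∞ M
  target_eq : ∀ e ∈ charts, e.target = Set.univ
  cover : ∀ x : M, ∃ e ∈ charts, x ∈ e.source
  positive : ∀ e ∈ charts, ∀ e' ∈ charts, ∀ y ∈ (e.symm.trans e').source,
    0 < (fderiv ℝ (e.symm.trans e') y).det

namespace OrientedAtlas

variable (O : OrientedAtlas M)

theorem isPlot_symm (e : O.charts) : IsPlot (e.1.symm : E3 → M) := by
  have h := contMDiffOn_symm_of_mem_maximalAtlas (O.smooth e.2)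
  rw [O.target_eq e.1 e.2] at h
  exact contMDiffOn_univ.1 h

theorem exists_partition [CompactSpace M] [T2Space M] :
    ∃ ρ : SmoothPartitionOfUnity O.charts (𝓡 3) M Set.univ,
      ρ.IsSubordinate (fun e => e.1.source) :=
  SmoothPartitionOfUnity.exists_isSubordinate (𝓡 3) isClosed_univ _ (fun e => e.1.open_source)
    (fun x _ => by
      obtain ⟨e, he, hx⟩ := O.cover x
      exact Set.mem_iUnion.2 ⟨⟨e, he⟩, hx⟩)

/-- A smooth partition of unity subordinate to the charts. -/
def partition [CompactSpace M] [T2Space M] :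
    SmoothPartitionOfUnity O.charts (𝓡 3) M Set.univ :=
  O.exists_partition.choose

/-- The integral of a form of degree three over a compact oriented three-manifold, by means of a
smooth partition of unity subordinate to the charts (only finitely many of its members are
nonzero, by compactness). -/
def integral [CompactSpace M] [T2Space M] (α : DiffForm M 3) : ℂ :=
  ∑ᶠ e : O.charts, ∫ y : E3, ((O.partition e (e.1.symm y) : ℝ) : ℂ) *
    α.onPlot e.1.symm (O.isPlot_symm e) y (fun i => EuclideanSpace.basisFun (Fin 3) ℝ i)

end OrientedAtlas

/-- The invariant `μ = ∫_M s^* TC₂(π)`. -/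
def mu [CompactSpace M] [T2Space M] (O : OrientedAtlas M) (c : CanonicalForms F)
    (s : GlobalSection F) : ℂ :=
  O.integral (c.TC₂.pullback s.toFun s.smooth)

end Manifold

end

end FlagGeometry

/-! Along a plot of M the pullback s^*π is a matrix A of one-forms. Everything rests on the gauge
law A' = h⁻¹ A h + h⁻¹ dh for the pullback A' by a section R_h ∘ s. The action of B is given on
coframes only, so this law has to be deduced; this is `sectionMatrix_gauge`. With indices counted
from 0, the structure equations say that the curvature Ω = dA + A ∧ A vanishes on and below the
diagonal and that Ω₁₂ is a multiple of A₂₀ ∧ A₂₁. Together with tr A = 0 these conditions survive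
gauge transformations with values in B (`IsNormal.gaugeTransform`). A matrix which satisfies them is
determined by A₂₀, A₁₀, A₂₁ and A₂₂ - A₀₀, which are ω, ω¹, ω², φ up to constants, provided that the
first three form a coframe (`IsNormal.ext`). On these entries the gauge law is the formula for the
action. The derivative terms of h⁻¹ dh match because φ is -dλ/λ on the fibres of E
(`phiAt_velocity_of_scale`).

Put θ = dh h⁻¹. The Chern-Simons computation `transgression_formula` gives tr A'³ - tr A³ = -3 d
tr(h⁻¹ A ∧ dh) + 3 tr(Ω ∧ θ) + tr θ³. Since h takes values in B, θ is upper triangular, while Ω is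
strictly upper triangular; so the last two terms vanish, and the factor 3 / 24π² becomes 1 / 8π²
(`TC₂_gauge`).

Local gauges exist because two adapted coframes over one point of M differ by coefficients from
which h can be computed after a cube root has been extracted (`exists_isGaugeOn`); the root is why h
is only local. Two gauges differ by a cube root of unity, the centre of SL(3, ℂ). It has derivative
zero and cancels in tr(h⁻¹ π ∧ dh), so the local two-forms agree and glue (`gaugeTrace_eq`,
`exists_gaugeForm`). The identity of forms is verified in charts onto ℝ³, which suffices by
`DiffForm.ext_fullChart`. The statement on integrals is then Stokes' theorem, proved with a
partition of unity (`OrientedAtlas.integral_d`). -/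

namespace FlagGeometry

noncomputable section

/-! ### Values of exterior products and exterior derivatives in low degree. -/

section FormValues

section

variable {E : Type*}

theorem removeNth_fin_two_zero (v : Fin 2 → E) : (0 : Fin 2).removeNth v = fun _ => v 1 := by
  funext i; fin_cases i; rfl

theorem removeNth_fin_two_one (v : Fin 2 → E) : (1 : Fin 2).removeNth v = fun _ => v 0 := by
  funext i; fin_cases i; rfl

theorem removeNth_fin_three_zero (v : Fin 3 → E) : (0 : Fin 3).removeNth v = ![v 1, v 2] := by
  funext i; fin_cases i <;> rfl

theorem removeNth_fin_three_one (v : Fin 3 → E) : (1 : Fin 3).removeNth v = ![v 0, v 2] := by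
  funext i; fin_cases i <;> rfl

theorem removeNth_fin_three_two (v : Fin 3 → E) : (2 : Fin 3).removeNth v = ![v 0, v 1] := by
  funext i; fin_cases i <;> rfl

end

variable {E : Type*} [NormedAddCommGroup E] [NormedSpace ℝ E]

theorem wedgeAlt_one_one (a b : E [⋀^Fin 1]→L[ℝ] ℂ) (v : Fin 2 → E) :
    wedgeAlt a b v = a (fun _ => v 0) * b (fun _ => v 1) - a (fun _ => v 1) * b (fun _ => v 0) := by
  rw [wedgeAlt_apply, Fin.sum_univ_two, removeNth_fin_two_zero, removeNth_fin_two_one]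
  simp [sub_eq_add_neg]

theorem wedgeAlt_one_two (a : E [⋀^Fin 1]→L[ℝ] ℂ) (b : E [⋀^Fin 2]→L[ℝ] ℂ) (v : Fin 3 → E) :
    wedgeAlt a b v = a (fun _ => v 0) * b ![v 1, v 2] - a (fun _ => v 1) * b ![v 0, v 2]
      + a (fun _ => v 2) * b ![v 0, v 1] := by
  rw [wedgeAlt_apply, Fin.sum_univ_three, removeNth_fin_three_zero, removeNth_fin_three_one,
    removeNth_fin_three_two]
  simp [sub_eq_add_neg]

theorem extDeriv_one_apply {α : E → E [⋀^Fin 1]→L[ℝ] ℂ} {t : E}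
    (h : DifferentiableAt ℝ α t) (v : Fin 2 → E) :
    extDeriv α t v = fderiv ℝ (fun s => α s (fun _ => v 1)) t (v 0)
      - fderiv ℝ (fun s => α s (fun _ => v 0)) t (v 1) := by
  rw [extDeriv_apply h, Fin.sum_univ_two, removeNth_fin_two_zero, removeNth_fin_two_one]
  simp [sub_eq_add_neg]

theorem extDeriv_two_apply {α : E → E [⋀^Fin 2]→L[ℝ] ℂ} {t : E}
    (h : DifferentiableAt ℝ α t) (v : Fin 3 → E) :
    extDeriv α t v = fderiv ℝ (fun s => α s ![v 1, v 2]) t (v 0)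
      - fderiv ℝ (fun s => α s ![v 0, v 2]) t (v 1)
      + fderiv ℝ (fun s => α s ![v 0, v 1]) t (v 2) := by
  rw [extDeriv_apply h, Fin.sum_univ_three, removeNth_fin_three_zero, removeNth_fin_three_one,
    removeNth_fin_three_two]
  simp [sub_eq_add_neg]

theorem ContDiff.alternating_apply {D : Type*} [NormedAddCommGroup D] [NormedSpace ℝ D] {k : ℕ}
    {α : D → E [⋀^Fin k]→L[ℝ] ℂ}
    (h : ContDiff ℝ ∞ α) (v : Fin k → E) : ContDiff ℝ ∞ (fun s => α s v) :=
  (ContinuousAlternatingMap.apply ℝ E ℂ v).contDiff.comp h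

end FormValues

/-! ### Matrix valued one-forms: curvature, gauge transformations and the Chern-Simons identity. -/

section MatrixCalculus

variable {E : Type*} [NormedAddCommGroup E] [NormedSpace ℝ E]

/-- Three by three complex matrices. -/
abbrev Mat3 : Type := Matrix (Fin 3) (Fin 3) ℂ

/-- The entrywise derivative of a matrix valued function. -/
def matDeriv (g : E → Mat3) (t u : E) : Mat3 :=
  Matrix.of fun i j => fderiv ℝ (fun s => g s i j) t u

/-- Smoothness of the entries of a matrix valued function. -/
def MatSmooth (g : E → Mat3) : Prop := ∀ i j, ContDiff ℝ ∞ (fun s => g s i j)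

theorem matDeriv_apply (g : E → Mat3) (t u : E) (i j : Fin 3) :
    matDeriv g t u i j = fderiv ℝ (fun s => g s i j) t u := rfl

theorem MatSmooth.differentiable {g : E → Mat3} (hg : MatSmooth g) (t : E) (i j : Fin 3) :
    DifferentiableAt ℝ (fun s => g s i j) t :=
  ((hg i j).differentiable (by simp)) t

theorem MatSmooth.mul {f g : E → Mat3} (hf : MatSmooth f) (hg : MatSmooth g) :
    MatSmooth (fun s => f s * g s) := fun i j => by
  simp only [Matrix.mul_apply]
  exact ContDiff.sum fun k _ => (hf i k).mul (hg k j)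

theorem MatSmooth.add {f g : E → Mat3} (hf : MatSmooth f) (hg : MatSmooth g) :
    MatSmooth (fun s => f s + g s) := fun i j => (hf i j).add (hg i j)

theorem MatSmooth.matDeriv {g : E → Mat3} (hg : MatSmooth g) (u : E) :
    MatSmooth (fun s => matDeriv g s u) := fun i j =>
  ((hg i j).fderiv_right (m := ∞) (by simp)).clm_apply contDiff_const

theorem matDeriv_mul {f g : E → Mat3} (hf : MatSmooth f) (hg : MatSmooth g) (t u : E) :
    matDeriv (fun s => f s * g s) t u = matDeriv f t u * g t + f t * matDeriv g t u := by
  ext i j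
  have h : HasFDerivAt (fun s => ∑ k, f s i k * g s k j)
      (∑ k, (f t i k • fderiv ℝ (fun s => g s k j) t
        + g t k j • fderiv ℝ (fun s => f s i k) t)) t :=
    HasFDerivAt.fun_sum fun k _ =>
      (hf.differentiable t i k).hasFDerivAt.mul (hg.differentiable t k j).hasFDerivAt
  simp only [matDeriv_apply, Matrix.mul_apply, Matrix.add_apply]
  rw [h.fderiv]
  simp only [sum_apply, add_apply, smul_apply,
    smul_eq_mul, ← Finset.sum_add_distrib]
  exact Finset.sum_congr rfl fun k _ => by ring

theorem matDeriv_add {f g : E → Mat3} (hf : MatSmooth f) (hg : MatSmooth g) (t u : E) :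
    matDeriv (fun s => f s + g s) t u = matDeriv f t u + matDeriv g t u := by
  ext i j
  simp only [matDeriv_apply, Matrix.add_apply]
  rw [fderiv_fun_add (hf.differentiable t i j) (hg.differentiable t i j)]
  rfl

theorem matDeriv_const (c : Mat3) (t u : E) : matDeriv (fun _ : E => c) t u = 0 := by
  ext i j
  simp [matDeriv_apply]

theorem fderiv_trace {g : E → Mat3} (hg : MatSmooth g) (t u : E) :
    fderiv ℝ (fun s => (g s).trace) t u = (matDeriv g t u).trace := by
  have h : HasFDerivAt (fun s => ∑ i, g s i i) (∑ i, fderiv ℝ (fun s => g s i i) t) t :=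
    HasFDerivAt.fun_sum fun i _ => (hg.differentiable t i i).hasFDerivAt
  simp only [Matrix.trace, Matrix.diag]
  rw [h.fderiv]
  simp [matDeriv_apply]

theorem MatSmooth.trace {g : E → Mat3} (hg : MatSmooth g) :
    ContDiff ℝ ∞ (fun s => (g s).trace) :=
  ContDiff.sum fun i _ => hg i i

theorem matDeriv_inv {g k : E → Mat3} (hg : MatSmooth g) (hk : MatSmooth k)
    (hkg : ∀ t, k t * g t = 1) (t u : E) :
    matDeriv k t u = -(k t * matDeriv g t u * k t) := by
  have hgk : g t * k t = 1 := mul_eq_one_comm.1 (hkg t)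
  have h := matDeriv_mul hk hg t u
  simp only [hkg, matDeriv_const] at h
  have h2 : matDeriv k t u * (g t * k t) + k t * matDeriv g t u * k t = 0 := by
    rw [← mul_assoc, ← add_mul, ← h, zero_mul]
  rw [hgk, mul_one] at h2
  exact eq_neg_of_add_eq_zero_left h2

theorem fderiv_fderiv_symm {f : E → ℂ} (hf : ContDiff ℝ ∞ f) (t u v : E) :
    fderiv ℝ (fun s => fderiv ℝ f s v) t u = fderiv ℝ (fun s => fderiv ℝ f s u) t v := by
  have h1 : DifferentiableAt ℝ (fderiv ℝ f) t :=
    (hf.fderiv_right (m := ∞) (by simp)).differentiable (by simp) t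
  have h2 : ∀ v, HasFDerivAt (fun s => fderiv ℝ f s v)
      ((ContinuousLinearMap.apply ℝ ℂ v).comp (fderiv ℝ (fderiv ℝ f) t)) t := fun v =>
    (ContinuousLinearMap.apply ℝ ℂ v).hasFDerivAt.comp t h1.hasFDerivAt
  rw [(h2 v).fderiv, (h2 u).fderiv]
  exact (hf.contDiffAt.isSymmSndFDerivAt (by
    rw [minSmoothness_of_isRCLikeNormedField]
    exact WithTop.coe_le_coe.2 (le_top (a := (2 : ℕ∞))))) u v

theorem matDeriv_symm {g : E → Mat3} (hg : MatSmooth g) (t u v : E) :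
    matDeriv (fun s => matDeriv g s v) t u = matDeriv (fun s => matDeriv g s u) t v := by
  ext i j
  exact fderiv_fderiv_symm (hg i j) t u v

/-- The curvature `dA + A ∧ A` of a matrix of one-forms, given by its values. -/
def curvature (A : E → E → Mat3) (t u v : E) : Mat3 :=
  matDeriv (fun s => A s v) t u - matDeriv (fun s => A s u) t v + (A t u * A t v - A t v * A t u)

/-- The gauge transform `g⁻¹ A g + g⁻¹ dg`, with `k` in the role of `g⁻¹`. -/
def gaugeTransform (A : E → E → Mat3) (g k : E → Mat3) (t u : E) : Mat3 :=
  k t * A t u * g t + k t * matDeriv g t u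

theorem gaugeTransform_smooth {A : E → E → Mat3} {g k : E → Mat3}
    (hA : ∀ u, MatSmooth (fun s => A s u)) (hg : MatSmooth g) (hk : MatSmooth k) (u : E) :
    MatSmooth (fun s => gaugeTransform A g k s u) :=
  ((hk.mul (hA u)).mul hg).add (hk.mul (hg.matDeriv u))

/-- The usual tensoriality of the curvature, for forms evaluated on constant vector fields. It
transports the normalisations of the curvature through a gauge. -/
theorem curvature_gaugeTransform {A : E → E → Mat3} {g k : E → Mat3}
    (hA : ∀ u, MatSmooth (fun s => A s u)) (hg : MatSmooth g) (hk : MatSmooth k)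
    (hkg : ∀ t, k t * g t = 1) (t u v : E) :
    curvature (gaugeTransform A g k) t u v = k t * curvature A t u v * g t := by
  have hgk : ∀ x, g t * (k t * x) = x := fun x => by
    rw [← mul_assoc, mul_eq_one_comm.1 (hkg t), one_mul]
  have hD : ∀ u v, matDeriv (fun s => gaugeTransform A g k s v) t u
      = matDeriv k t u * A t v * g t + k t * matDeriv (fun s => A s v) t u * g t
        + k t * A t v * matDeriv g t u + matDeriv k t u * matDeriv g t v
        + k t * matDeriv (fun s => matDeriv g s v) t u := fun u v => by
    simp only [gaugeTransform]
    rw [matDeriv_add ((hk.mul (hA v)).mul hg) (hk.mul (hg.matDeriv v)),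
      matDeriv_mul (hk.mul (hA v)) hg, matDeriv_mul hk (hA v), matDeriv_mul hk (hg.matDeriv v)]
    noncomm_ring
  -- The second derivatives of `g` are symmetric and cancel in the antisymmetrisation; the
  -- derivatives of `k` become -k dg k.
  rw [curvature, hD u v, hD v u, matDeriv_symm hg t u v, matDeriv_inv hg hk hkg,
    matDeriv_inv hg hk hkg]
  simp only [curvature, gaugeTransform]
  simp only [mul_add, add_mul, mul_sub, sub_mul, mul_assoc, neg_mul, hgk]
  abel

/-- The two-form `tr (g⁻¹ A ∧ dg)`, given by its values. -/
def transgression (A : E → E → Mat3) (g k : E → Mat3) (t u v : E) : ℂ :=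
  (k t * A t u * matDeriv g t v).trace - (k t * A t v * matDeriv g t u).trace

theorem trace_rotate (X Y Z : Mat3) : (X * Y * Z).trace = (Y * Z * X).trace := by
  rw [mul_assoc, Matrix.trace_mul_comm]

/-- The transform is k (A + θ) g, so its cubic trace is that of A + θ. Expanding the cube, the terms
linear in θ are completed by dA to the curvature, and what is left over is an exact form and tr θ³.
Up to the common factor 3, the expression tr (X(u) [X(v), X(w)]) is the value of tr (X ∧ X ∧ X). No
triangularity is used here. -/
theorem transgression_formula {A : E → E → Mat3} {g k : E → Mat3}
    (hA : ∀ u, MatSmooth (fun s => A s u)) (hg : MatSmooth g) (hk : MatSmooth k)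
    (hkg : ∀ t, k t * g t = 1) (t u v w : E) (θ : E → Mat3) (hθ : ∀ u, θ u = matDeriv g t u * k t) :
    (gaugeTransform A g k t u * (gaugeTransform A g k t v * gaugeTransform A g k t w
        - gaugeTransform A g k t w * gaugeTransform A g k t v)).trace
      - (A t u * (A t v * A t w - A t w * A t v)).trace
    = -(fderiv ℝ (fun s => transgression A g k s v w) t u
        - fderiv ℝ (fun s => transgression A g k s u w) t v
        + fderiv ℝ (fun s => transgression A g k s u v) t w)
      + ((curvature A t u v * θ w).trace - (curvature A t u w * θ v).trace
        + (curvature A t v w * θ u).trace) + (θ u * (θ v * θ w - θ w * θ v)).trace := by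
  have hgk1 : g t * k t = 1 := mul_eq_one_comm.1 (hkg t)
  have hgk : ∀ x, g t * (k t * x) = x := fun x => by rw [← mul_assoc, hgk1, one_mul]
  have hdg : ∀ u, matDeriv g t u = θ u * g t := fun u => by
    rw [hθ, mul_assoc, hkg, mul_one]
  have hdk : ∀ u, matDeriv k t u = -(k t * θ u) := fun u => by
    rw [matDeriv_inv hg hk hkg, hdg, mul_assoc, mul_assoc, hgk1, mul_one]
  have hconj : ∀ x, (k t * (x * g t)).trace = x.trace := fun x => by
    rw [Matrix.trace_mul_comm, mul_assoc, hgk1, mul_one]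
  have hs : ∀ v w, MatSmooth (fun s => k s * A s v * matDeriv g s w) := fun v w =>
    (hk.mul (hA v)).mul (hg.matDeriv w)
  have hD : ∀ u v w, fderiv ℝ (fun s => transgression A g k s v w) t u
      = (matDeriv (fun s => A s v) t u * θ w).trace - (θ u * A t v * θ w).trace
        + (A t v * (matDeriv (fun s => matDeriv g s w) t u * k t)).trace
        - ((matDeriv (fun s => A s w) t u * θ v).trace - (θ u * A t w * θ v).trace
        + (A t w * (matDeriv (fun s => matDeriv g s v) t u * k t)).trace) := fun u v w => by
    have h1 : ∀ v w, fderiv ℝ (fun s => (k s * A s v * matDeriv g s w).trace) t u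
        = (matDeriv (fun s => A s v) t u * θ w).trace - (θ u * A t v * θ w).trace
        + (A t v * (matDeriv (fun s => matDeriv g s w) t u * k t)).trace := fun v w => by
      rw [fderiv_trace (hs v w), matDeriv_mul (hk.mul (hA v)) (hg.matDeriv w),
        matDeriv_mul hk (hA v), hdk, hdg, Matrix.trace_add, add_mul, Matrix.trace_add]
      have e1 : -(k t * θ u) * A t v * (θ w * g t) = -(k t * ((θ u * A t v * θ w) * g t)) := by
        noncomm_ring
      have e2 : k t * matDeriv (fun s => A s v) t u * (θ w * g t)
          = k t * ((matDeriv (fun s => A s v) t u * θ w) * g t) := by noncomm_ring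
      have e3 : (k t * A t v * matDeriv (fun s => matDeriv g s w) t u).trace
          = (A t v * (matDeriv (fun s => matDeriv g s w) t u * k t)).trace := by
        rw [mul_assoc, Matrix.trace_mul_comm, mul_assoc]
      rw [e1, e2, e3, Matrix.trace_neg, hconj, hconj]
      ring
    simp only [transgression]
    rw [fderiv_fun_sub ((hs v w).trace.differentiable (by simp) t)
      ((hs w v).trace.differentiable (by simp) t), sub_apply, h1, h1]
  have hG : ∀ u, gaugeTransform A g k t u = k t * ((A t u + θ u) * g t) := fun u => by
    rw [gaugeTransform, hdg]; noncomm_ring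
  have hG3 : ∀ X Y Z : Mat3, k t * (X * g t) * (k t * (Y * g t) * (k t * (Z * g t)))
      = k t * (X * Y * Z * g t) := fun X Y Z => by
    simp only [mul_assoc, hgk]
  -- In the alternating sum each second derivative of `g` occurs twice with opposite signs, once its
  -- two directions are interchanged.
  rw [hD, hD, hD, matDeriv_symm hg t u v, matDeriv_symm hg t u w, matDeriv_symm hg t v w]
  simp only [hG, mul_sub, hG3, Matrix.trace_sub, hconj, curvature]
  -- Normal form for cyclic words: each cubic word contains exactly one letter belonging to `u`, and
  -- the rules rotate a word until that letter stands first. After this the identity is linear in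
  -- the traces.
  have rv := trace_rotate (A t v)
  have rv' := trace_rotate (θ v)
  have rw' := trace_rotate (A t w)
  have rw'' := trace_rotate (θ w)
  generalize A t u = au at *
  generalize A t v = av at *
  generalize A t w = aw at *
  generalize θ u = x at *
  generalize θ v = y at *
  generalize θ w = z at *
  simp only [mul_add, add_mul, sub_mul, ← mul_assoc, Matrix.trace_add, Matrix.trace_sub,
    rv, rv', rw', rw'']
  ring

end MatrixCalculus

/-! ### Linear algebra of complex coframes on ℝ³. -/

section Coframes

/-- Three functionals which span the complex valued functionals on `ℝ³`. -/
def IsCoframe (o o₁ o₂ : E3 → ℂ) : Prop :=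
  ∀ a : E3 →ₗ[ℝ] ℂ, ∃ x y z : ℂ, ∀ u, a u = x * o u + y * o₁ u + z * o₂ u

/-- Writing the three coordinate functionals in the coframe gives a left inverse of the matrix of
values of the coframe on the standard basis, whose determinant is therefore not zero. -/
theorem IsCoframe.exists_ne_zero {o o₁ o₂ : E3 → ℂ} (h : IsCoframe o o₁ o₂) :
    ∃ u v w : E3, o u * (o₁ v * o₂ w - o₁ w * o₂ v) - o v * (o₁ u * o₂ w - o₁ w * o₂ u)
      + o w * (o₁ u * o₂ v - o₁ v * o₂ u) ≠ 0 := by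
  let b : Fin 3 → E3 := fun i => EuclideanSpace.basisFun (Fin 3) ℝ i
  let coord : Fin 3 → (E3 →ₗ[ℝ] ℂ) := fun i =>
    Complex.ofRealCLM.toLinearMap.comp (EuclideanSpace.proj i : E3 →L[ℝ] ℝ).toLinearMap
  choose x y z hxyz using fun i => h (coord i)
  let N : Mat3 := Matrix.of fun i j => ![x i, y i, z i] j
  let W : Mat3 := Matrix.of fun j k => ![o (b k), o₁ (b k), o₂ (b k)] j
  have hNW : N * W = 1 := by
    ext i k
    have h1 := hxyz i (b k)
    have h2 : coord i (b k) = (1 : Mat3) i k := by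
      simp only [coord, b, Matrix.one_apply]
      by_cases hik : i = k <;> simp [hik]
    rw [Matrix.mul_apply, Fin.sum_univ_three, ← h2, h1]
    rfl
  have hdet : W.det ≠ 0 := (Matrix.isUnit_det_of_left_inverse hNW).ne_zero
  refine ⟨b 0, b 1, b 2, fun h0 => hdet ?_⟩
  rw [Matrix.det_fin_three]
  simp only [W, Matrix.of_apply, Matrix.cons_val]
  linear_combination h0

/-- Multiplying the relation by each of the three forms isolates one coefficient times the volume
form o ∧ o₁ ∧ o₂. In this way equations between two-forms are solved for coefficients below. -/
theorem IsCoframe.wedge_indep {o o₁ o₂ : E3 → ℂ} (h : IsCoframe o o₁ o₂) {c c₁ c₂ : ℂ}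
    (hc : ∀ u v, c * (o u * o₁ v - o v * o₁ u) + c₁ * (o u * o₂ v - o v * o₂ u)
      + c₂ * (o₁ u * o₂ v - o₁ v * o₂ u) = 0) : c = 0 ∧ c₁ = 0 ∧ c₂ = 0 := by
  obtain ⟨u, v, w, hD⟩ := h.exists_ne_zero
  refine ⟨?_, ?_, ?_⟩ <;> refine (mul_eq_zero.1 ?_).resolve_right hD
  · linear_combination hc u v * o₂ w - hc u w * o₂ v + hc v w * o₂ u
  · linear_combination -hc u v * o₁ w + hc u w * o₁ v - hc v w * o₁ u
  · linear_combination hc u v * o w - hc u w * o v + hc v w * o u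

theorem IsCoframe.indep {o o₁ o₂ : E3 → ℂ} (h : IsCoframe o o₁ o₂) {c c₁ c₂ : ℂ}
    (hc : ∀ u, c * o u + c₁ * o₁ u + c₂ * o₂ u = 0) : c = 0 ∧ c₁ = 0 ∧ c₂ = 0 := by
  obtain ⟨u, v, w, hD⟩ := h.exists_ne_zero
  refine ⟨?_, ?_, ?_⟩ <;> refine (mul_eq_zero.1 ?_).resolve_right hD
  · linear_combination hc u * (o₁ v * o₂ w - o₁ w * o₂ v) - hc v * (o₁ u * o₂ w - o₁ w * o₂ u)
      + hc w * (o₁ u * o₂ v - o₁ v * o₂ u)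
  · linear_combination -hc u * (o v * o₂ w - o w * o₂ v) + hc v * (o u * o₂ w - o w * o₂ u)
      - hc w * (o u * o₂ v - o v * o₂ u)
  · linear_combination hc u * (o v * o₁ w - o w * o₁ v) - hc v * (o u * o₁ w - o w * o₁ u)
      + hc w * (o u * o₁ v - o v * o₁ u)

end Coframes

/-! ### Uniqueness of normal connections with given coframe. -/

section NormalConnections

theorem curvature_entry {E : Type*} [NormedAddCommGroup E] [NormedSpace ℝ E] {A : E → E → Mat3}
    (t u v : E) (i j : Fin 3) :
    curvature A t u v i j = fderiv ℝ (fun s => A s v i j) t u - fderiv ℝ (fun s => A s u i j) t v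
      + ((A t u i 0 * A t v 0 j + A t u i 1 * A t v 1 j + A t u i 2 * A t v 2 j)
        - (A t v i 0 * A t u 0 j + A t v i 1 * A t u 1 j + A t v i 2 * A t u 2 j)) := by
  simp only [curvature, Matrix.add_apply, Matrix.sub_apply, matDeriv_apply, Matrix.mul_apply,
    Fin.sum_univ_three]

/-- Matrices of one-forms on `ℝ³` which satisfy the algebraic normalisations of the adapted
connection. -/
structure IsNormal (A : E3 → E3 → Mat3) : Prop where
  smooth : ∀ u, MatSmooth (fun s => A s u)
  linear : ∀ t i j, ∃ L : E3 →ₗ[ℝ] ℂ, ∀ u, L u = A t u i j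
  trace : ∀ t u, A t u 0 0 + A t u 1 1 + A t u 2 2 = 0
  lower : ∀ t u v i j, j ≤ i → curvature A t u v i j = 0
  upper : ∀ t, ∃ Q : ℂ, ∀ u v, curvature A t u v 1 2
    = Q * (A t u 2 0 * A t v 2 1 - A t v 2 0 * A t u 2 1)

/-- The uniqueness part of Cartan's method of equivalence. Let δ, β₁, β₂, ρ be the differences of
the entries 11, 12, 01, 02. Comparing the curvatures entry by entry gives equations for these forms:
(1,0) and (2,1) make δ a multiple x A₂₀ and express β₁, β₂ by x, modulo A₂₀; (1,1), compared with
the exterior derivative of δ, gives x = 0, because A₂₀ is a contact form, and then β₁ = β₂ = 0;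
(0,0) makes ρ a multiple of A₂₀, and the normalisation of (1,2) removes it. -/
theorem IsNormal.ext {A B : E3 → E3 → Mat3} (hA : IsNormal A) (hB : IsNormal B)
    (h10 : ∀ t u, B t u 1 0 = A t u 1 0) (h20 : ∀ t u, B t u 2 0 = A t u 2 0)
    (h21 : ∀ t u, B t u 2 1 = A t u 2 1)
    (hd : ∀ t u, B t u 2 2 - B t u 0 0 = A t u 2 2 - A t u 0 0)
    (hco : ∀ t, IsCoframe (fun u => A t u 2 0) (fun u => A t u 1 0) (fun u => A t u 2 1)) :
    B = A := by
  have hb : ∀ i j, ∃ η : E3 → E3 → ℂ, ∀ t u, B t u i j = A t u i j + η t u := fun i j =>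
    ⟨fun t u => B t u i j - A t u i j, fun t u => by ring⟩
  obtain ⟨δ, h11⟩ := hb 1 1
  obtain ⟨β₁, h12⟩ := hb 1 2
  obtain ⟨β₂, h01⟩ := hb 0 1
  obtain ⟨ρ, h02⟩ := hb 0 2
  -- The trace and the difference of the outer diagonal entries are common to both matrices, so δ
  -- determines the change of the whole diagonal.
  have h00 : ∀ t u, B t u 0 0 = A t u 0 0 - δ t u / 2 := fun t u => by
    linear_combination (1 / 2 : ℂ) * hB.trace t u - (1 / 2 : ℂ) * hA.trace t u
      - (1 / 2 : ℂ) * h11 t u - (1 / 2 : ℂ) * hd t u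
  have h22 : ∀ t u, B t u 2 2 = A t u 2 2 - δ t u / 2 := fun t u => by
    linear_combination (1 / 2 : ℂ) * hB.trace t u - (1 / 2 : ℂ) * hA.trace t u
      - (1 / 2 : ℂ) * h11 t u + (1 / 2 : ℂ) * hd t u
  have hlin : ∀ (η : E3 → E3 → ℂ) i j, (∀ t u, B t u i j = A t u i j + η t u) → ∀ t,
      ∃ x y z : ℂ, ∀ u, η t u = x * A t u 2 0 + y * A t u 1 0 + z * A t u 2 1 := by
    intro η i j hη t
    obtain ⟨L, hL⟩ := hA.linear t i j
    obtain ⟨L', hL'⟩ := hB.linear t i j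
    obtain ⟨x, y, z, h⟩ := hco t (L' - L)
    refine ⟨x, y, z, fun u => ?_⟩
    rw [← h u, LinearMap.sub_apply, hL, hL', hη]
    ring
  have step1 : ∀ t, ∃ x y z : ℂ, ∀ u, δ t u = x * A t u 2 0 ∧
      β₁ t u = y * A t u 2 0 + 3 / 2 * x * A t u 1 0 ∧
      β₂ t u = z * A t u 2 0 + 3 / 2 * x * A t u 2 1 := by
    intro t
    obtain ⟨x0, x1, x2, hx⟩ := hlin δ 1 1 h11 t
    obtain ⟨y0, y1, y2, hy⟩ := hlin β₁ 1 2 h12 t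
    obtain ⟨z0, z1, z2, hz⟩ := hlin β₂ 0 1 h01 t
    -- The difference of the (1,0) curvatures is (3/2) δ ∧ A₁₀ + β₁ ∧ A₂₀, because dA₁₀ cancels. The
    -- (2,1) entry gives the corresponding relation for β₂.
    obtain ⟨r1, r2, r3⟩ := (hco t).wedge_indep (c := 3 / 2 * x0 - y1) (c₁ := -y2)
      (c₂ := -(3 / 2) * x2) (fun u v => by
        have ha := hA.lower t u v 1 0 (by decide)
        have hb := hB.lower t u v 1 0 (by decide)
        rw [curvature_entry] at ha hb
        simp only [h10, h20, h00, h11, h12] at hb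
        simp only [hx, hy] at hb
        linear_combination hb - ha)
    obtain ⟨s1, s2, s3⟩ := (hco t).wedge_indep (c := z1) (c₁ := z2 - 3 / 2 * x0)
      (c₂ := -(3 / 2) * x1) (fun u v => by
        have ha := hA.lower t u v 2 1 (by decide)
        have hb := hB.lower t u v 2 1 (by decide)
        rw [curvature_entry] at ha hb
        simp only [h21, h20, h22, h11, h01] at hb
        simp only [hx, hz] at hb
        linear_combination hb - ha)
    refine ⟨x0, y0, z0, fun u => ⟨?_, ?_, ?_⟩⟩
    · linear_combination hx u - 2 / 3 * A t u 1 0 * s3 - 2 / 3 * A t u 2 1 * r3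
    · linear_combination hy u - A t u 1 0 * r1 - A t u 2 1 * r2
    · linear_combination hz u + A t u 1 0 * s1 + A t u 2 1 * s2
  have hδs : ∀ u t, DifferentiableAt ℝ (fun s => δ s u) t := fun u t => by
    have : (fun s => δ s u) = fun s => B s u 1 1 - A s u 1 1 := by
      funext s; rw [h11]; ring
    rw [this]
    exact ((hB.smooth u).differentiable t 1 1).sub ((hA.smooth u).differentiable t 1 1)
  have hDδ : ∀ t u v, fderiv ℝ (fun s => A s v 1 1 + δ s v) t u
      = fderiv ℝ (fun s => A s v 1 1) t u + fderiv ℝ (fun s => δ s v) t u := fun t u v => by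
    rw [fderiv_fun_add ((hA.smooth v).differentiable t 1 1) (hδs v t), add_apply]
  have hδ0 : ∀ t u, δ t u = 0 := by
    intro t
    -- The coefficient x was chosen point by point and is not known to be smooth. Hence the relation
    -- δ ∧ A₂₀ = 0 is differentiated instead of δ = x A₂₀.
    have hF : ∀ w u v, fderiv ℝ (fun s => δ s u) t w * A t v 2 0
        + δ t u * fderiv ℝ (fun s => A s v 2 0) t w
        - (fderiv ℝ (fun s => δ s v) t w * A t u 2 0
        + δ t v * fderiv ℝ (fun s => A s u 2 0) t w) = 0 := by
      intro w u v
      have hz : (fun s => δ s u * A s v 2 0 - δ s v * A s u 2 0) = fun _ => (0 : ℂ) := by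
        funext s
        obtain ⟨x, y, z, h⟩ := step1 s
        rw [(h u).1, (h v).1]; ring
      have h1 := ((hδs u t).hasFDerivAt.mul ((hA.smooth v).differentiable t 2 0).hasFDerivAt).sub
        ((hδs v t).hasFDerivAt.mul ((hA.smooth u).differentiable t 2 0).hasFDerivAt)
      have h2 := (h1.congr_of_eventuallyEq (f₁ := fun _ => (0 : ℂ))
        (Filter.Eventually.of_forall fun s => (congrFun hz s).symm)).unique
          (hasFDerivAt_const (0 : ℂ) t)
      have h3 := congrArg (fun L : E3 →L[ℝ] ℂ => L w) h2
      simp only [sub_apply, add_apply, smul_apply, smul_eq_mul,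
        zero_apply] at h3
      linear_combination h3
    obtain ⟨x, y, z, h⟩ := step1 t
    obtain ⟨u, v, w, hD⟩ := (hco t).exists_ne_zero
    have hx : x = 0 := by
      have e11 : ∀ u v, fderiv ℝ (fun s => δ s v) t u - fderiv ℝ (fun s => δ s u) t v
          + (A t u 1 0 * β₂ t v - A t v 1 0 * β₂ t u + β₁ t u * A t v 2 1
            - β₁ t v * A t u 2 1) = 0 := fun u v => by
        have ha := hA.lower t u v 1 1 le_rfl
        have hb := hB.lower t u v 1 1 le_rfl
        rw [curvature_entry] at ha hb
        simp only [h10, h21, h11, h01, h12, hDδ] at hb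
        linear_combination hb - ha
      have e20 : ∀ u v, fderiv ℝ (fun s => A s v 2 0) t u - fderiv ℝ (fun s => A s u 2 0) t v
          + ((A t u 2 0 * A t v 0 0 + A t u 2 1 * A t v 1 0 + A t u 2 2 * A t v 2 0)
          - (A t v 2 0 * A t u 0 0 + A t v 2 1 * A t u 1 0 + A t v 2 2 * A t u 2 0)) = 0 :=
        fun u v => by
        have ha := hA.lower t u v 2 0 (by decide)
        rwa [curvature_entry] at ha
      have e := e11 u v
      have e' := e11 v w
      have e'' := e11 w u
      have f := hF u v w
      have f' := hF v w u
      have f'' := hF w u v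
      simp only [fun u => (h u).1, fun u => (h u).2.1, fun u => (h u).2.2] at e e' e'' f f' f''
      -- Modulo A₂₀, dδ is -3x A₁₀ ∧ A₂₁ by the (1,1) equation. It is also x dA₂₀, which is x A₁₀ ∧
      -- A₂₁ by the (2,0) equation. Hence 4x = 0 after multiplication by A₂₀.
      have : 4 * x * (A t u 2 0 * (A t v 1 0 * A t w 2 1 - A t w 1 0 * A t v 2 1)
          - A t v 2 0 * (A t u 1 0 * A t w 2 1 - A t w 1 0 * A t u 2 1)
          + A t w 2 0 * (A t u 1 0 * A t v 2 1 - A t v 1 0 * A t u 2 1)) = 0 := by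
        linear_combination (A t w 2 0) * e + A t u 2 0 * e' + A t v 2 0 * e''
          - (f + f' + f'') - x * (A t w 2 0) * e20 u v - x * A t u 2 0 * e20 v w
          - x * A t v 2 0 * e20 w u
      simpa using (mul_eq_zero.1 this).resolve_right hD
    intro u
    rw [(h u).1, hx, zero_mul]
  have step2 : ∀ t u, β₁ t u = 0 ∧ β₂ t u = 0 := by
    intro t
    obtain ⟨x, y, z, h⟩ := step1 t
    have hx : x = 0 := by
      refine ((hco t).indep (c := x) (c₁ := 0) (c₂ := 0) fun u => ?_).1
      rw [← (h u).1, hδ0]; ring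
    subst hx
    obtain ⟨r1, r2, -⟩ := (hco t).wedge_indep (c := -z) (c₁ := y) (c₂ := 0) (fun u v => by
        have ha := hA.lower t u v 1 1 le_rfl
        have hb := hB.lower t u v 1 1 le_rfl
        rw [curvature_entry] at ha hb
        simp only [h10, h21, h11, h01, h12, hδ0, add_zero] at hb
        simp only [fun u => (h u).2.1, fun u => (h u).2.2] at hb
        linear_combination hb - ha)
    intro u
    constructor
    · rw [(h u).2.1]; linear_combination A t u 2 0 * r2
    · rw [(h u).2.2]; linear_combination -A t u 2 0 * r1
  have step3 : ∀ t u, ρ t u = 0 := by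
    intro t
    obtain ⟨r0, r1, r2, hr⟩ := hlin ρ 0 2 h02 t
    obtain ⟨s1, s2, -⟩ := (hco t).wedge_indep (c := -r1) (c₁ := -r2) (c₂ := 0) (fun u v => by
        have ha := hA.lower t u v 0 0 le_rfl
        have hb := hB.lower t u v 0 0 le_rfl
        rw [curvature_entry] at ha hb
        simp only [h10, h20, h00, h01, h02, hδ0, zero_div, sub_zero,
          fun u => (step2 t u).2, add_zero] at hb
        simp only [hr] at hb
        linear_combination hb - ha)
    -- What remains of ρ is r0 A₂₀. In the (1,2) entry it contributes A₁₀ ∧ A₂₀, whereas both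
    -- curvatures are multiples of A₂₀ ∧ A₂₁; so r0 = 0.
    obtain ⟨Q, hQ⟩ := hA.upper t
    obtain ⟨Q', hQ'⟩ := hB.upper t
    obtain ⟨s3, -, -⟩ := (hco t).wedge_indep (c := -r0) (c₁ := Q - Q') (c₂ := r2) (fun u v => by
        have ha := hQ u v
        have hb := hQ' u v
        have h12' : ∀ t u, B t u 1 2 = A t u 1 2 := fun t u => by
          rw [h12, (step2 t u).1, add_zero]
        rw [curvature_entry] at ha hb
        simp only [h10, h20, h21, h11, h02, h12', h22, hδ0, zero_div, sub_zero, add_zero] at hb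
        simp only [hr] at hb
        linear_combination hb - ha)
    intro u
    rw [hr]
    linear_combination -A t u 2 0 * s3 - A t u 1 0 * s1 - A t u 2 1 * s2
  funext t u
  ext i j
  fin_cases i <;> fin_cases j
  · simpa [hδ0] using h00 t u
  · simpa [(step2 t u).2] using h01 t u
  · simpa [step3] using h02 t u
  · exact h10 t u
  · simpa [hδ0] using h11 t u
  · simpa [(step2 t u).1] using h12 t u
  · exact h20 t u
  · exact h21 t u
  · simpa [hδ0] using h22 t u

end NormalConnections

/-! ### Smoothness and derivatives of maps into the complexified cotangent bundle. -/

section Cotangent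

variable {M : Type*} [TopologicalSpace M] [ChartedSpace E3 M] [IsManifold (𝓡 3) ∞ M]

/-- The fibre coordinate of a point of the complexified cotangent bundle in the preferred
trivialisation at `x₀`. -/
def fibreCoord (x₀ : M) (z : CotC M) : E3 →L[ℝ] ℂ :=
  (trivializationAt (E3 →L[ℝ] ℂ) (fun x : M => TangentSpace (𝓡 3) x →L[ℝ] ℂ) x₀ z).2

theorem fibreCoord_apply (x₀ : M) (z : CotC M) (u : E3) :
    fibreCoord x₀ z u = z.2 ((trivializationAt E3 (TangentSpace (𝓡 3)) x₀).symmL ℝ z.proj u) := by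
  rw [fibreCoord, hom_trivializationAt_apply]
  simp [ContinuousLinearMap.inCoordinates]

theorem fibreCoord_self (z : CotC M) : fibreCoord z.proj z = z.2 := by
  ext u
  rw [fibreCoord_apply, TangentBundle.symmL_trivializationAt_eq_core (mem_chart_source _ _)]
  congr 1
  exact (tangentBundleCore (𝓡 3) M).coordChange_self _ _ (mem_chart_source _ _) u

theorem fibreCoord_smul (x₀ x : M) (c : ℂ) (p : TangentSpace (𝓡 3) x →L[ℝ] ℂ) :
    fibreCoord x₀ (⟨x, c • p⟩ : CotC M) = c • fibreCoord x₀ ⟨x, p⟩ := by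
  ext u
  refine (fibreCoord_apply x₀ _ u).trans ?_
  exact (congrArg (c * ·) (fibreCoord_apply x₀ ⟨x, p⟩ u)).symm

variable {E : Type*} [NormedAddCommGroup E] [NormedSpace ℝ E]

theorem mfderiv_eq_fderiv_writtenInExtChartAt {V H N : Type*} [NormedAddCommGroup V]
    [NormedSpace ℝ V] [TopologicalSpace H] [TopologicalSpace N] [ChartedSpace H N]
    {I : ModelWithCorners ℝ V H} {f : E → N} {t : E} (h : MDifferentiableAt 𝓘(ℝ, E) I f t) :
    DifferentiableAt ℝ (writtenInExtChartAt 𝓘(ℝ, E) I t f) t ∧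
      (mfderiv 𝓘(ℝ, E) I f t : E →L[ℝ] V) = fderiv ℝ (writtenInExtChartAt 𝓘(ℝ, E) I t f) t := by
  constructor
  · have h1 := h.differentiableWithinAt_writtenInExtChartAt
    rw [ModelWithCorners.range_eq_univ, differentiableWithinAt_univ] at h1
    exact h1
  · rw [h.mfderiv, ModelWithCorners.range_eq_univ, fderivWithin_univ]
    rfl

theorem contMDiffAt_cot_iff {γ : E → CotC M} {t : E} :
    ContMDiffAt 𝓘(ℝ, E) cotModel ∞ γ t ↔
      ContMDiffAt 𝓘(ℝ, E) (𝓡 3) ∞ (fun r => (γ r).proj) t ∧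
      ContDiffAt ℝ ∞ (fun r => fibreCoord (γ t).proj (γ r)) t := by
  rw [← contMDiffAt_iff_contDiffAt]
  exact contMDiffAt_totalSpace

/-- The chart of the bundle at γ(t) is the trivialisation over the base point followed by the chart
of M there, so derivatives split into a base part and a fibre part. Near t the curve stays over the
base set of this trivialisation. -/
theorem mfderiv_cot {γ : E → CotC M} {t : E} (h : ContMDiffAt 𝓘(ℝ, E) cotModel ∞ γ t) (u : E) :
    (mfderiv 𝓘(ℝ, E) cotModel γ t u : CotVec) =
      (mfderiv 𝓘(ℝ, E) (𝓡 3) (fun r => (γ r).proj) t u,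
        fderiv ℝ (fun r => fibreCoord (γ t).proj (γ r)) t u) := by
  have h' := contMDiffAt_cot_iff.1 h
  have hm : MDifferentiableAt 𝓘(ℝ, E) cotModel γ t := h.mdifferentiableAt (by simp)
  have hp : MDifferentiableAt 𝓘(ℝ, E) (𝓡 3) (fun r => (γ r).proj) t :=
    h'.1.mdifferentiableAt (by simp)
  have hq : DifferentiableAt ℝ (fun r => fibreCoord (γ t).proj (γ r)) t :=
    h'.2.differentiableAt (by simp)
  have e : writtenInExtChartAt 𝓘(ℝ, E) cotModel t γ =ᶠ[𝓝 t] fun r =>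
      (writtenInExtChartAt 𝓘(ℝ, E) (𝓡 3) t (fun r => (γ r).proj) r,
        fibreCoord (γ t).proj (γ r)) := by
    have hb : (trivializationAt (E3 →L[ℝ] ℂ) (fun x : M => TangentSpace (𝓡 3) x →L[ℝ] ℂ)
        (γ t).proj).baseSet ∈ 𝓝 (γ t).proj :=
      (Trivialization.open_baseSet _).mem_nhds (mem_baseSet_trivializationAt _ _ _)
    filter_upwards [h'.1.continuousAt.preimage_mem_nhds hb] with r hr
    have h1 : ((trivializationAt (E3 →L[ℝ] ℂ) (fun x : M => TangentSpace (𝓡 3) x →L[ℝ] ℂ)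
        (γ t).proj) (γ r)).1 = (γ r).proj :=
      Trivialization.coe_fst' _ hr
    simp only [writtenInExtChartAt, FiberBundle.extChartAt, Function.comp_apply,
      PartialEquiv.trans_apply, PartialEquiv.prod_coe, PartialEquiv.refl_coe, id]
    refine Prod.ext ?_ rfl
    exact congrArg (extChartAt (𝓡 3) (γ t).proj) h1
  have hm' := mfderiv_eq_fderiv_writtenInExtChartAt hm
  have hp' := mfderiv_eq_fderiv_writtenInExtChartAt hp
  have hf := (e.fderiv_eq (𝕜 := ℝ)).trans (hp'.1.hasFDerivAt.prodMk hq.hasFDerivAt).fderiv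
  refine (congrArg (fun L : E →L[ℝ] CotVec => L u) (hm'.2.trans hf)).trans ?_
  exact Prod.ext (congrArg (fun L : E →L[ℝ] E3 => L u) hp'.2.symm) rfl

end Cotangent

/-! ### Charts onto ℝ³. -/

section FullCharts

variable {M : Type*} [TopologicalSpace M] [ChartedSpace E3 M]

/-- Smooth charts onto the whole of `ℝ³`. -/
def IsFullChart (e : OpenPartialHomeomorph M E3) : Prop :=
  e ∈ IsManifold.maximalAtlas (𝓡 3) ∞ M ∧ e.target = Set.univ

variable {e : OpenPartialHomeomorph M E3}

theorem IsFullChart.contMDiff_symm [IsManifold (𝓡 3) ∞ M] (he : IsFullChart e) :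
    ContMDiff (𝓡 3) (𝓡 3) ∞ e.symm := by
  have h := contMDiffOn_symm_of_mem_maximalAtlas he.1
  rw [he.2] at h
  exact contMDiffOn_univ.1 h

theorem IsFullChart.isPlot_symm [IsManifold (𝓡 3) ∞ M] (he : IsFullChart e) :
    IsPlot (e.symm : E3 → M) := he.contMDiff_symm

theorem IsFullChart.right_inv (he : IsFullChart e) (t : E3) : e (e.symm t) = t :=
  e.right_inv (he.2 ▸ Set.mem_univ t)

theorem IsFullChart.mem_source (he : IsFullChart e) (t : E3) : e.symm t ∈ e.source :=
  e.map_target (he.2 ▸ Set.mem_univ t)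

/-- The image of a restricted chart contains a ball, and `OpenPartialHomeomorph.univBall` identifies
ℝ³ smoothly with this ball. The inverse of such a chart is a plot defined on all of ℝ³, as the
definition of `DiffForm` requires. -/
theorem exists_isFullChart [IsManifold (𝓡 3) ∞ M] {U : Set M} (hU : IsOpen U) {x : M}
    (hx : x ∈ U) : ∃ e : OpenPartialHomeomorph M E3, IsFullChart e ∧ x ∈ e.source ∧ e.source ⊆ U := by
  let e₀ := (chartAt E3 x).restr U
  have hs : e₀.source = (chartAt E3 x).source ∩ U := (chartAt E3 x).restr_source' U hU
  have hx₀ : x ∈ e₀.source := by rw [hs]; exact ⟨mem_chart_source E3 x, hx⟩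
  have he₀ : e₀ ∈ IsManifold.maximalAtlas (𝓡 3) ∞ M :=
    restr_mem_maximalAtlas _ (IsManifold.chart_mem_maximalAtlas x) hU
  obtain ⟨r, hr, hball⟩ := Metric.isOpen_iff.1 e₀.open_target (e₀ x) (e₀.map_source hx₀)
  let φ : OpenPartialHomeomorph E3 E3 := OpenPartialHomeomorph.univBall (e₀ x) r
  have hφs : φ.source = Set.univ := OpenPartialHomeomorph.univBall_source _ _
  have hφt : φ.target = Metric.ball (e₀ x) r := OpenPartialHomeomorph.univBall_target _ hr
  have hφ : φ.symm ∈ contDiffGroupoid ∞ (𝓡 3) := by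
    rw [contDiffGroupoid, mem_groupoid_of_pregroupoid]
    simp only [contDiffPregroupoid, modelWithCornersSelf_coe, modelWithCornersSelf_coe_symm,
      Function.comp_id, Function.id_comp, Set.range_id, Set.inter_univ, Set.preimage_id,
      OpenPartialHomeomorph.symm_source, OpenPartialHomeomorph.symm_target,
      OpenPartialHomeomorph.symm_symm]
    rw [hφt]
    exact ⟨OpenPartialHomeomorph.contDiffOn_univBall_symm,
      OpenPartialHomeomorph.contDiff_univBall.contDiffOn⟩
  refine ⟨e₀.trans φ.symm, ⟨?_, ?_⟩, ?_, ?_⟩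
  · intro e' he'
    have h1 := he₀ e' he'
    refine ⟨?_, ?_⟩
    · rw [OpenPartialHomeomorph.trans_symm_eq_symm_trans_symm, OpenPartialHomeomorph.trans_assoc]
      exact (contDiffGroupoid ∞ (𝓡 3)).trans ((contDiffGroupoid ∞ (𝓡 3)).symm hφ) h1.1
    · rw [← OpenPartialHomeomorph.trans_assoc]
      exact (contDiffGroupoid ∞ (𝓡 3)).trans h1.2 hφ
  · rw [OpenPartialHomeomorph.trans_target]
    simp only [OpenPartialHomeomorph.symm_target, hφs, Set.univ_inter,
      OpenPartialHomeomorph.symm_symm]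
    refine Set.eq_univ_of_forall fun t => hball ?_
    rw [← hφt]
    exact φ.map_source (hφs ▸ Set.mem_univ t)
  · rw [OpenPartialHomeomorph.trans_source]
    refine ⟨hx₀, ?_⟩
    rw [Set.mem_preimage, OpenPartialHomeomorph.symm_source, hφt]
    exact Metric.mem_ball_self hr
  · rw [OpenPartialHomeomorph.trans_source, hs]
    exact fun y hy => hy.1.2

theorem IsFullChart.mfderiv_symm_bijective [IsManifold (𝓡 3) ∞ M] (he : IsFullChart e) (t : E3) :
    Function.Bijective (mfderiv (𝓡 3) (𝓡 3) e.symm t : E3 → E3) := by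
  have hm : e.MDifferentiable (𝓡 3) (𝓡 3) :=
    ⟨(contMDiffOn_of_mem_maximalAtlas he.1).mdifferentiableOn (by simp),
      (contMDiffOn_symm_of_mem_maximalAtlas he.1).mdifferentiableOn (by simp)⟩
  exact hm.symm.mfderiv_bijective (x := t) (by
    rw [OpenPartialHomeomorph.symm_source, he.2]; exact Set.mem_univ t)

end FullCharts

/-! ### Complex linearity of the extension to the complexified tangent space. -/

section ComplexExt

variable {M : Type*} [TopologicalSpace M] [ChartedSpace E3 M]

theorem complexExt_smul {x : M} (c : ℂ) (θ : TangentSpace (𝓡 3) x →L[ℝ] ℂ) :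
    complexExt (c • θ) = c • complexExt θ := by
  refine TensorProduct.AlgebraTensorModule.curry_injective ?_
  ext v
  simp [complexExt]

end ComplexExt

/-! ### Rescaling in the fibres and tangent vectors of the bundle of contact forms. -/

section Velocities

variable {M : Type*} [TopologicalSpace M] [ChartedSpace E3 M] [IsManifold (𝓡 3) ∞ M]
variable {E : Type*} [NormedAddCommGroup E] [NormedSpace ℝ E]

/-- A point of the complexified cotangent bundle as a form on the model space. -/
def cotForm (z : CotC M) : E3 →L[ℝ] ℂ := z.2

/-- The rescaling of a point in the fibre of the complexified cotangent bundle. -/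
def scaleCot (c : ℂ) (z : CotC M) : CotC M := ⟨z.proj, c • z.2⟩

theorem fibreCoord_scaleCot (x₀ : M) (c : ℂ) (z : CotC M) :
    fibreCoord x₀ (scaleCot c z) = c • fibreCoord x₀ z := fibreCoord_smul x₀ z.proj c z.2

theorem contMDiffAt_scaleCot {γ : E → CotC M} {l : E → ℂ} {t : E}
    (hγ : ContMDiffAt 𝓘(ℝ, E) cotModel ∞ γ t) (hl : ContDiffAt ℝ ∞ l t) :
    ContMDiffAt 𝓘(ℝ, E) cotModel ∞ (fun r => scaleCot (l r) (γ r)) t := by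
  have h := contMDiffAt_cot_iff.1 hγ
  refine contMDiffAt_cot_iff.2 ⟨h.1, ?_⟩
  simp only [fibreCoord_scaleCot]
  exact hl.smul h.2

theorem mfderiv_scaleCot {γ : E → CotC M} {l : E → ℂ} {t : E}
    (hγ : ContMDiffAt 𝓘(ℝ, E) cotModel ∞ γ t) (hl : ContDiffAt ℝ ∞ l t) (u : E) :
    (mfderiv 𝓘(ℝ, E) cotModel (fun r => scaleCot (l r) (γ r)) t u : CotVec)
      = ((mfderiv 𝓘(ℝ, E) cotModel γ t u : CotVec).1,
        l t • (mfderiv 𝓘(ℝ, E) cotModel γ t u : CotVec).2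
          + fderiv ℝ l t u • cotForm (γ t)) := by
  have h := contMDiffAt_cot_iff.1 hγ
  refine (mfderiv_cot (contMDiffAt_scaleCot hγ hl) u).trans ?_
  rw [mfderiv_cot hγ u]
  refine Prod.ext rfl ?_
  have hq : DifferentiableAt ℝ (fun r => fibreCoord (γ t).proj (γ r)) t :=
    h.2.differentiableAt (by simp)
  have hl' : DifferentiableAt ℝ l t := hl.differentiableAt (by simp)
  have e : (fun r => fibreCoord (γ t).proj (scaleCot (l r) (γ r)))
      = fun r => l r • fibreCoord (γ t).proj (γ r) := by
    funext r; exact fibreCoord_scaleCot _ _ _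
  change fderiv ℝ (fun r => fibreCoord (γ t).proj (scaleCot (l r) (γ r))) t u = _
  have h1 : HasFDerivAt (fun r => l r • fibreCoord (γ t).proj (γ r)) _ t :=
    hl'.hasFDerivAt.smul hq.hasFDerivAt
  have h2 : fibreCoord (γ t).proj (γ t) = cotForm (γ t) := fibreCoord_self (γ t)
  rw [e, h1.fderiv, h2]
  rfl

variable {F : FlagStructure M}

theorem scaleCot_mem_contactForms {z : CotC M} (hz : z ∈ F.contactForms) {c : ℂ} (hc : c ≠ 0) :
    scaleCot c z ∈ F.contactForms := by
  change LinearMap.ker (complexExt (c • z.2)) = _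
  rw [complexExt_smul, LinearMap.ker_smul _ _ hc]
  exact hz

/-- Multiplication by a nonzero constant maps curves in E to curves in E. This is the identification
of tangent spaces used in `IsRightTranslate`. -/
theorem scale_mem_tangentE {z : CotC M} {c : ℂ} (hc : c ≠ 0) {w : CotVec}
    (hw : w ∈ F.tangentE z) : (w.1, c • w.2) ∈ F.tangentE (scaleCot c z) := by
  induction hw using Submodule.span_induction with
  | mem w hw =>
    obtain ⟨γ, hγ, hmem, rfl, rfl⟩ := hw
    refine Submodule.subset_span ⟨fun r => scaleCot c (γ r),
      fun r => contMDiffAt_scaleCot (hγ r) contDiffAt_const,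
      fun r => scaleCot_mem_contactForms (hmem r) hc, rfl, ?_⟩
    refine Eq.trans ?_ (mfderiv_scaleCot (l := fun _ => c) (hγ 0) contDiffAt_const 1).symm
    have h0 : fderiv ℝ (fun _ : ℝ => c) 0 1 = 0 := by simp
    have h1 : ∀ a b : E3 →L[ℝ] ℂ, c • a = c • a + (0 : ℂ) • b := fun a b => by
      ext v
      change c * a v = c * a v + 0 * b v
      ring
    rw [h0]
    exact Prod.ext rfl (h1 _ _)
  | zero =>
    have h0 : ((0 : CotVec).1, c • (0 : CotVec).2) = 0 := 
      Prod.ext rfl (show c • (0 : E3 →L[ℝ] ℂ) = 0 from by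
        ext v; exact mul_zero c)
    rw [h0]
    exact Submodule.zero_mem _
  | add w w' _ _ h h' => simpa using Submodule.add_mem _ h h'
  | smul r w _ h => 
    have := Submodule.smul_mem _ r h
    rwa [Prod.smul_mk, smul_comm] at this

theorem velocity_section_fst {s : GlobalSection F} {n : ℕ} {q : EuclideanSpace ℝ (Fin n) → M}
    (hq : IsPlot q) (t u : EuclideanSpace ℝ (Fin n)) :
    (AdaptedCoframe.velocity (s.toFun ∘ q) t u).1 = mfderiv (𝓡 n) (𝓡 3) q t u := by
  have hb : ContMDiff (𝓡 n) cotModel ∞ (fun r => ((s.toFun ∘ q) r).base) :=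
    contMDiffOn_univ.1 (s.smooth _ q hq).1
  refine (congrArg Prod.fst (mfderiv_cot (hb t) u)).trans ?_
  have e : (fun r => ((s.toFun ∘ q) r).base.proj) = q := funext fun r => s.pt_eq (q r)
  have hcongr : ∀ f g : EuclideanSpace ℝ (Fin n) → M, f = g →
      (mfderiv (𝓡 n) (𝓡 3) f t u : E3) = mfderiv (𝓡 n) (𝓡 3) g t u := by
    rintro f _ rfl; rfl
  exact hcongr _ _ e

/-- A section lifts the velocities of plots of M to E, and the velocities of the inverse of a chart
fill the tangent space of M. -/
theorem exists_mem_tangentE (s : GlobalSection F) (x : M) (u : E3) :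
    ∃ w ∈ F.tangentE (s.toFun x).base, w.1 = u := by
  obtain ⟨e, he, hx, -⟩ := exists_isFullChart isOpen_univ (Set.mem_univ x)
  obtain ⟨v, hv⟩ := (he.mfderiv_symm_bijective (e x)).2 u
  have h := AdaptedCoframe.velocity_mem (s.toFun ∘ e.symm) (s.smooth _ _ he.isPlot_symm) (e x) v
  rw [Function.comp_apply, e.left_inv hx] at h
  exact ⟨_, h, (velocity_section_fst he.isPlot_symm (e x) v).trans hv⟩

end Velocities

/-! ### Comparison of adapted coframes over one point, and the Borel group. -/

section PointwiseCoframes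

variable {M : Type*} [TopologicalSpace M] [ChartedSpace E3 M]

/-- The complex linear extension of a form on the model space, regarded as a form at `x`. -/
def extAt (x : M) (a : E3 →L[ℝ] ℂ) : (ℂ ⊗[ℝ] TangentSpace (𝓡 3) x) →ₗ[ℂ] ℂ :=
  complexExt (x := x) a

theorem extAt_tmul (x : M) (a : E3 →L[ℝ] ℂ) (c : ℂ) (u : E3) :
    extAt x a (c ⊗ₜ[ℝ] (show TangentSpace (𝓡 3) x from u)) = c * a u := by
  simp [extAt, complexExt]
  rfl

theorem extAt_comb (x : M) (a b c : E3 →L[ℝ] ℂ) (r s t : ℂ) :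
    extAt x (r • a + s • b + t • c) = r • extAt x a + s • extAt x b + t • extAt x c := by
  refine LinearMap.ext fun z => ?_
  induction z using TensorProduct.induction_on with
  | zero => simp
  | tmul k u =>
    have h : (r • a + s • b + t • c) u = r * a u + s * b u + t * c u := rfl
    have h1 := extAt_tmul x (r • a + s • b + t • c) k u
    rw [h] at h1
    refine h1.trans ?_
    simp only [LinearMap.add_apply, LinearMap.smul_apply, smul_eq_mul]
    refine Eq.trans ?_ (congrArg₂ (· + ·) (congrArg₂ (· + ·)
      (congrArg (r * ·) (extAt_tmul x a k u)) (congrArg (s * ·) (extAt_tmul x b k u)))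
      (congrArg (t * ·) (extAt_tmul x c k u))).symm
    ring
  | add z w hz hw => rw [map_add, map_add, hz, hw]

variable [IsManifold (𝓡 3) ∞ M] {F : FlagStructure M}

variable (F) in
/-- The conditions on the forms `ω`, `ω¹`, `ω²` of an adapted coframe at a point. -/
structure IsFlagCoframe (x : M) (p θ₁ θ₂ : E3 →L[ℝ] ℂ) : Prop where
  ker_eq : LinearMap.ker (extAt x p) = F.T₁ x ⊔ F.T₂ x
  eq_zero₁ : ∀ z ∈ F.T₂ x, extAt x θ₁ z = 0
  ne_zero₁ : ∀ z ∈ F.T₁ x, z ≠ 0 → extAt x θ₁ z ≠ 0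
  eq_zero₂ : ∀ z ∈ F.T₁ x, extAt x θ₂ z = 0
  ne_zero₂ : ∀ z ∈ F.T₂ x, z ≠ 0 → extAt x θ₂ z ≠ 0

/-- The form `ω²` of a coframe on the model space; similarly for `ω¹` and `ω` below. -/
def AdaptedCoframe.form₂ (y : AdaptedCoframe F) : E3 →L[ℝ] ℂ := y.θ₂

/-- The form `ω¹` of a coframe on the model space. -/
def AdaptedCoframe.form₁ (y : AdaptedCoframe F) : E3 →L[ℝ] ℂ := y.θ₁

/-- The form `ω` of a coframe on the model space. -/
def AdaptedCoframe.form₀ (y : AdaptedCoframe F) : E3 →L[ℝ] ℂ := cotForm y.base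

theorem AdaptedCoframe.isFlagCoframe (y : AdaptedCoframe F) :
    IsFlagCoframe F y.pt y.form₀ y.form₁ y.form₂ :=
  ⟨y.base_mem, y.θ₁_eq_zero, y.θ₁_ne_zero, y.θ₂_eq_zero, y.θ₂_ne_zero⟩

theorem IsSmoothLineField.exists_span {T : ∀ x : M, Submodule ℂ (ℂ ⊗[ℝ] TangentSpace (𝓡 3) x)}
    (hT : IsSmoothLineField T) (x : M) : ∃ v, v ≠ 0 ∧ T x = Submodule.span ℂ {v} := by
  obtain ⟨U, -, hx, V, W, -, -, h⟩ := hT x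
  exact ⟨_, (h x hx).1, (h x hx).2⟩

variable {x : M} {p θ₁ θ₂ p' θ₁' θ₂' : E3 →L[ℝ] ℂ}

/-- Otherwise the kernel would be the whole complexified tangent space, of dimension 3, although T₁
⊔ T₂ is spanned by two vectors. -/
theorem IsFlagCoframe.ne_zero (h : IsFlagCoframe F x p θ₁ θ₂) : ∃ u, p u ≠ 0 := by
  obtain ⟨v₁, -, hs₁⟩ := F.smooth₁.exists_span x
  obtain ⟨v₂, -, hs₂⟩ := F.smooth₂.exists_span x
  by_contra! hp
  have hp0 : extAt x p = 0 := by
    have : p = (0 : ℂ) • p + (0 : ℂ) • p + (0 : ℂ) • p := by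
      ext u; rw [hp]; change 0 = 0 * p u + 0 * p u + 0 * p u; ring
    rw [this, extAt_comb]
    simp
  have hk := h.ker_eq
  rw [hp0, LinearMap.ker_zero, hs₁, hs₂, ← Submodule.span_union] at hk
  have h1 : Module.finrank ℂ (ℂ ⊗[ℝ] TangentSpace (𝓡 3) x) = 3 := by
    rw [Module.finrank_baseChange]
    exact finrank_euclideanSpace_fin
  classical
  have h2 := finrank_span_finset_le_card (R := ℂ) ({v₁, v₂} : Finset (ℂ ⊗[ℝ] TangentSpace (𝓡 3) x))
  have h3 : (({v₁, v₂} : Finset _) : Set (ℂ ⊗[ℝ] TangentSpace (𝓡 3) x)) = {v₁} ∪ {v₂} := by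
    ext; simp [or_comm]
  rw [Set.finrank, h3, ← hk, finrank_top, h1] at h2
  exact absurd (h2.trans Finset.card_le_two) (by norm_num)

/-- Subtract multiples of θ₁ and θ₂ so that the remainder vanishes on T₁ and T₂. Its kernel then
contains that of p, which makes it a multiple of p. -/
theorem IsFlagCoframe.exists_comb (h : IsFlagCoframe F x p θ₁ θ₂) (a : E3 →L[ℝ] ℂ) :
    ∃ r s t : ℂ, a = r • p + s • θ₁ + t • θ₂ := by
  obtain ⟨v₁, hv₁, hs₁⟩ := F.smooth₁.exists_span x
  obtain ⟨v₂, hv₂, hs₂⟩ := F.smooth₂.exists_span x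
  have m₁ : v₁ ∈ F.T₁ x := hs₁ ▸ Submodule.mem_span_singleton_self v₁
  have m₂ : v₂ ∈ F.T₂ x := hs₂ ▸ Submodule.mem_span_singleton_self v₂
  obtain ⟨u₀, hu₀⟩ := h.ne_zero
  let s := extAt x a v₁ / extAt x θ₁ v₁
  let t := extAt x a v₂ / extAt x θ₂ v₂
  let b : E3 →L[ℝ] ℂ := (1 : ℂ) • a + (-s) • θ₁ + (-t) • θ₂
  have hb : extAt x b = (1 : ℂ) • extAt x a + (-s) • extAt x θ₁ + (-t) • extAt x θ₂ :=
    extAt_comb x _ _ _ _ _ _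
  have hb₁ : extAt x b v₁ = 0 := by
    have h1 := h.ne_zero₁ v₁ m₁ hv₁
    simp [hb, h.eq_zero₂ v₁ m₁, s, h1]
  have hb₂ : extAt x b v₂ = 0 := by
    have h1 := h.ne_zero₂ v₂ m₂ hv₂
    simp [hb, h.eq_zero₁ v₂ m₂, t, h1]
  have hker : LinearMap.ker (extAt x p) ≤ LinearMap.ker (extAt x b) := by
    rw [h.ker_eq, hs₁, hs₂, sup_le_iff, Submodule.span_singleton_le_iff_mem,
      Submodule.span_singleton_le_iff_mem]
    exact ⟨hb₁, hb₂⟩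
  refine ⟨b u₀ / p u₀, s, t, ?_⟩
  ext u
  -- A vector in the kernel of p which expresses b(u) by b(u₀).
  have h1 : (p u₀ ⊗ₜ[ℝ] (show TangentSpace (𝓡 3) x from u)
      - p u ⊗ₜ[ℝ] (show TangentSpace (𝓡 3) x from u₀)) ∈ LinearMap.ker (extAt x p) := by
    rw [LinearMap.mem_ker, map_sub, extAt_tmul, extAt_tmul]; ring
  have h2 := hker h1
  rw [LinearMap.mem_ker, map_sub, extAt_tmul, extAt_tmul] at h2
  have h3 : ∀ u, b u = 1 * a u + -s * θ₁ u + -t * θ₂ u := fun u => rfl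
  change a u = b u₀ / p u₀ * p u + s * θ₁ u + t * θ₂ u
  rw [h3 u] at h2
  field_simp
  linear_combination h2

theorem IsFlagCoframe.isCoframe (h : IsFlagCoframe F x p θ₁ θ₂) : IsCoframe p θ₁ θ₂ := fun a => by
  obtain ⟨r, s, t, e⟩ := h.exists_comb (LinearMap.toContinuousLinearMap a)
  exact ⟨r, s, t, fun u => congrArg (fun L : E3 →L[ℝ] ℂ => L u) e⟩

/-- Each new form is expanded in the old coframe. Evaluation on generators of T₁ and T₂ shows which
coefficients vanish and which do not. -/
theorem IsFlagCoframe.compare (h : IsFlagCoframe F x p θ₁ θ₂)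
    (h' : IsFlagCoframe F x p' θ₁' θ₂') :
    ∃ l μ ν α β : ℂ, l ≠ 0 ∧ μ ≠ 0 ∧ ν ≠ 0 ∧ (∀ u, p' u = l * p u) ∧
      (∀ u, θ₁' u = μ * θ₁ u + α * p u) ∧ (∀ u, θ₂' u = ν * θ₂ u + β * p u) := by
  obtain ⟨v₁, hv₁, hs₁⟩ := F.smooth₁.exists_span x
  obtain ⟨v₂, hv₂, hs₂⟩ := F.smooth₂.exists_span x
  have m₁ : v₁ ∈ F.T₁ x := hs₁ ▸ Submodule.mem_span_singleton_self v₁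
  have m₂ : v₂ ∈ F.T₂ x := hs₂ ▸ Submodule.mem_span_singleton_self v₂
  have hp₁ : ∀ q : E3 →L[ℝ] ℂ, LinearMap.ker (extAt x q) = F.T₁ x ⊔ F.T₂ x →
      extAt x q v₁ = 0 ∧ extAt x q v₂ = 0 := fun q hq =>
    ⟨LinearMap.mem_ker.1 (hq ▸ Submodule.mem_sup_left m₁),
      LinearMap.mem_ker.1 (hq ▸ Submodule.mem_sup_right m₂)⟩
  have n₁ := h.ne_zero₁ v₁ m₁ hv₁
  have n₂ := h.ne_zero₂ v₂ m₂ hv₂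
  have n₁' := h'.ne_zero₁ v₁ m₁ hv₁
  have n₂' := h'.ne_zero₂ v₂ m₂ hv₂
  have ev : ∀ r s t : ℂ, extAt x (r • p + s • θ₁ + t • θ₂) v₁ = s * extAt x θ₁ v₁ ∧
      extAt x (r • p + s • θ₁ + t • θ₂) v₂ = t * extAt x θ₂ v₂ := fun r s t => by
    rw [extAt_comb]
    simp [(hp₁ p h.ker_eq).1, (hp₁ p h.ker_eq).2, h.eq_zero₂ v₁ m₁, h.eq_zero₁ v₂ m₂]
  obtain ⟨r0, s0, t0, e0⟩ := h.exists_comb p'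
  obtain ⟨r1, s1, t1, e1⟩ := h.exists_comb θ₁'
  obtain ⟨r2, s2, t2, e2⟩ := h.exists_comb θ₂'
  have hs0 : s0 = 0 := by
    have := (ev r0 s0 t0).1
    rw [← e0, (hp₁ p' h'.ker_eq).1] at this
    exact (mul_eq_zero.1 this.symm).resolve_right n₁
  have ht0 : t0 = 0 := by
    have := (ev r0 s0 t0).2
    rw [← e0, (hp₁ p' h'.ker_eq).2] at this
    exact (mul_eq_zero.1 this.symm).resolve_right n₂
  have ht1 : t1 = 0 := by
    have := (ev r1 s1 t1).2
    rw [← e1, h'.eq_zero₁ v₂ m₂] at this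
    exact (mul_eq_zero.1 this.symm).resolve_right n₂
  have hs2 : s2 = 0 := by
    have := (ev r2 s2 t2).1
    rw [← e2, h'.eq_zero₂ v₁ m₁] at this
    exact (mul_eq_zero.1 this.symm).resolve_right n₁
  have hs1 : s1 ≠ 0 := by
    have := (ev r1 s1 t1).1
    rw [← e1] at this
    exact left_ne_zero_of_mul (this ▸ n₁')
  have ht2 : t2 ≠ 0 := by
    have := (ev r2 s2 t2).2
    rw [← e2] at this
    exact left_ne_zero_of_mul (this ▸ n₂')
  have c0 : ∀ u, p' u = r0 * p u + s0 * θ₁ u + t0 * θ₂ u :=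
    fun u => congrArg (fun L : E3 →L[ℝ] ℂ => L u) e0
  have c1 : ∀ u, θ₁' u = r1 * p u + s1 * θ₁ u + t1 * θ₂ u :=
    fun u => congrArg (fun L : E3 →L[ℝ] ℂ => L u) e1
  have c2 : ∀ u, θ₂' u = r2 * p u + s2 * θ₁ u + t2 * θ₂ u :=
    fun u => congrArg (fun L : E3 →L[ℝ] ℂ => L u) e2
  refine ⟨r0, s1, t2, r1, r2, ?_, hs1, ht2, ?_, ?_, ?_⟩
  · rintro rfl
    obtain ⟨u, hu⟩ := h'.ne_zero
    exact hu (by rw [c0, hs0, ht0]; ring)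
  · intro u; rw [c0, hs0, ht0]; ring
  · intro u; rw [c1, ht1]; ring
  · intro u; rw [c2, hs2]; ring

theorem AdaptedCoframe.structure_phiAt (y : AdaptedCoframe F) {w w' : CotVec}
    (hw : w ∈ F.tangentE y.base) (hw' : w' ∈ F.tangentE y.base) :
    dTautForm w w' = (y.form₀ w.1 * y.phiAt w' - y.form₀ w'.1 * y.phiAt w)
      + (y.form₁ w.1 * y.form₂ w'.1 - y.form₁ w'.1 * y.form₂ w.1) := by
  rw [phiAt, phiAt, dif_pos hw, dif_pos hw']
  exact y.structure_eq ⟨w, hw⟩ ⟨w', hw'⟩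

/-- The scaling by l multiplies dω by l. Comparing the structure equations of y and y' therefore
gives ω ∧ X + (μν - l) ω¹ ∧ ω² = 0 with X = l(φ' - φ) - μβ ω¹ + αν ω². Multiplication by ω yields l
= μν, and then X is a multiple of ω. Thus only κ remains free. -/
theorem AdaptedCoframe.compare_phi {y y' : AdaptedCoframe F} {l μ ν α β : ℂ} (hl : l ≠ 0)
    (hb : y'.base = scaleCot l y.base) (hsurj : ∀ u : E3, ∃ w ∈ F.tangentE y.base, w.1 = u)
    (h₁ : ∀ u, y'.form₁ u = μ * y.form₁ u + α * y.form₀ u)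
    (h₂ : ∀ u, y'.form₂ u = ν * y.form₂ u + β * y.form₀ u) :
    l = μ * ν ∧ ∃ κ : ℂ, ∀ w ∈ F.tangentE y.base, y'.phiAt (w.1, l • w.2)
      = y.phiAt w + μ * β / l * y.form₁ w.1 - α * ν / l * y.form₂ w.1 + κ * y.form₀ w.1 := by
  have h₀ : ∀ u, y'.form₀ u = l * y.form₀ u := fun u => by
    rw [form₀, hb]; rfl
  have hm : ∀ w ∈ F.tangentE y.base, (w.1, l • w.2) ∈ F.tangentE y'.base := fun w hw => by
    rw [hb]; exact scale_mem_tangentE hl hw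
  obtain ⟨X, hX⟩ : ∃ X : CotVec → ℂ, ∀ w, X w = l * (y'.phiAt (w.1, l • w.2) - y.phiAt w)
      - μ * β * y.form₁ w.1 + α * ν * y.form₂ w.1 := ⟨_, fun w => rfl⟩
  have key : ∀ w ∈ F.tangentE y.base, ∀ w' ∈ F.tangentE y.base,
      y.form₀ w.1 * X w' - y.form₀ w'.1 * X w
        + (μ * ν - l) * (y.form₁ w.1 * y.form₂ w'.1 - y.form₁ w'.1 * y.form₂ w.1) = 0 := by
    intro w hw w' hw'
    have e := y.structure_phiAt hw hw'
    have e' := y'.structure_phiAt (hm w hw) (hm w' hw')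
    have ed : dTautForm (w.1, l • w.2) (w'.1, l • w'.2) = l * dTautForm w w' := by
      change l * w.2 w'.1 - l * w'.2 w.1 = l * (w.2 w'.1 - w'.2 w.1)
      ring
    rw [ed] at e'
    simp only [h₀, h₁, h₂] at e'
    rw [hX, hX]
    linear_combination l * e - e'
  have hμν : l = μ * ν := by
    obtain ⟨u, v, w, hD⟩ := y.isFlagCoframe.isCoframe.exists_ne_zero
    obtain ⟨wu, hu, rfl⟩ := hsurj u
    obtain ⟨wv, hv, rfl⟩ := hsurj v
    obtain ⟨ww, hw, rfl⟩ := hsurj w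
    have h := (mul_eq_zero.1 (show (μ * ν - l) * (_ : ℂ) = 0 by
      linear_combination y.form₀ ww.1 * key wu hu wv hv - y.form₀ wv.1 * key wu hu ww hw
        + y.form₀ wu.1 * key wv hv ww hw)).resolve_right hD
    linear_combination -h
  refine ⟨hμν, ?_⟩
  obtain ⟨u₀, hu₀⟩ := y.isFlagCoframe.ne_zero
  obtain ⟨w₀, hw₀, rfl⟩ := hsurj u₀
  -- From ω ∧ X = 0, the coefficient of X along ω is read off at a vector with ω(w₀) ≠ 0.
  refine ⟨X w₀ / (l * y.form₀ w₀.1), fun w hw => ?_⟩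
  have e := key w₀ hw₀ w hw
  have e' := hX w
  rw [← hμν] at e
  field_simp
  linear_combination e - y.form₀ w₀.1 * e'

/-- The element of the Borel group with prescribed action on coframes. -/
def borelMatrix (a l α β κ : ℂ) : Mat3 :=
  !![a, a / l * β, a / l / 4 * (κ - a * (a / l * β) * α / a ^ 2);
     0, l / a ^ 2, -α / (2 * a ^ 2); 0, 0, a / l]

theorem borelMatrix_mem {a l : ℂ} (ha : a ≠ 0) (hl : l ≠ 0) (α β κ : ℂ) :
    borelMatrix a l α β κ ∈ borel := by
  refine ⟨rfl, rfl, rfl, ?_⟩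
  rw [Matrix.det_fin_three]
  simp [borelMatrix]
  field_simp

/-- The entries of `borelMatrix` solve a/b = l, c/b = β, -2a²d = α and 4e/b - 2acd = κ in this
order. The equation a²b = μ then becomes a³ = lμ, and 1/(ab²) = ν follows from l = μν. -/
theorem isRightTranslate_borelMatrix {y y' : AdaptedCoframe F} {a l μ ν α β κ : ℂ}
    (ha : a ≠ 0) (hμ : μ ≠ 0) (hν : ν ≠ 0) (hlμ : l = μ * ν) (ha3 : a ^ 3 = l * μ)
    (hb : y'.base = scaleCot l y.base)
    (h₁ : ∀ u, y'.form₁ u = μ * y.form₁ u + α * y.form₀ u)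
    (h₂ : ∀ u, y'.form₂ u = ν * y.form₂ u + β * y.form₀ u)
    (hφ : ∀ w ∈ F.tangentE y.base, y'.phiAt (w.1, l • w.2)
      = y.phiAt w + μ * β / l * y.form₁ w.1 - α * ν / l * y.form₂ w.1 + κ * y.form₀ w.1) :
    IsRightTranslate y (borelMatrix a l α β κ) y' := by
  have hl : l ≠ 0 := hlμ ▸ mul_ne_zero hμ hν
  have hab : a / (a / l) = l := by field_simp
  have e1 : a ^ 2 * (a / l) = μ := by
    field_simp; linear_combination ha3
  have e2 : 1 / (a * (a / l) ^ 2) = ν := by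
    field_simp
    rw [ha3, hlμ]; ring
  refine ⟨?_, fun u => (h₁ u).trans ?_, fun u => (h₂ u).trans ?_, fun w hw => ?_⟩
  · simp only [borelMatrix, Matrix.of_apply, Matrix.cons_val]
    rw [hab]; exact hb
  · simp only [borelMatrix, Matrix.of_apply, Matrix.cons_val]
    change μ * y.form₁ u + α * y.form₀ u
      = a ^ 2 * (a / l) * y.form₁ u - 2 * a ^ 2 * (-α / (2 * a ^ 2)) * y.form₀ u
    rw [e1]; field_simp; ring
  · simp only [borelMatrix, Matrix.of_apply, Matrix.cons_val]
    change ν * y.form₂ u + β * y.form₀ u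
      = 1 / (a * (a / l) ^ 2) * y.form₂ u + a / l * β / (a / l) * y.form₀ u
    rw [e2]; field_simp
  · simp only [borelMatrix, Matrix.of_apply, Matrix.cons_val]
    rw [hab, hφ w hw]
    change _ = y.phiAt w + a * (a / l) * (a / l * β) * y.form₁ w.1
      + 2 * (-α / (2 * a ^ 2)) / (a / l) * y.form₂ w.1
      + (4 * (a / l / 4 * (κ - a * (a / l * β) * α / a ^ 2)) / (a / l)
        - 2 * a * (a / l * β) * (-α / (2 * a ^ 2))) * y.form₀ w.1
    have f1 : a * (a / l) * (a / l * β) = μ * β / l := by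
      rw [← e1]; field_simp
    have f2 : 2 * (-α / (2 * a ^ 2)) / (a / l) = -(α * ν / l) := by
      rw [← e2]; field_simp
    have f3 : 4 * (a / l / 4 * (κ - a * (a / l * β) * α / a ^ 2)) / (a / l)
        - 2 * a * (a / l * β) * (-α / (2 * a ^ 2)) = κ := by
      field_simp; ring
    rw [f1, f2, f3]; ring

/-- The quotient a/b is common, so a and b change by one factor ζ, and a²b being common forces ζ³ =
1. The other coefficients of the action, compared in the coframe, and the determinant show that each
remaining entry changes by the same factor. The kernel of the action is thus the centre of SL(3, ℂ).
-/
theorem IsRightTranslate.unique {y y' : AdaptedCoframe F} {g g' : Mat3} (hg : g ∈ borel)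
    (hg' : g' ∈ borel) (h : IsRightTranslate y g y') (h' : IsRightTranslate y g' y')
    (hsurj : ∀ u : E3, ∃ w ∈ F.tangentE y.base, w.1 = u) :
    ∃ ζ : ℂ, ζ ^ 3 = 1 ∧ g' = ζ • g := by
  obtain ⟨z1, z2, z3, hdet⟩ := hg
  obtain ⟨z1', z2', z3', hdet'⟩ := hg'
  rw [Matrix.det_fin_three, z1, z2, z3] at hdet
  rw [Matrix.det_fin_three, z1', z2', z3'] at hdet'
  obtain ⟨hb, h1, h2, h3⟩ := h
  obtain ⟨hb', h1', h2', h3'⟩ := h'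
  have hco := y.isFlagCoframe.isCoframe
  obtain ⟨u₀, hu₀⟩ := y.isFlagCoframe.ne_zero
  have ha : g 0 0 ≠ 0 := fun h0 => by simp [h0] at hdet
  have hbb : g 2 2 ≠ 0 := fun h0 => by simp [h0] at hdet
  have ha' : g' 0 0 ≠ 0 := fun h0 => by simp [h0] at hdet'
  have hbb' : g' 2 2 ≠ 0 := fun h0 => by simp [h0] at hdet'
  have hl : g 0 0 / g 2 2 = g' 0 0 / g' 2 2 := by
    have e := congrArg (fun z => cotForm z u₀) (hb.symm.trans hb')
    exact mul_right_cancel₀ hu₀ e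
  obtain ⟨c1, c2, -⟩ := hco.indep (c := -2 * g 0 0 ^ 2 * g 1 2 + 2 * g' 0 0 ^ 2 * g' 1 2)
    (c₁ := g 0 0 ^ 2 * g 2 2 - g' 0 0 ^ 2 * g' 2 2) (c₂ := 0) fun u => by
      have e := (h1 u).symm.trans (h1' u)
      change g 0 0 ^ 2 * g 2 2 * y.form₁ u - 2 * g 0 0 ^ 2 * g 1 2 * y.form₀ u
        = g' 0 0 ^ 2 * g' 2 2 * y.form₁ u - 2 * g' 0 0 ^ 2 * g' 1 2 * y.form₀ u at e
      linear_combination e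
  obtain ⟨c3, -, -⟩ := hco.indep (c := g 0 1 / g 2 2 - g' 0 1 / g' 2 2)
    (c₁ := 0) (c₂ := 1 / (g 0 0 * g 2 2 ^ 2) - 1 / (g' 0 0 * g' 2 2 ^ 2)) fun u => by
      have e := (h2 u).symm.trans (h2' u)
      change 1 / (g 0 0 * g 2 2 ^ 2) * y.form₂ u + g 0 1 / g 2 2 * y.form₀ u
        = 1 / (g' 0 0 * g' 2 2 ^ 2) * y.form₂ u + g' 0 1 / g' 2 2 * y.form₀ u at e
      linear_combination e
  obtain ⟨c4, -, -⟩ := hco.indep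
    (c := 4 * g 0 2 / g 2 2 - 2 * g 0 0 * g 0 1 * g 1 2
      - (4 * g' 0 2 / g' 2 2 - 2 * g' 0 0 * g' 0 1 * g' 1 2))
    (c₁ := g 0 0 * g 2 2 * g 0 1 - g' 0 0 * g' 2 2 * g' 0 1)
    (c₂ := 2 * g 1 2 / g 2 2 - 2 * g' 1 2 / g' 2 2) fun u => by
      obtain ⟨w, hw, rfl⟩ := hsurj u
      have e0 := h3' w hw
      rw [← hl] at e0
      have e := (h3 w hw).symm.trans e0
      change y.phiAt w + g 0 0 * g 2 2 * g 0 1 * y.form₁ w.1 + 2 * g 1 2 / g 2 2 * y.form₂ w.1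
          + (4 * g 0 2 / g 2 2 - 2 * g 0 0 * g 0 1 * g 1 2) * y.form₀ w.1
        = y.phiAt w + g' 0 0 * g' 2 2 * g' 0 1 * y.form₁ w.1 + 2 * g' 1 2 / g' 2 2 * y.form₂ w.1
          + (4 * g' 0 2 / g' 2 2 - 2 * g' 0 0 * g' 0 1 * g' 1 2) * y.form₀ w.1 at e
      linear_combination e
  obtain ⟨ζ, hζ⟩ : ∃ ζ, g' 0 0 = ζ * g 0 0 := ⟨g' 0 0 / g 0 0, by field_simp⟩
  have hζ0 : ζ ≠ 0 := fun h0 => ha' (by rw [hζ, h0, zero_mul])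
  have e22 : g' 2 2 = ζ * g 2 2 := by
    rw [hζ] at hl
    field_simp at hl
    linear_combination hl
  have hζ3 : ζ ^ 3 = 1 := by
    rw [hζ, e22] at c2
    have : (ζ ^ 3 - 1) * (g 0 0 ^ 2 * g 2 2) = 0 := by linear_combination -c2
    have h0 := (mul_eq_zero.1 this).resolve_right (mul_ne_zero (pow_ne_zero 2 ha) hbb)
    linear_combination h0
  have e12 : g' 1 2 = ζ * g 1 2 := by
    rw [hζ] at c1
    have : 2 * g 0 0 ^ 2 * (ζ ^ 2 * g' 1 2 - g 1 2) = 0 := by linear_combination c1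
    have h0 := (mul_eq_zero.1 this).resolve_left (mul_ne_zero two_ne_zero (pow_ne_zero 2 ha))
    linear_combination ζ * h0 - g' 1 2 * hζ3
  have e01 : g' 0 1 = ζ * g 0 1 := by
    rw [e22] at c3
    field_simp at c3
    linear_combination -c3
  have e02 : g' 0 2 = ζ * g 0 2 := by
    rw [e22, e12, e01, hζ] at c4
    field_simp at c4
    refine mul_left_cancel₀ (show (4 : ℂ) ≠ 0 by norm_num) ?_
    linear_combination -c4 + 2 * ζ * g 2 2 * g 0 0 * g 0 1 * g 1 2 * hζ3
  have e11 : g' 1 1 = ζ * g 1 1 := by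
    rw [hζ, e22] at hdet'
    linear_combination -g' 1 1 * hdet + ζ * g 1 1 * hdet'
      - g 0 0 * g 1 1 * g 2 2 * g' 1 1 * hζ3
  refine ⟨ζ, hζ3, ?_⟩
  ext i j
  rw [Matrix.smul_apply, smul_eq_mul]
  fin_cases i <;> fin_cases j
  · exact hζ
  · exact e01
  · exact e02
  · exact z1'.trans (by simp [z1])
  · exact e11
  · exact e12
  · exact z2'.trans (by simp [z2])
  · exact z3'.trans (by simp [z3])
  · exact e22

end PointwiseCoframes

/-! ### Values of forms along plots, and the cubic trace. -/

section PlotValues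

variable {X : Type*} [DiffeologicalSpace X] {n : ℕ} {p : EuclideanSpace ℝ (Fin n) → X}

/-- The value of a form of degree one along a plot. -/
def DiffForm.val (α : DiffForm X 1) (hp : IsPlot p) (t u : EuclideanSpace ℝ (Fin n)) : ℂ :=
  α.onPlot p hp t (fun _ => u)

/-- The derivative of the values of a form of degree one along a plot: the values of the form on
the constant vector field `v` are differentiated in the direction `u`. -/
def DiffForm.dval (α : DiffForm X 1) (hp : IsPlot p) (t u v : EuclideanSpace ℝ (Fin n)) : ℂ :=
  fderiv ℝ (fun r => α.val hp r v) t u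

namespace DiffForm

variable (α β : DiffForm X 1) (c : ℂ) (hp : IsPlot p) (t u v : EuclideanSpace ℝ (Fin n))

theorem val_contDiff : ContDiff ℝ ∞ (fun r => α.val hp r u) :=
  ContDiff.alternating_apply (α.contDiff p hp) _

theorem val_differentiable : DifferentiableAt ℝ (fun r => α.val hp r u) t :=
  (α.val_contDiff hp u).differentiable (by simp) t

theorem neg_val : (-α).val hp t u = -α.val hp t u := rfl

theorem sub_onPlot {k : ℕ} (α β : DiffForm X k) :
    (α - β).onPlot p hp t = α.onPlot p hp t - β.onPlot p hp t := by
  rw [sub_eq_add_neg, add_onPlot, neg_onPlot, sub_eq_add_neg]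

theorem sub_val : (α - β).val hp t u = α.val hp t u - β.val hp t u := by
  rw [val, sub_onPlot]; rfl

theorem smul_val : (c • α).val hp t u = c * α.val hp t u := rfl

theorem sub_dval : (α - β).dval hp t u v = α.dval hp t u v - β.dval hp t u v := by
  simp only [dval, sub_val]
  rw [fderiv_fun_sub (α.val_differentiable hp t v) (β.val_differentiable hp t v)]
  rfl

theorem smul_dval : (c • α).dval hp t u v = c * α.dval hp t u v := by
  simp only [dval, smul_val]
  rw [fderiv_const_mul (α.val_differentiable hp t v)]
  rfl

theorem d_onPlot_pair : α.d.onPlot p hp t ![u, v] = α.dval hp t u v - α.dval hp t v u :=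
  extDeriv_one_apply ((α.contDiff p hp).differentiable (by simp) t) _

theorem wedge_onPlot_pair : (α.wedge β).onPlot p hp t ![u, v]
    = α.val hp t u * β.val hp t v - α.val hp t v * β.val hp t u :=
  wedgeAlt_one_one _ _ _

theorem smul_wedge_onPlot_pair : (c • α.wedge β).onPlot p hp t ![u, v]
    = c * (α.val hp t u * β.val hp t v - α.val hp t v * β.val hp t u) :=
  congrArg (c * ·) (wedgeAlt_one_one _ _ _)

theorem exists_linear_val : ∃ L : EuclideanSpace ℝ (Fin n) →ₗ[ℝ] ℂ, ∀ u, L u = α.val hp t u :=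
  ⟨((ContinuousAlternatingMap.ofSubsingletonLIE (𝕜 := ℝ) (E := EuclideanSpace ℝ (Fin n)) (F := ℂ)
    (0 : Fin 1)).symm (α.onPlot p hp t)).toLinearMap, fun _ => rfl⟩

theorem ext_val {E : Type*} [NormedAddCommGroup E] [NormedSpace ℝ E] {a b : E [⋀^Fin 2]→L[ℝ] ℂ}
    (h : ∀ u v, a ![u, v] = b ![u, v]) : a = b := by
  ext w
  have : w = ![w 0, w 1] := by funext i; fin_cases i <;> rfl
  rw [this, h]

end DiffForm

/-- The values of a matrix of forms of degree one along a plot. -/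
def plotMatrix (A : Matrix (Fin 3) (Fin 3) (DiffForm X 1)) (hp : IsPlot p)
    (t u : EuclideanSpace ℝ (Fin n)) : Mat3 :=
  Matrix.of fun i j => (A i j).val hp t u

theorem plotMatrix_smooth (A : Matrix (Fin 3) (Fin 3) (DiffForm X 1)) (hp : IsPlot p)
    (u : EuclideanSpace ℝ (Fin n)) : MatSmooth (fun t => plotMatrix A hp t u) :=
  fun i j => (A i j).val_contDiff hp u

/-- The triple exterior product is a signed sum over six orders of the arguments; cyclic invariance
of the trace collapses it to two terms, each taken three times. -/
theorem traceCube_onPlot (A : Matrix (Fin 3) (Fin 3) (DiffForm X 1)) (hp : IsPlot p)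
    (t : EuclideanSpace ℝ (Fin n)) (v : Fin 3 → EuclideanSpace ℝ (Fin n)) :
    (traceCube A).onPlot p hp t v = 3 * (plotMatrix A hp t (v 0)
      * (plotMatrix A hp t (v 1) * plotMatrix A hp t (v 2)
        - plotMatrix A hp t (v 2) * plotMatrix A hp t (v 1))).trace := by
  have hz : ∀ {k : ℕ} (f : Fin 3 → DiffForm X k), (∑ i, f i).onPlot p hp t
      = ∑ i, (f i).onPlot p hp t := fun f => by
    rw [Fin.sum_univ_three, Fin.sum_univ_three, DiffForm.add_onPlot, DiffForm.add_onPlot]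
  have hw : ∀ α β γ : DiffForm X 1, (α.wedge (β.wedge γ)).onPlot p hp t v
      = α.val hp t (v 0) * (β.val hp t (v 1) * γ.val hp t (v 2)
          - β.val hp t (v 2) * γ.val hp t (v 1))
        - α.val hp t (v 1) * (β.val hp t (v 0) * γ.val hp t (v 2)
          - β.val hp t (v 2) * γ.val hp t (v 0))
        + α.val hp t (v 2) * (β.val hp t (v 0) * γ.val hp t (v 1)
          - β.val hp t (v 1) * γ.val hp t (v 0)) := fun α β γ => by
    refine (wedgeAlt_one_two _ _ _).trans ?_
    rw [β.wedge_onPlot_pair γ, β.wedge_onPlot_pair γ, β.wedge_onPlot_pair γ]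
    rfl
  have hs : (traceCube A).onPlot p hp t v
      = (plotMatrix A hp t (v 0) * plotMatrix A hp t (v 1) * plotMatrix A hp t (v 2)).trace
      - (plotMatrix A hp t (v 0) * plotMatrix A hp t (v 2) * plotMatrix A hp t (v 1)).trace
      - (plotMatrix A hp t (v 1) * plotMatrix A hp t (v 0) * plotMatrix A hp t (v 2)).trace
      + (plotMatrix A hp t (v 1) * plotMatrix A hp t (v 2) * plotMatrix A hp t (v 0)).trace
      + (plotMatrix A hp t (v 2) * plotMatrix A hp t (v 0) * plotMatrix A hp t (v 1)).trace
      - (plotMatrix A hp t (v 2) * plotMatrix A hp t (v 1) * plotMatrix A hp t (v 0)).trace := by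
    have hl : (traceCube A).onPlot p hp t v
        = ∑ i, ∑ j, ∑ k, ((A i j).wedge ((A j k).wedge (A k i))).onPlot p hp t v := by
      simp only [traceCube, hz, ContinuousAlternatingMap.sum_apply]
    have hm : ∀ X Y Z : Mat3, (X * Y * Z).trace = ∑ i, ∑ j, ∑ k, X i j * Y j k * Z k i := by
      intro X Y Z
      simp only [Matrix.trace, Matrix.diag, Matrix.mul_apply, Finset.sum_mul]
      exact Finset.sum_congr rfl fun i _ => Finset.sum_comm
    simp only [hl, hw, hm, ← Finset.sum_add_distrib, ← Finset.sum_sub_distrib]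
    refine Finset.sum_congr rfl fun i _ => Finset.sum_congr rfl fun j _ =>
      Finset.sum_congr rfl fun k _ => ?_
    simp only [plotMatrix, Matrix.of_apply]
    ring
  rw [hs, trace_rotate (plotMatrix A hp t (v 1)) (plotMatrix A hp t (v 0)),
    trace_rotate (plotMatrix A hp t (v 2)) (plotMatrix A hp t (v 0)),
    trace_rotate (plotMatrix A hp t (v 1)) (plotMatrix A hp t (v 2)),
    trace_rotate (plotMatrix A hp t (v 2)) (plotMatrix A hp t (v 1)) (plotMatrix A hp t (v 0)),
    trace_rotate (plotMatrix A hp t (v 2)) (plotMatrix A hp t (v 0)) (plotMatrix A hp t (v 1)),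
    trace_rotate (plotMatrix A hp t (v 1)) (plotMatrix A hp t (v 0)) (plotMatrix A hp t (v 2)),
    mul_sub, Matrix.trace_sub, ← mul_assoc, ← mul_assoc]
  ring

end PlotValues

/-! ### The curvature of the adapted connection. -/

section Connection

variable {M : Type*} [TopologicalSpace M] [ChartedSpace E3 M] [IsManifold (𝓡 3) ∞ M]
variable {F : FlagStructure M} (c : CanonicalForms F) {n : ℕ}
  {p : EuclideanSpace ℝ (Fin n) → AdaptedCoframe F} (hp : IsPlot p)
  (t u v : EuclideanSpace ℝ (Fin n))

theorem connection_trace : plotMatrix c.connection hp t u 0 0 + plotMatrix c.connection hp t u 1 1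
    + plotMatrix c.connection hp t u 2 2 = 0 := by
  simp only [plotMatrix, CanonicalForms.connection, Matrix.of_apply, Matrix.cons_val,
    DiffForm.sub_val, DiffForm.smul_val]
  ring

theorem connection_curvature_entry (i j : Fin 3) :
    curvature (plotMatrix c.connection hp) t u v i j
      = (c.connection i j).dval hp t u v - (c.connection i j).dval hp t v u
      + (((c.connection i 0).val hp t u * (c.connection 0 j).val hp t v
        + (c.connection i 1).val hp t u * (c.connection 1 j).val hp t v
        + (c.connection i 2).val hp t u * (c.connection 2 j).val hp t v)
      - ((c.connection i 0).val hp t v * (c.connection 0 j).val hp t u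
        + (c.connection i 1).val hp t v * (c.connection 1 j).val hp t u
        + (c.connection i 2).val hp t v * (c.connection 2 j).val hp t u)) :=
  curvature_entry _ _ _ _ _

/-- The entries on and below the diagonal are combinations of the structure equations for ω, ω¹, ω²,
φ and ω₁¹, with the coefficients of `CanonicalForms.connection`. -/
theorem connection_curvature_lower (i j : Fin 3) (h : j ≤ i) :
    curvature (plotMatrix c.connection hp) t u v i j = 0 := by
  have e0 := congrArg (fun α => α.onPlot p hp t ![u, v]) c.d_om
  have e1 := congrArg (fun α => α.onPlot p hp t ![u, v]) c.d_om₁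
  have e2 := congrArg (fun α => α.onPlot p hp t ![u, v]) c.d_om₂
  have e3 := congrArg (fun α => α.onPlot p hp t ![u, v]) c.d_φ
  have e4 := congrArg (fun α => α.onPlot p hp t ![u, v]) c.d_om₁₁
  simp only [DiffForm.d_onPlot_pair, DiffForm.add_onPlot, DiffForm.sub_onPlot,
    ContinuousAlternatingMap.add_apply, ContinuousAlternatingMap.sub_apply,
    DiffForm.wedge_onPlot_pair, DiffForm.smul_wedge_onPlot_pair] at e0 e1 e2 e3 e4
  rw [connection_curvature_entry]
  fin_cases i <;> fin_cases j <;> first | exact absurd h (by decide) | skip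
  all_goals
    simp only [CanonicalForms.connection, Matrix.of_apply, Matrix.cons_val, Fin.zero_eta,
      Fin.mk_one, Fin.reduceFinMk, DiffForm.sub_val, DiffForm.smul_val, DiffForm.neg_val,
      DiffForm.sub_dval, DiffForm.smul_dval]
  · linear_combination -(1 / 2) * e3 - 1 / 3 * e4
  · linear_combination e1
  · linear_combination 2 / 3 * e4
  · linear_combination 2 * e0
  · linear_combination 2 * e2
  · linear_combination 1 / 2 * e3 - 1 / 3 * e4

theorem connection_curvature_upper : ∃ Q : ℂ, ∀ u v,
    curvature (plotMatrix c.connection hp) t u v 1 2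
      = Q * (plotMatrix c.connection hp t u 2 0 * plotMatrix c.connection hp t v 2 1
        - plotMatrix c.connection hp t v 2 0 * plotMatrix c.connection hp t u 2 1) := by
  obtain ⟨Q, hQ⟩ := c.d_φ₁
  -- The (1,2) entry contains φ¹/2, which gives Q/2. The entries 20 and 21 are 2ω and 2ω², which
  -- gives a further factor 1/4.
  refine ⟨Q (p t) / 8, fun u v => ?_⟩
  have e := congrArg (fun α => α ![u, v]) (hQ p hp t)
  simp only [DiffForm.d_onPlot_pair, DiffForm.sub_onPlot, ContinuousAlternatingMap.smul_apply,
    ContinuousAlternatingMap.sub_apply, DiffForm.wedge_onPlot_pair,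
    DiffForm.smul_wedge_onPlot_pair, smul_eq_mul] at e
  rw [connection_curvature_entry]
  simp only [plotMatrix, CanonicalForms.connection, Matrix.of_apply, Matrix.cons_val,
    DiffForm.sub_val, DiffForm.smul_val, DiffForm.smul_dval]
  linear_combination 1 / 2 * e

end Connection

/-! ### Pullbacks of the connection by sections, in terms of the coframes. -/

section SectionForms

variable {M : Type*} [TopologicalSpace M] [ChartedSpace E3 M] [IsManifold (𝓡 3) ∞ M]
variable {F : FlagStructure M} (c : CanonicalForms F) (s : GlobalSection F) {n : ℕ}
  {q : EuclideanSpace ℝ (Fin n) → M} (hq : IsPlot q) (t u : EuclideanSpace ℝ (Fin n))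

/-- The values of the pullback `s^* π` of the adapted connection along a plot of `M`. -/
def sectionMatrix : Mat3 := plotMatrix c.connection (s.smooth n q hq) t u

theorem sectionMatrix_20 : sectionMatrix c s hq t u 2 0
    = 2 * (s.toFun (q t)).form₀ (mfderiv (𝓡 n) (𝓡 3) q t u) := by
  have e := c.om_taut _ (s.smooth n q hq) t (fun _ => u)
  refine congrArg (2 * ·) (e.trans ?_)
  exact congrArg (s.toFun (q t)).form₀ (velocity_section_fst hq t u)

theorem sectionMatrix_10 : sectionMatrix c s hq t u 1 0
    = (s.toFun (q t)).form₁ (mfderiv (𝓡 n) (𝓡 3) q t u) := by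
  have e := c.om₁_taut _ (s.smooth n q hq) t (fun _ => u)
  refine e.trans ?_
  exact congrArg (s.toFun (q t)).form₁ (velocity_section_fst hq t u)

theorem sectionMatrix_21 : sectionMatrix c s hq t u 2 1
    = 2 * (s.toFun (q t)).form₂ (mfderiv (𝓡 n) (𝓡 3) q t u) := by
  have e := c.om₂_taut _ (s.smooth n q hq) t (fun _ => u)
  refine congrArg (2 * ·) (e.trans ?_)
  exact congrArg (s.toFun (q t)).form₂ (velocity_section_fst hq t u)

theorem sectionMatrix_diag : sectionMatrix c s hq t u 2 2 - sectionMatrix c s hq t u 0 0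
    = (s.toFun (q t)).phiAt (AdaptedCoframe.velocity (s.toFun ∘ q) t u) := by
  have e := c.φ_taut _ (s.smooth n q hq) t (fun _ => u)
  change c.φ.val (s.smooth n q hq) t u = _ at e
  refine Eq.trans ?_ e
  simp only [sectionMatrix, plotMatrix, CanonicalForms.connection, Matrix.of_apply,
    Matrix.cons_val, DiffForm.sub_val, DiffForm.smul_val]
  ring

theorem velocity_section_mem (s : GlobalSection F) {q : EuclideanSpace ℝ (Fin n) → M}
    (hq : IsPlot q) (t u : EuclideanSpace ℝ (Fin n)) : AdaptedCoframe.velocity (s.toFun ∘ q) t u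
    ∈ F.tangentE (s.toFun (q t)).base :=
  AdaptedCoframe.velocity_mem _ (s.smooth n q hq) t u

/-- Two sections whose base points in the bundle of contact forms differ by a smooth factor. -/
theorem phiAt_velocity_of_scale {s s' : GlobalSection F} {q : EuclideanSpace ℝ (Fin n) → M}
    (hq : IsPlot q) {l : EuclideanSpace ℝ (Fin n) → ℂ} {t : EuclideanSpace ℝ (Fin n)}
    (hl : ContDiffAt ℝ ∞ l t) (hl0 : l t ≠ 0)
    (hb : ∀ᶠ r in 𝓝 t, (s'.toFun (q r)).base = scaleCot (l r) (s.toFun (q r)).base)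
    (u : EuclideanSpace ℝ (Fin n)) :
    (s'.toFun (q t)).phiAt (AdaptedCoframe.velocity (s'.toFun ∘ q) t u)
      = (s'.toFun (q t)).phiAt ((AdaptedCoframe.velocity (s.toFun ∘ q) t u).1,
          l t • (AdaptedCoframe.velocity (s.toFun ∘ q) t u).2) - fderiv ℝ l t u / l t := by
  have hsm : ContMDiff (𝓡 n) cotModel ∞ (fun r => ((s.toFun ∘ q) r).base) :=
    contMDiffOn_univ.1 (s.smooth _ q hq).1
  have hbt := hb.self_of_nhds
  obtain ⟨w, hw⟩ : ∃ w, w = AdaptedCoframe.velocity (s.toFun ∘ q) t u := ⟨_, rfl⟩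
  have hwm : w ∈ F.tangentE (s.toFun (q t)).base := hw ▸ velocity_section_mem s hq t u
  have hv : AdaptedCoframe.velocity (s'.toFun ∘ q) t u
      = (w.1, l t • w.2 + fderiv ℝ l t u • cotForm (s.toFun (q t)).base) := by
    have e1 := mfderiv_scaleCot (hsm t) hl u
    rw [hw]
    refine Eq.trans ?_ e1
    have hcongr : ∀ f g : EuclideanSpace ℝ (Fin n) → CotC M, f =ᶠ[𝓝 t] g →
        (mfderiv (𝓡 n) cotModel f t u : CotVec) = mfderiv (𝓡 n) cotModel g t u := by
      intro f g hfg
      exact congrArg (fun L : EuclideanSpace ℝ (Fin n) →L[ℝ] CotVec => L u) hfg.mfderiv_eq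
    exact hcongr _ _ hb
  have m1 : (w.1, l t • w.2) ∈ F.tangentE (s'.toFun (q t)).base := by
    rw [hbt]; exact scale_mem_tangentE hl0 hwm
  have m2 := velocity_section_mem s' hq t u
  obtain ⟨u₀, hu₀⟩ := (s'.toFun (q t)).isFlagCoframe.ne_zero
  obtain ⟨w₀, hw₀, rfl⟩ := exists_mem_tangentE s' (q t) u₀
  -- The two vectors differ by a vertical vector of E. Evaluating the structure equation of `s'` on
  -- each of them together with a fixed w₀, where ω(w₀) ≠ 0, determines the change of φ.
  have e1 := (s'.toFun (q t)).structure_phiAt m1 hw₀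
  have e2 := (s'.toFun (q t)).structure_phiAt m2 hw₀
  have h0 : (s'.toFun (q t)).form₀ w₀.1 = l t * cotForm (s.toFun (q t)).base w₀.1 := by
    rw [AdaptedCoframe.form₀, hbt]; rfl
  rw [hv] at e2
  rw [← hw, hv]
  simp only at e1 e2
  have ed : dTautForm (w.1, l t • w.2 + fderiv ℝ l t u • cotForm (s.toFun (q t)).base) w₀
      = dTautForm (w.1, l t • w.2) w₀
        + fderiv ℝ l t u * cotForm (s.toFun (q t)).base w₀.1 := by
    change (l t * w.2 w₀.1 + fderiv ℝ l t u * cotForm (s.toFun (q t)).base w₀.1) - w₀.2 w.1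
      = (l t * w.2 w₀.1 - w₀.2 w.1) + fderiv ℝ l t u * cotForm (s.toFun (q t)).base w₀.1
    ring
  rw [ed] at e2
  rw [h0] at hu₀
  have hp0 := right_ne_zero_of_mul hu₀
  rw [h0] at e1 e2
  refine mul_left_cancel₀ hu₀ ?_
  rw [mul_sub, show l t * cotForm (s.toFun (q t)).base w₀.1 * (fderiv ℝ l t u / l t)
    = cotForm (s.toFun (q t)).base w₀.1 * fderiv ℝ l t u by field_simp]
  linear_combination e2 - e1

end SectionForms

/-! ### Explicit formulas for upper triangular gauges. -/

section BorelMatrices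

theorem borel_det {g : Mat3} (hg : g ∈ borel) : g 0 0 * g 1 1 * g 2 2 = 1 := by
  obtain ⟨h1, h2, h3, hd⟩ := hg
  rw [Matrix.det_fin_three, h1, h2, h3] at hd
  linear_combination hd

theorem borel_inv {g : Mat3} (hg : g ∈ borel) : g⁻¹ =
    !![g 1 1 * g 2 2, -(g 0 1 * g 2 2), g 0 1 * g 1 2 - g 0 2 * g 1 1;
       0, g 0 0 * g 2 2, -(g 0 0 * g 1 2); 0, 0, g 0 0 * g 1 1] := by
  have hd := borel_det hg
  obtain ⟨h1, h2, h3, -⟩ := hg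
  refine Matrix.inv_eq_left_inv ?_
  ext i j
  fin_cases i <;> fin_cases j <;>
    simp only [Matrix.mul_apply, Fin.sum_univ_three, Matrix.of_apply, Matrix.cons_val,
      Fin.zero_eta, Fin.mk_one, Fin.reduceFinMk, h1, h2, h3]
  · simp; linear_combination hd
  · simp; ring
  · simp; ring
  · simp
  · simp; linear_combination hd
  · simp; ring
  · simp
  · simp
  · simp; linear_combination hd

theorem borel_inv_mul {g : Mat3} (hg : g ∈ borel) : g⁻¹ * g = 1 :=
  Matrix.nonsing_inv_mul g (by rw [hg.2.2.2]; exact isUnit_one)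

variable {E : Type*} [NormedAddCommGroup E] [NormedSpace ℝ E]

/-- With determinant one the inverse is polynomial in the entries, so smoothness requires no
division. -/
theorem MatSmooth.inv_borel {g : E → Mat3} (hg : MatSmooth g) (hb : ∀ t, g t ∈ borel) :
    MatSmooth (fun t => (g t)⁻¹) := fun i j => by
  simp only [fun t => borel_inv (hb t)]
  fin_cases i <;> fin_cases j <;>
    simp only [Matrix.of_apply, Matrix.cons_val, Fin.zero_eta, Fin.mk_one, Fin.reduceFinMk]
  · exact (hg 1 1).mul (hg 2 2)
  · exact ((hg 0 1).mul (hg 2 2)).neg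
  · exact ((hg 0 1).mul (hg 1 2)).sub ((hg 0 2).mul (hg 1 1))
  · exact contDiff_const
  · exact (hg 0 0).mul (hg 2 2)
  · exact ((hg 0 0).mul (hg 1 2)).neg
  · exact contDiff_const
  · exact contDiff_const
  · exact (hg 0 0).mul (hg 1 1)

theorem matDeriv_lower {g : E → Mat3} (hb : ∀ t, g t ∈ borel) (t u : E) :
    matDeriv g t u 1 0 = 0 ∧ matDeriv g t u 2 0 = 0 ∧ matDeriv g t u 2 1 = 0 := by
  refine ⟨?_, ?_, ?_⟩
  · rw [matDeriv_apply, show (fun s => g s 1 0) = fun _ => 0 from funext fun s => (hb s).1]; simp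
  · rw [matDeriv_apply, show (fun s => g s 2 0) = fun _ => 0 from funext fun s => (hb s).2.1]; simp
  · rw [matDeriv_apply, show (fun s => g s 2 1) = fun _ => 0 from funext fun s => (hb s).2.2.1]
    simp

theorem matDeriv_diag {g : E → Mat3} (hg : MatSmooth g) (hb : ∀ t, g t ∈ borel) (t u : E) :
    matDeriv g t u 0 0 * (g t 1 1 * g t 2 2) + g t 0 0 * matDeriv g t u 1 1 * g t 2 2
      + g t 0 0 * g t 1 1 * matDeriv g t u 2 2 = 0 := by
  have h := ((hg.differentiable t 0 0).hasFDerivAt.mul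
    (hg.differentiable t 1 1).hasFDerivAt).mul (hg.differentiable t 2 2).hasFDerivAt
  have h2 := (h.congr_of_eventuallyEq (f₁ := fun _ => (1 : ℂ)) (Filter.Eventually.of_forall
    fun s => (borel_det (hb s)).symm)).unique (hasFDerivAt_const (1 : ℂ) t)
  have h3 := congrArg (fun L : E →L[ℝ] ℂ => L u) h2
  simp only [add_apply, smul_apply, smul_eq_mul, zero_apply, smul_add, Pi.mul_apply] at h3
  simp only [matDeriv_apply]
  linear_combination h3

theorem gaugeTransform_apply {A : E → E → Mat3} {g : E → Mat3} (hb : ∀ t, g t ∈ borel) (t u : E) :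
    gaugeTransform A g (fun t => (g t)⁻¹) t u
      = !![g t 1 1 * g t 2 2, -(g t 0 1 * g t 2 2), g t 0 1 * g t 1 2 - g t 0 2 * g t 1 1;
       0, g t 0 0 * g t 2 2, -(g t 0 0 * g t 1 2); 0, 0, g t 0 0 * g t 1 1]
        * (A t u * g t + matDeriv g t u) := by
  rw [gaugeTransform, borel_inv (hb t), mul_add, mul_assoc]

/-- These are the entries needed for `IsNormal`. Since the diagonal entries have product 1, the
derivative terms in the fourth formula are minus the logarithmic derivative of g₀₀ / g₂₂, the factor
by which the point of E moves. -/
theorem gaugeTransform_entries {A : E → E → Mat3} {g : E → Mat3} (hg : MatSmooth g)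
    (hb : ∀ t, g t ∈ borel) (t u : E) :
    gaugeTransform A g (fun t => (g t)⁻¹) t u 2 0 = g t 0 0 ^ 2 * g t 1 1 * A t u 2 0 ∧
    gaugeTransform A g (fun t => (g t)⁻¹) t u 1 0
      = g t 0 0 ^ 2 * (g t 2 2 * A t u 1 0 - g t 1 2 * A t u 2 0) ∧
    gaugeTransform A g (fun t => (g t)⁻¹) t u 2 1
      = g t 0 0 * g t 1 1 * (g t 0 1 * A t u 2 0 + g t 1 1 * A t u 2 1) ∧
    gaugeTransform A g (fun t => (g t)⁻¹) t u 2 2 - gaugeTransform A g (fun t => (g t)⁻¹) t u 0 0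
      = A t u 2 2 - A t u 0 0 + g t 0 0 * g t 2 2 * g t 0 1 * A t u 1 0
        + g t 0 0 * g t 1 1 * g t 1 2 * A t u 2 1
        + (2 * g t 0 0 * g t 1 1 * g t 0 2 - g t 0 0 * g t 0 1 * g t 1 2) * A t u 2 0
        + g t 0 0 * g t 1 1 * matDeriv g t u 2 2 - g t 1 1 * g t 2 2 * matDeriv g t u 0 0 ∧
    gaugeTransform A g (fun t => (g t)⁻¹) t u 0 0 + gaugeTransform A g (fun t => (g t)⁻¹) t u 1 1
      + gaugeTransform A g (fun t => (g t)⁻¹) t u 2 2 = A t u 0 0 + A t u 1 1 + A t u 2 2 := by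
  have hd := borel_det (hb t)
  obtain ⟨h1, h2, h3, -⟩ := hb t
  obtain ⟨d1, d2, d3⟩ := matDeriv_lower hb t u
  have d4 := matDeriv_diag hg hb t u
  simp only [gaugeTransform_apply hb, Matrix.mul_apply, Fin.sum_univ_three, Matrix.of_apply,
    Matrix.cons_val, Matrix.add_apply, h1, h2, h3, d1, d2, d3]
  refine ⟨by ring, by ring, by ring, ?_, ?_⟩
  · linear_combination (A t u 2 2 - A t u 0 0) * hd
  · linear_combination (A t u 0 0 + A t u 1 1 + A t u 2 2) * hd + d4

/-- The strictly upper triangular matrices are an ideal of the upper triangular ones, and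
conjugation acts on the entry 12 modulo the corner by the ratio of the diagonal entries, g₂₂ / g₁₁.
-/
theorem conj_borel_entries {g K : Mat3} (hb : g ∈ borel) (hK : ∀ i j, j ≤ i → K i j = 0) :
    (∀ i j, j ≤ i → (g⁻¹ * K * g) i j = 0) ∧
      (g⁻¹ * K * g) 1 2 = g 0 0 * g 2 2 ^ 2 * K 1 2 := by
  have hd := borel_det hb
  rw [borel_inv hb]
  obtain ⟨h1, h2, h3, -⟩ := hb
  have k1 := hK 0 0 le_rfl
  have k2 := hK 1 1 le_rfl
  have k3 := hK 2 2 le_rfl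
  have k4 := hK 1 0 (by decide)
  have k5 := hK 2 0 (by decide)
  have k6 := hK 2 1 (by decide)
  constructor
  · intro i j hij
    fin_cases i <;> fin_cases j <;> first | exact absurd hij (by decide) | skip
    all_goals
      simp only [Matrix.mul_apply, Fin.sum_univ_three, Matrix.of_apply, Matrix.cons_val,
        Fin.zero_eta, Fin.mk_one, Fin.reduceFinMk, h1, h2, h3, k1, k2, k3, k4, k5, k6]
      ring
  · simp only [Matrix.mul_apply, Fin.sum_univ_three, Matrix.of_apply, Matrix.cons_val,
      k2, k3, k4, k5, k6]
    ring

/-- A strictly upper triangular matrix times an upper triangular one has zero diagonal. This removes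
the curvature terms from `transgression_formula`. -/
theorem trace_mul_borel_deriv {g K D : Mat3} (hb : g ∈ borel) (hK : ∀ i j, j ≤ i → K i j = 0)
    (hD : D 1 0 = 0 ∧ D 2 0 = 0 ∧ D 2 1 = 0) : (K * (D * g⁻¹)).trace = 0 := by
  rw [borel_inv hb, Matrix.trace_fin_three]
  simp [Matrix.mul_apply, Fin.sum_univ_three, hD, hK 0 0 le_rfl, hK 1 1 le_rfl, hK 2 2 le_rfl,
    hK 1 0 (by decide), hK 2 0 (by decide), hK 2 1 (by decide)]

theorem mul_borel_inv_lower {g D : Mat3} (hb : g ∈ borel)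
    (hD : D 1 0 = 0 ∧ D 2 0 = 0 ∧ D 2 1 = 0) :
    (D * g⁻¹) 1 0 = 0 ∧ (D * g⁻¹) 2 0 = 0 ∧ (D * g⁻¹) 2 1 = 0 := by
  rw [borel_inv hb]
  simp [Matrix.mul_apply, Fin.sum_univ_three, hD]

/-- A commutator of upper triangular matrices is strictly upper triangular. This removes tr θ³. -/
theorem trace_commutator_upper {X Y Z : Mat3} (hX : X 1 0 = 0 ∧ X 2 0 = 0 ∧ X 2 1 = 0)
    (hY : Y 1 0 = 0 ∧ Y 2 0 = 0 ∧ Y 2 1 = 0) (hZ : Z 1 0 = 0 ∧ Z 2 0 = 0 ∧ Z 2 1 = 0) :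
    (X * (Y * Z - Z * Y)).trace = 0 := by
  rw [Matrix.trace_fin_three]
  simp only [Matrix.mul_apply, Fin.sum_univ_three, Matrix.sub_apply, hX, hY, hZ]
  ring

end BorelMatrices

/-! ### The gauge law for the adapted connection and the variation of TC₂. -/

section GaugeLaw

variable {M : Type*} [TopologicalSpace M] [ChartedSpace E3 M] [IsManifold (𝓡 3) ∞ M]
variable {F : FlagStructure M} (c : CanonicalForms F) {s s' : GlobalSection F}
  {U : Set M} {h : M → Mat3} {e : OpenPartialHomeomorph M E3}

theorem IsCoframe.comp {o o₁ o₂ : E3 → ℂ} (ho : IsCoframe o o₁ o₂) {L : E3 →ₗ[ℝ] E3}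
    (hL : Function.Bijective L) :
    IsCoframe (fun u => o (L u)) (fun u => o₁ (L u)) (fun u => o₂ (L u)) := fun a => by
  obtain ⟨x, y, z, hx⟩ := ho (a.comp (LinearEquiv.ofBijective L hL).symm.toLinearMap)
  refine ⟨x, y, z, fun u => ?_⟩
  rw [← hx (L u)]
  exact congrArg a ((LinearEquiv.ofBijective L hL).symm_apply_apply u).symm

theorem IsCoframe.scale {o o₁ o₂ : E3 → ℂ} (ho : IsCoframe o o₁ o₂) {k k₁ k₂ : ℂ} (h0 : k ≠ 0)
    (h1 : k₁ ≠ 0) (h2 : k₂ ≠ 0) :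
    IsCoframe (fun u => k * o u) (fun u => k₁ * o₁ u) (fun u => k₂ * o₂ u) := fun a => by
  obtain ⟨x, y, z, hx⟩ := ho a
  refine ⟨x / k, y / k₁, z / k₂, fun u => ?_⟩
  rw [hx u]
  field_simp

theorem isNormal_sectionMatrix (s : GlobalSection F) {q : E3 → M} (hq : IsPlot q) :
    IsNormal (sectionMatrix c s hq) where
  smooth u := plotMatrix_smooth _ _ u
  linear t i j := (c.connection i j).exists_linear_val (s.smooth 3 q hq) t
  trace t u := connection_trace c _ t u
  lower t u v i j hij := connection_curvature_lower c _ t u v i j hij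
  upper t := connection_curvature_upper c _ t

theorem isCoframe_sectionMatrix (s : GlobalSection F) (he : IsFullChart e) (t : E3) :
    IsCoframe (fun u => sectionMatrix c s he.isPlot_symm t u 2 0)
      (fun u => sectionMatrix c s he.isPlot_symm t u 1 0)
      (fun u => sectionMatrix c s he.isPlot_symm t u 2 1) := by
  simp only [sectionMatrix_20, sectionMatrix_10, sectionMatrix_21]
  have h1 := (s.toFun (e.symm t)).isFlagCoframe.isCoframe
  have h2 := (h1.comp (L := (mfderiv (𝓡 3) (𝓡 3) e.symm t : E3 →L[ℝ] E3).toLinearMap)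
    (he.mfderiv_symm_bijective t)).scale (k := 2) (k₁ := 1) (k₂ := 2) (by simp) (by simp) (by simp)
  simp only [one_mul] at h2
  exact h2

theorem IsNormal.gaugeTransform {A : E3 → E3 → Mat3} (hA : IsNormal A) {g : E3 → Mat3}
    (hg : MatSmooth g) (hb : ∀ t, g t ∈ borel) :
    IsNormal (gaugeTransform A g (fun t => (g t)⁻¹)) where
  smooth u := gaugeTransform_smooth hA.smooth hg (hg.inv_borel hb) u
  linear t i j := by
    choose L hL using fun i j => hA.linear t i j
    let D : Fin 3 → Fin 3 → (E3 →ₗ[ℝ] ℂ) := fun i j => (fderiv ℝ (fun s => g s i j) t).toLinearMap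
    refine ⟨∑ k, (LinearMap.mulLeft ℝ ((g t)⁻¹ i k)).comp
      (∑ l, (LinearMap.mulRight ℝ (g t l j)).comp (L k l) + D k j), fun u => ?_⟩
    simp only [LinearMap.sum_apply, LinearMap.comp_apply, LinearMap.add_apply,
      LinearMap.mulLeft_apply, LinearMap.mulRight_apply, hL]
    rw [FlagGeometry.gaugeTransform, mul_assoc, ← mul_add, Matrix.mul_apply]
    rfl
  trace t u := by
    rw [(gaugeTransform_entries hg hb t u).2.2.2.2]
    exact hA.trace t u
  lower t u v := by
    rw [curvature_gaugeTransform hA.smooth hg (hg.inv_borel hb) (fun t => borel_inv_mul (hb t))]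
    exact (conj_borel_entries (hb t) (hA.lower t u v)).1
  upper t := by
    obtain ⟨Q, hQ⟩ := hA.upper t
    -- The curvature entry acquires g₀₀ g₂₂², while A₂₀ ∧ A₂₁ acquires (g₀₀ g₁₁)³, the inverse of
    -- g₂₂³.
    refine ⟨Q * g t 0 0 * g t 2 2 ^ 5, fun u v => ?_⟩
    rw [curvature_gaugeTransform hA.smooth hg (hg.inv_borel hb) (fun t => borel_inv_mul (hb t)),
      (conj_borel_entries (hb t) (hA.lower t u v)).2, hQ,
      (gaugeTransform_entries hg hb t u).1, (gaugeTransform_entries hg hb t u).2.2.1,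
      (gaugeTransform_entries hg hb t v).1, (gaugeTransform_entries hg hb t v).2.2.1]
    have hd : (g t 0 0 * g t 1 1 * g t 2 2) ^ 3 = 1 := by rw [borel_det (hb t), one_pow]
    linear_combination -(g t 0 0 * g t 2 2 ^ 2 * Q
      * (A t u 2 0 * A t v 2 1 - A t v 2 0 * A t u 2 1)) * hd

theorem IsGaugeOn.matSmooth (hh : IsGaugeOn s s' U h) {n : ℕ} {q : EuclideanSpace ℝ (Fin n) → M}
    (hq : IsPlot q) (hU : ∀ t, q t ∈ U) : MatSmooth (fun t => h (q t)) := fun i j =>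
  contMDiff_iff_contDiff.1 ((hh.1 i j).comp_contMDiff hq hU)

/-- Both sides are normal, so by `IsNormal.ext` only the entries given by ω, ω¹, ω² and φ need to be
compared. For these the assertion is the definition of the action, together with the vertical
contribution to φ. A chart onto ℝ³ is used so that the pulled back forms are a coframe. -/
theorem sectionMatrix_gauge (hh : IsGaugeOn s s' U h) (he : IsFullChart e) (hU : e.source ⊆ U) :
    gaugeTransform (sectionMatrix c s he.isPlot_symm) (fun t => h (e.symm t))
      (fun t => (h (e.symm t))⁻¹) = sectionMatrix c s' he.isPlot_symm := by
  have hmem : ∀ t, e.symm t ∈ U := fun t => hU (he.mem_source t)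
  have hg := hh.matSmooth he.isPlot_symm hmem
  have hb : ∀ t, h (e.symm t) ∈ borel := fun t => (hh.2 _ (hmem t)).1
  have hr := fun t => (hh.2 _ (hmem t)).2
  have hent := gaugeTransform_entries (A := sectionMatrix c s he.isPlot_symm) hg hb
  have hdet := fun t => borel_det (hb t)
  have h22 : ∀ t, h (e.symm t) 2 2 ≠ 0 := fun t h0 => by
    have := hdet t; rw [h0] at this; simp at this
  have h00 : ∀ t, h (e.symm t) 0 0 ≠ 0 := fun t h0 => by
    have := hdet t; rw [h0] at this; simp at this
  have h11 : ∀ t, h (e.symm t) 1 1 = 1 / (h (e.symm t) 0 0 * h (e.symm t) 2 2) := fun t => by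
    have := hdet t; have := h22 t; have := h00 t; field_simp; linear_combination hdet t
  refine (isNormal_sectionMatrix c s' he.isPlot_symm).ext
    ((isNormal_sectionMatrix c s he.isPlot_symm).gaugeTransform hg hb) ?_ ?_ ?_ ?_
    (isCoframe_sectionMatrix c s' he)
  · intro t u
    rw [(hent t u).2.1, sectionMatrix_10, sectionMatrix_10, sectionMatrix_20]
    have e1 := (hr t).2.1 (mfderiv (𝓡 3) (𝓡 3) e.symm t u)
    refine Eq.trans ?_ e1.symm
    change _ = h (e.symm t) 0 0 ^ 2 * h (e.symm t) 2 2
        * (s.toFun (e.symm t)).form₁ (mfderiv (𝓡 3) (𝓡 3) e.symm t u)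
      - 2 * h (e.symm t) 0 0 ^ 2 * h (e.symm t) 1 2
        * (s.toFun (e.symm t)).form₀ (mfderiv (𝓡 3) (𝓡 3) e.symm t u)
    ring
  · intro t u
    rw [(hent t u).1, sectionMatrix_20, sectionMatrix_20]
    have e1 := congrArg (fun z => cotForm z (mfderiv (𝓡 3) (𝓡 3) e.symm t u)) (hr t).1
    change (s'.toFun (e.symm t)).form₀ (mfderiv (𝓡 3) (𝓡 3) e.symm t u)
      = h (e.symm t) 0 0 / h (e.symm t) 2 2
        * (s.toFun (e.symm t)).form₀ (mfderiv (𝓡 3) (𝓡 3) e.symm t u) at e1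
    rw [e1, h11]
    have := h00 t
    have := h22 t
    field_simp
  · intro t u
    rw [(hent t u).2.2.1, sectionMatrix_21, sectionMatrix_21, sectionMatrix_20]
    have e1 := (hr t).2.2.1 (mfderiv (𝓡 3) (𝓡 3) e.symm t u)
    refine Eq.trans ?_ (congrArg (2 * ·) e1.symm)
    change _ = 2 * (1 / (h (e.symm t) 0 0 * h (e.symm t) 2 2 ^ 2)
        * (s.toFun (e.symm t)).form₂ (mfderiv (𝓡 3) (𝓡 3) e.symm t u)
      + h (e.symm t) 0 1 / h (e.symm t) 2 2
        * (s.toFun (e.symm t)).form₀ (mfderiv (𝓡 3) (𝓡 3) e.symm t u))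
    rw [h11]
    have := h00 t
    have := h22 t
    field_simp
    ring
  · intro t u
    have hl : ContDiff ℝ ∞ (fun t => h (e.symm t) 0 0 / h (e.symm t) 2 2) := by
      simp only [div_eq_mul_inv]
      exact (hg 0 0).mul ((hg 2 2).inv h22)
    have e1 := phiAt_velocity_of_scale (s := s) (s' := s') he.isPlot_symm (t := t) hl.contDiffAt
      (div_ne_zero (h00 t) (h22 t)) (Filter.Eventually.of_forall fun r => (hr r).1) u
    have e2 := (hr t).2.2.2 _ (velocity_section_mem s he.isPlot_symm t u)
    rw [(hent t u).2.2.2.1, sectionMatrix_diag, sectionMatrix_diag, sectionMatrix_21,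
      sectionMatrix_20, sectionMatrix_10, e1]
    refine Eq.trans ?_ (congrArg (· - _) e2.symm)
    rw [velocity_section_fst he.isPlot_symm]
    change _ = (s.toFun (e.symm t)).phiAt (AdaptedCoframe.velocity (s.toFun ∘ e.symm) t u)
      + h (e.symm t) 0 0 * h (e.symm t) 2 2 * h (e.symm t) 0 1
        * (s.toFun (e.symm t)).form₁ (mfderiv (𝓡 3) (𝓡 3) e.symm t u)
      + 2 * h (e.symm t) 1 2 / h (e.symm t) 2 2
        * (s.toFun (e.symm t)).form₂ (mfderiv (𝓡 3) (𝓡 3) e.symm t u)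
      + (4 * h (e.symm t) 0 2 / h (e.symm t) 2 2
          - 2 * h (e.symm t) 0 0 * h (e.symm t) 0 1 * h (e.symm t) 1 2)
        * (s.toFun (e.symm t)).form₀ (mfderiv (𝓡 3) (𝓡 3) e.symm t u) - _
    -- The quotient rule, obtained by differentiating (h₀₀ / h₂₂) h₂₂ = h₀₀.
    have hdl : fderiv ℝ (fun t => h (e.symm t) 0 0 / h (e.symm t) 2 2) t u
        = (matDeriv (fun t => h (e.symm t)) t u 0 0 * h (e.symm t) 2 2
          - h (e.symm t) 0 0 * matDeriv (fun t => h (e.symm t)) t u 2 2) / h (e.symm t) 2 2 ^ 2 := by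
      have d1 := (hl.differentiable (by simp) t).hasFDerivAt.mul
        (hg.differentiable t 2 2).hasFDerivAt
      have d2 := (d1.congr_of_eventuallyEq (f₁ := fun t => h (e.symm t) 0 0)
        (Filter.Eventually.of_forall fun r => (div_mul_cancel₀ _ (h22 r)).symm)).unique
          (hg.differentiable t 0 0).hasFDerivAt
      have d3 := congrArg (fun L : E3 →L[ℝ] ℂ => L u) d2
      simp only [add_apply, smul_apply, smul_eq_mul] at d3
      simp only [matDeriv_apply]
      have := h22 t
      field_simp
      field_simp at d3
      linear_combination d3
    rw [hdl, h11]
    have := h00 t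
    have := h22 t
    field_simp
    ring

/-- The Chern-Simons identity with the gauge law inserted; triangularity removes every term except
the exact one. -/
theorem TC₂_gauge (hh : IsGaugeOn s s' U h) (he : IsFullChart e) (hU : e.source ⊆ U)
    (t : E3) (v : Fin 3 → E3) :
    (c.TC₂.pullback s'.toFun s'.smooth - c.TC₂.pullback s.toFun s.smooth).onPlot
        e.symm he.isPlot_symm t v
      = (-(1 / (8 * (Real.pi : ℂ) ^ 2))) *
        (fderiv ℝ (fun r => transgression (sectionMatrix c s he.isPlot_symm)
            (fun t => h (e.symm t)) (fun t => (h (e.symm t))⁻¹) r (v 1) (v 2)) t (v 0)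
          - fderiv ℝ (fun r => transgression (sectionMatrix c s he.isPlot_symm)
            (fun t => h (e.symm t)) (fun t => (h (e.symm t))⁻¹) r (v 0) (v 2)) t (v 1)
          + fderiv ℝ (fun r => transgression (sectionMatrix c s he.isPlot_symm)
            (fun t => h (e.symm t)) (fun t => (h (e.symm t))⁻¹) r (v 0) (v 1)) t (v 2)) := by
  have hmem : ∀ t, e.symm t ∈ U := fun t => hU (he.mem_source t)
  have hg := hh.matSmooth he.isPlot_symm hmem
  have hb : ∀ t, h (e.symm t) ∈ borel := fun t => (hh.2 _ (hmem t)).1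
  have hA := isNormal_sectionMatrix c s he.isPlot_symm
  have hTC : ∀ s : GlobalSection F, (c.TC₂.pullback s.toFun s.smooth).onPlot
      e.symm he.isPlot_symm t v = 1 / (24 * (Real.pi : ℂ) ^ 2)
        * (3 * (sectionMatrix c s he.isPlot_symm t (v 0)
        * (sectionMatrix c s he.isPlot_symm t (v 1) * sectionMatrix c s he.isPlot_symm t (v 2)
          - sectionMatrix c s he.isPlot_symm t (v 2)
            * sectionMatrix c s he.isPlot_symm t (v 1))).trace) := fun s =>
    congrArg (1 / (24 * (Real.pi : ℂ) ^ 2) * ·)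
      (traceCube_onPlot c.connection (s.smooth 3 _ he.isPlot_symm) t v)
  have hf := transgression_formula hA.smooth hg (hg.inv_borel hb)
    (fun t => borel_inv_mul (hb t)) t (v 0) (v 1) (v 2)
    (fun u => matDeriv (fun t => h (e.symm t)) t u * (h (e.symm t))⁻¹) (fun u => rfl)
  have hD := fun u => matDeriv_lower hb t u
  rw [sectionMatrix_gauge c hh he hU,
    trace_mul_borel_deriv (hb t) (hA.lower t (v 0) (v 1)) (hD (v 2)),
    trace_mul_borel_deriv (hb t) (hA.lower t (v 0) (v 2)) (hD (v 1)),
    trace_mul_borel_deriv (hb t) (hA.lower t (v 1) (v 2)) (hD (v 0)),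
    trace_commutator_upper (mul_borel_inv_lower (hb t) (hD (v 0)))
      (mul_borel_inv_lower (hb t) (hD (v 1))) (mul_borel_inv_lower (hb t) (hD (v 2)))] at hf
  rw [DiffForm.sub_onPlot, ContinuousAlternatingMap.sub_apply, hTC, hTC]
  have hpi : (Real.pi : ℂ) ≠ 0 := by exact_mod_cast Real.pi_ne_zero
  field_simp
  -- The factor 3 of `traceCube_onPlot` turns 1 / 24π² into 1 / 8π².
  linear_combination 24 * hf

end GaugeLaw

theorem contDiffAt_wedgeAlt {E D : Type*} [NormedAddCommGroup E] [NormedSpace ℝ E]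
    [NormedAddCommGroup D] [NormedSpace ℝ D] {k : ℕ}
    {a : D → E [⋀^Fin 1]→L[ℝ] ℂ} {b : D → E [⋀^Fin k]→L[ℝ] ℂ} {t : D}
    (ha : ContDiffAt ℝ ∞ a t) (hb : ContDiffAt ℝ ∞ b t) :
    ContDiffAt ℝ ∞ (fun t => wedgeAlt (a t) (b t)) t := by
  have h1 : ContDiffAt ℝ ∞ (fun t =>
      (ContinuousLinearMap.lsmul ℝ ℂ (E := E [⋀^Fin k]→L[ℝ] ℂ)).flip (b t)) t :=
    (ContinuousLinearMap.contDiff _).contDiffAt.comp t hb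
  have h2 : ContDiffAt ℝ ∞ (fun t => (ContinuousAlternatingMap.ofSubsingletonLIE
      (𝕜 := ℝ) (E := E) (F := ℂ) (0 : Fin 1)).symm (a t)) t :=
    (LinearIsometryEquiv.contDiff _).contDiffAt.comp t ha
  exact (ContinuousLinearMap.contDiff (𝕜 := ℝ) (E := E →L[ℝ] E [⋀^Fin k]→L[ℝ] ℂ)
    (F := E [⋀^Fin (k + 1)]→L[ℝ] ℂ)
    (ContinuousAlternatingMap.alternatizeUncurryFinCLM ℝ E ℂ)).contDiffAt.comp t
      (h1.clm_comp h2)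

theorem eventually_mem_of_isPlot {M : Type*} [TopologicalSpace M] [ChartedSpace E3 M]
    {U : Set M} {n : ℕ} {q : EuclideanSpace ℝ (Fin n) → M} (hU : IsOpen U) (hq : IsPlot q)
    {t : EuclideanSpace ℝ (Fin n)} (ht : q t ∈ U) : ∀ᶠ r in 𝓝 t, q r ∈ U := by
  have hqc : ContMDiff (𝓡 n) (𝓡 3) ∞ q := hq
  exact hqc.continuous.continuousAt.eventually (hU.mem_nhds ht)

/-! ### Differential forms are determined by their values in charts. -/

section Localization

variable {M : Type*} [TopologicalSpace M] [ChartedSpace E3 M] [IsManifold (𝓡 3) ∞ M]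

theorem DiffForm.onPlot_congr {X : Type*} [DiffeologicalSpace X] {k n : ℕ} (α : DiffForm X k)
    {p p' : EuclideanSpace ℝ (Fin n) → X} (hp : IsPlot p) (hp' : IsPlot p') (h : p = p')
    (t : EuclideanSpace ℝ (Fin n)) : α.onPlot p hp t = α.onPlot p' hp' t := by
  subst h; rfl

/-- The values of a form along two plots which are locally related by a smooth change of the
parameters. -/
theorem DiffForm.onPlot_of_factor {X : Type*} [DiffeologicalSpace X] {k n m : ℕ}
    (α : DiffForm X k) {q : EuclideanSpace ℝ (Fin n) → X} {p : EuclideanSpace ℝ (Fin m) → X}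
    (hq : IsPlot q) (hp : IsPlot p) {f : EuclideanSpace ℝ (Fin n) → EuclideanSpace ℝ (Fin m)}
    {U : Set (EuclideanSpace ℝ (Fin n))} (hU : IsOpen U) (hf : ContDiffOn ℝ ∞ f U)
    (hfac : ∀ r ∈ U, q r = p (f r)) {t : EuclideanSpace ℝ (Fin n)} (ht : t ∈ U) :
    α.onPlot q hq t = (α.onPlot p hp (f t)).compContinuousLinearMap (fderiv ℝ f t) := by
  -- The axiom `reparam` needs a map f defined and smooth on the whole parameter space, whereas f is
  -- controlled on U only. Both plots are therefore composed with a diffeomorphism of the whole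
  -- space onto a ball around t inside U, and its invertible derivative is cancelled at the end.
  obtain ⟨r, hr, hball⟩ := Metric.isOpen_iff.1 hU t ht
  let ρ := OpenPartialHomeomorph.univBall t r
  have hρ : ContDiff ℝ ∞ ρ := OpenPartialHomeomorph.contDiff_univBall
  have hρ0 : ρ 0 = t := OpenPartialHomeomorph.univBall_apply_zero t r
  have hρs : ρ.source = Set.univ := OpenPartialHomeomorph.univBall_source t r
  have hρt : ρ.target = Metric.ball t r := OpenPartialHomeomorph.univBall_target t hr
  have hmem : ∀ w, ρ w ∈ U := fun w => hball (hρt ▸ ρ.map_source (hρs ▸ Set.mem_univ w))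
  have hfρ : ContDiff ℝ ∞ (f ∘ ρ) := hf.comp_contDiff hρ hmem
  have hcomp : q ∘ ρ = p ∘ (f ∘ ρ) := funext fun w => hfac _ (hmem w)
  have hsurj : Function.Surjective (fderiv ℝ ρ 0) := by
    have h1 : DifferentiableAt ℝ ρ.symm t :=
      ((OpenPartialHomeomorph.contDiffOn_univBall_symm (n := 1)).contDiffAt
        (Metric.ball_mem_nhds t hr)).differentiableAt (by simp)
    have h2 : HasFDerivAt ρ (fderiv ℝ ρ 0) (ρ.symm t) := by
      rw [← hρ0, ρ.left_inv (hρs ▸ Set.mem_univ 0)]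
      exact (hρ.differentiable (by simp) 0).hasFDerivAt
    have h3 : (ρ ∘ ρ.symm) =ᶠ[𝓝 t] id := by
      filter_upwards [Metric.ball_mem_nhds t hr] with w hw
      exact ρ.right_inv (hρt ▸ hw)
    have h4 := (h2.comp t h1.hasFDerivAt).unique ((hasFDerivAt_id t).congr_of_eventuallyEq h3)
    exact fun v => ⟨fderiv ℝ ρ.symm t v,
      congrArg (fun L : EuclideanSpace ℝ (Fin n) →L[ℝ] EuclideanSpace ℝ (Fin n) => L v) h4⟩
  have hchain : fderiv ℝ (f ∘ ρ) 0 = (fderiv ℝ f t).comp (fderiv ℝ ρ 0) := by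
    have h1 : DifferentiableAt ℝ f (ρ 0) :=
      (hf.contDiffAt (hU.mem_nhds (hmem 0))).differentiableAt (by simp)
    rw [fderiv_comp 0 h1 (hρ.differentiable (by simp) 0), hρ0]
  have e1 := α.reparam q hq ρ hρ 0
  rw [α.onPlot_congr (isPlot_reparam hq hρ) (isPlot_reparam hp hfρ) hcomp,
    α.reparam p hp _ hfρ 0, hchain, Function.comp_apply, hρ0] at e1
  ext v
  choose w hw using fun i => hsurj (v i)
  have hv : v = fderiv ℝ ρ 0 ∘ w := funext fun i => (hw i).symm
  rw [hv]
  exact (congrArg (fun a : EuclideanSpace ℝ (Fin n) [⋀^Fin k]→L[ℝ] ℂ => a w) e1).symm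

/-- Two forms on a three-manifold which agree in charts are equal. -/
theorem DiffForm.ext_fullChart {k : ℕ} {α β : DiffForm M k}
    (h : ∀ x : M, ∃ (e : OpenPartialHomeomorph M E3) (he : IsFullChart e), x ∈ e.source ∧
      ∀ t, α.onPlot e.symm he.isPlot_symm t = β.onPlot e.symm he.isPlot_symm t) : α = β := by
  refine ext_onPlot fun {n} q hq t => ?_
  obtain ⟨e, he, hx, hab⟩ := h (q t)
  have hqc : ContMDiff (𝓡 n) (𝓡 3) ∞ q := hq
  have hU : IsOpen (q ⁻¹' e.source) := e.open_source.preimage hqc.continuous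
  have hf : ContDiffOn ℝ ∞ (fun r => e (q r)) (q ⁻¹' e.source) := by
    rw [← contMDiffOn_iff_contDiffOn]
    exact (contMDiffOn_of_mem_maximalAtlas he.1).comp hqc.contMDiffOn fun r hr => hr
  have hfac : ∀ r ∈ q ⁻¹' e.source, q r = e.symm (e (q r)) := fun r hr => (e.left_inv hr).symm
  rw [α.onPlot_of_factor hq he.isPlot_symm hU hf hfac hx,
    β.onPlot_of_factor hq he.isPlot_symm hU hf hfac hx, hab]

end Localization

/-! ### The two-form of a local gauge: independence of the gauge and gluing. -/

section GaugeTrace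

variable {M : Type*} [TopologicalSpace M] [ChartedSpace E3 M] [IsManifold (𝓡 3) ∞ M]
variable {F : FlagStructure M} (c : CanonicalForms F) {s s' : GlobalSection F}
  {U V : Set M} {h h' : M → Mat3} {n : ℕ} {q : EuclideanSpace ℝ (Fin n) → M}

theorem gaugeTrace_pair (s : GlobalSection F) (h : M → Mat3) (hq : IsPlot q)
    (t u v : EuclideanSpace ℝ (Fin n)) : gaugeTrace c s h q hq t ![u, v]
      = transgression (sectionMatrix c s hq) (fun t => h (q t)) (fun t => (h (q t))⁻¹) t u v := by
  have hm : ∀ X Y Z : Mat3, (X * Y * Z).trace = ∑ i, ∑ j, ∑ k, X i j * (Y j k * Z k i) := by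
    intro X Y Z
    simp only [Matrix.trace, Matrix.diag, Matrix.mul_apply, Finset.sum_mul, mul_assoc]
    exact Finset.sum_congr rfl fun i _ => Finset.sum_comm
  simp only [gaugeTrace, transgression, hm, ContinuousAlternatingMap.sum_apply,
    ContinuousAlternatingMap.smul_apply, wedgeAlt_one_one, oneForm_apply,
    ← Finset.sum_sub_distrib, smul_eq_mul]
  refine Finset.sum_congr rfl fun i _ => Finset.sum_congr rfl fun j _ =>
    Finset.sum_congr rfl fun k _ => ?_
  exact mul_sub _ _ _

theorem IsGaugeOn.contDiffAt (hh : IsGaugeOn s s' U h) (hU : IsOpen U) (hq : IsPlot q)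
    {t : EuclideanSpace ℝ (Fin n)} (ht : q t ∈ U) (i j : Fin 3) :
    ContDiffAt ℝ ∞ (fun r => h (q r) i j) t := by
  have hqc : ContMDiff (𝓡 n) (𝓡 3) ∞ q := hq
  rw [← contMDiffAt_iff_contDiffAt]
  exact ((hh.1 i j).contMDiffAt (hU.mem_nhds ht)).comp t (hqc t)

/-- By `IsRightTranslate.unique` h' = ζ h with ζ³ = 1. The factor ζ is a quotient of entries, hence
differentiable near the point, and its derivative vanishes. So h'⁻¹ contributes ζ⁻¹ and dh'
contributes ζ. -/
theorem gaugeTrace_eq (hU : IsOpen U) (hV : IsOpen V) (hh : IsGaugeOn s s' U h)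
    (hh' : IsGaugeOn s s' V h') (hq : IsPlot q) (t : EuclideanSpace ℝ (Fin n))
    (htU : q t ∈ U) (htV : q t ∈ V) :
    gaugeTrace c s h' q hq t = gaugeTrace c s h q hq t := by
  have hev := (eventually_mem_of_isPlot hU hq htU).and (eventually_mem_of_isPlot hV hq htV)
  have hz : ∀ r, q r ∈ U → q r ∈ V → ∃ ζ : ℂ, ζ ^ 3 = 1 ∧ h' (q r) = ζ • h (q r) :=
    fun r hrU hrV => (hh.2 _ hrU).2.unique (hh.2 _ hrU).1 (hh'.2 _ hrV).1 (hh'.2 _ hrV).2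
      (exists_mem_tangentE s (q r))
  have h00 : ∀ r, q r ∈ U → h (q r) 0 0 ≠ 0 := fun r hr h0 => by
    have := borel_det (hh.2 _ hr).1
    rw [h0] at this
    simp at this
  let Z : EuclideanSpace ℝ (Fin n) → ℂ := fun r => h' (q r) 0 0 * (h (q r) 0 0)⁻¹
  have hZ : ∀ r, q r ∈ U → q r ∈ V → Z r ^ 3 = 1 ∧ h' (q r) = Z r • h (q r) := by
    intro r hrU hrV
    obtain ⟨ζ, h1, h2⟩ := hz r hrU hrV
    have h3 : Z r = ζ := by
      have := h00 r hrU
      simp only [Z, h2, Matrix.smul_apply, smul_eq_mul]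
      field_simp
    rw [h3]
    exact ⟨h1, h2⟩
  have hZd : DifferentiableAt ℝ Z t :=
    ((hh'.contDiffAt hV hq htV 0 0).mul ((hh.contDiffAt hU hq htU 0 0).inv
      (h00 t htU))).differentiableAt (by simp)
  obtain ⟨hZ3, hZt⟩ := hZ t htU htV
  have hZ0 : Z t ≠ 0 := fun h0 => by rw [h0] at hZ3; simp at hZ3
  -- Differentiating ζ³ = 1 gives 3ζ² dζ = 0; no connectedness is needed.
  have hDZ : fderiv ℝ Z t = 0 := by
    have h1 := hZd.hasFDerivAt.pow 3
    have h2 := (h1.congr_of_eventuallyEq (f₁ := fun _ => (1 : ℂ))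
      (hev.mono fun r hr => (hZ r hr.1 hr.2).1.symm)).unique (hasFDerivAt_const (1 : ℂ) t)
    ext u
    have h3 := congrArg (fun L : EuclideanSpace ℝ (Fin n) →L[ℝ] ℂ => L u) h2
    simp only [smul_apply, smul_eq_mul, zero_apply] at h3 ⊢
    have h4 : (3 : ℂ) * Z t ^ 2 ≠ 0 := mul_ne_zero (by norm_num) (pow_ne_zero 2 hZ0)
    refine (mul_eq_zero.1 ?_).resolve_left h4
    simpa using h3
  have hD : ∀ u, matDeriv (fun r => h' (q r)) t u = Z t • matDeriv (fun r => h (q r)) t u := by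
    intro u
    ext i j
    have h1 : (fun r => h' (q r) i j) =ᶠ[𝓝 t] fun r => Z r * h (q r) i j :=
      hev.mono fun r hr => by
        change h' (q r) i j = _
        rw [(hZ r hr.1 hr.2).2]; rfl
    have h2 := hZd.hasFDerivAt.mul
      ((hh.contDiffAt hU hq htU i j).differentiableAt (by simp)).hasFDerivAt
    rw [matDeriv_apply, h1.fderiv_eq]
    have h3 : fderiv ℝ (fun r => Z r * h (q r) i j) t = _ := h2.fderiv
    rw [h3, hDZ]
    simp [matDeriv_apply]
  have hinv : (h' (q t))⁻¹ = (Z t)⁻¹ • (h (q t))⁻¹ := by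
    refine Matrix.inv_eq_left_inv ?_
    rw [hZt, Matrix.smul_mul, Matrix.mul_smul, smul_smul, inv_mul_cancel₀ hZ0, one_smul,
      borel_inv_mul (hh.2 _ htU).1]
  refine DiffForm.ext_val fun u v => ?_
  rw [gaugeTrace_pair, gaugeTrace_pair, transgression, transgression, hD, hD, hinv]
  simp only [Matrix.smul_mul, Matrix.mul_smul, smul_smul, mul_inv_cancel₀ hZ0, one_smul]

theorem contDiffAt_gaugeTrace (hU : IsOpen U) (hh : IsGaugeOn s s' U h) (hq : IsPlot q)
    {t : EuclideanSpace ℝ (Fin n)} (ht : q t ∈ U) :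
    ContDiffAt ℝ ∞ (gaugeTrace c s h q hq) t := by
  have hinv : ∀ i j, ContDiffAt ℝ ∞ (fun r => (h (q r))⁻¹ i j) t := by
    have hs := fun i j => hh.contDiffAt hU hq ht i j
    have hev := eventually_mem_of_isPlot hU hq ht
    intro i j
    have h1 : (fun r => (h (q r))⁻¹ i j) =ᶠ[𝓝 t] fun r => _ :=
      hev.mono fun r hr => congrArg (fun X : Mat3 => X i j) (borel_inv (hh.2 _ hr).1)
    refine ContDiffAt.congr_of_eventuallyEq ?_ h1
    fin_cases i <;> fin_cases j <;>
      simp only [Matrix.of_apply, Matrix.cons_val, Fin.zero_eta, Fin.mk_one, Fin.reduceFinMk]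
    · exact (hs 1 1).mul (hs 2 2)
    · exact ((hs 0 1).mul (hs 2 2)).neg
    · exact ((hs 0 1).mul (hs 1 2)).sub ((hs 0 2).mul (hs 1 1))
    · exact contDiffAt_const
    · exact (hs 0 0).mul (hs 2 2)
    · exact ((hs 0 0).mul (hs 1 2)).neg
    · exact contDiffAt_const
    · exact contDiffAt_const
    · exact (hs 0 0).mul (hs 1 1)
  unfold gaugeTrace
  refine ContDiffAt.sum fun i _ => ContDiffAt.sum fun j _ => ContDiffAt.sum fun k _ => ?_
  refine (hinv i j).smul ?_
  exact contDiffAt_wedgeAlt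
    (((c.connection j k).pullback s.toFun s.smooth).contDiff q hq).contDiffAt
    ((LinearIsometryEquiv.contDiff (ContinuousAlternatingMap.ofSubsingletonLIE (𝕜 := ℝ)
      (E := EuclideanSpace ℝ (Fin n)) (F := ℂ) (0 : Fin 1))).contDiffAt.comp t
      ((hh.contDiffAt hU hq ht k i).fderiv_right (m := ∞) (by simp)))

theorem gaugeTrace_reparam (hU : IsOpen U) (hh : IsGaugeOn s s' U h) (hq : IsPlot q) {m : ℕ}
    {f : EuclideanSpace ℝ (Fin m) → EuclideanSpace ℝ (Fin n)} (hf : ContDiff ℝ ∞ f)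
    {t : EuclideanSpace ℝ (Fin m)} (ht : q (f t) ∈ U) :
    gaugeTrace c s h (q ∘ f) (isPlot_reparam hq hf) t
      = (gaugeTrace c s h q hq (f t)).compContinuousLinearMap (fderiv ℝ f t) := by
  have hD : ∀ k i, oneForm (fderiv ℝ (fun r => h ((q ∘ f) r) k i) t)
      = (oneForm (fderiv ℝ (fun r => h (q r) k i) (f t))).compContinuousLinearMap
        (fderiv ℝ f t) := fun k i => by
    have h1 : HasFDerivAt (fun r => h ((q ∘ f) r) k i) _ t :=
      ((hh.contDiffAt hU hq ht k i).differentiableAt (by simp)).hasFDerivAt.comp t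
        (hf.differentiable (by simp) t).hasFDerivAt
    rw [h1.fderiv]
    rfl
  have hA : ∀ j k, ((c.connection j k).pullback s.toFun s.smooth).onPlot (q ∘ f)
      (isPlot_reparam hq hf) t = (((c.connection j k).pullback s.toFun s.smooth).onPlot q hq
        (f t)).compContinuousLinearMap (fderiv ℝ f t) := fun j k =>
    ((c.connection j k).pullback s.toFun s.smooth).reparam q hq f hf t
  ext v
  simp only [gaugeTrace, hD, hA, wedgeAlt_comp, ContinuousAlternatingMap.sum_apply,
    ContinuousAlternatingMap.smul_apply, ContinuousAlternatingMap.compContinuousLinearMap_apply]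
  rfl

/-- The global two-form which is given by `s^* tr (h⁻¹ π ∧ dh)` for all local gauges `h`. -/
theorem exists_gaugeForm (hex : ∀ x : M, ∃ (U : Set M) (h : M → Mat3),
      IsOpen U ∧ x ∈ U ∧ IsGaugeOn s s' U h) :
    ∃ β : DiffForm M 2, ∀ (U : Set M) (h : M → Mat3), IsOpen U → IsGaugeOn s s' U h →
      ∀ (n : ℕ) (q : EuclideanSpace ℝ (Fin n) → M) (hq : IsPlot q),
        ∀ t, q t ∈ U → β.onPlot q hq t = gaugeTrace c s h q hq t := by
  choose U h hU hx hh using hex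
  refine ⟨{
    -- The gauge used at t is the one chosen for the point q(t), so the value is compatible with
    -- changes of parameters. For smoothness near t it is replaced by one fixed gauge.
    onPlot := fun q hq t => gaugeTrace c s (h (q t)) q hq t
    contDiff := fun {n} q hq => contDiff_iff_contDiffAt.2 fun t => ?_
    reparam := fun {n m} q hq f hf t =>
      gaugeTrace_reparam c (hU (q (f t))) (hh (q (f t))) hq hf (hx (q (f t))) }, ?_⟩
  · refine (contDiffAt_gaugeTrace c (hU (q t)) (hh (q t)) hq (hx (q t))).congr_of_eventuallyEq ?_
    filter_upwards [eventually_mem_of_isPlot (hU (q t)) hq (hx (q t))] with r hr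
    exact gaugeTrace_eq c (hU (q t)) (hU (q r)) (hh (q t)) (hh (q r)) hq r hr (hx (q r))
  · intro V h' hV hh' n q hq t ht
    exact gaugeTrace_eq c hV (hU (q t)) hh' (hh (q t)) hq t ht (hx (q t))

/-- Both sides are forms on M, so it is enough to compare them in charts onto ℝ³ lying in the domain
of a gauge, where `TC₂_gauge` applies. -/
theorem TC₂_sub_eq {β : DiffForm M 2}
    (hex : ∀ x : M, ∃ (U : Set M) (h : M → Mat3), IsOpen U ∧ x ∈ U ∧ IsGaugeOn s s' U h)
    (hβ : ∀ (U : Set M) (h : M → Mat3), IsOpen U → IsGaugeOn s s' U h →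
      ∀ (n : ℕ) (q : EuclideanSpace ℝ (Fin n) → M) (hq : IsPlot q),
        ∀ t, q t ∈ U → β.onPlot q hq t = gaugeTrace c s h q hq t) :
    c.TC₂.pullback s'.toFun s'.smooth - c.TC₂.pullback s.toFun s.smooth
      = (-(1 / (8 * (Real.pi : ℂ) ^ 2))) • β.d := by
  refine DiffForm.ext_fullChart fun x => ?_
  obtain ⟨U, h, hU, hx, hh⟩ := hex x
  obtain ⟨e, he, hxe, heU⟩ := exists_isFullChart hU hx
  refine ⟨e, he, hxe, fun t => ?_⟩
  ext v
  rw [TC₂_gauge c hh he heU]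
  have h1 : β.d.onPlot e.symm he.isPlot_symm t v = _ :=
    extDeriv_two_apply ((β.contDiff _ he.isPlot_symm).differentiable (by simp) t) v
  refine Eq.trans ?_ (congrArg ((-(1 / (8 * (Real.pi : ℂ) ^ 2))) * ·) h1).symm
  have h2 : ∀ u w, (fun r => β.onPlot e.symm he.isPlot_symm r ![u, w])
      = fun r => transgression (sectionMatrix c s he.isPlot_symm)
            (fun t => h (e.symm t)) (fun t => (h (e.symm t))⁻¹) r u w := fun u w => by
    funext r
    rw [hβ U h hU hh 3 e.symm he.isPlot_symm r (heU (he.mem_source r))]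
    exact gaugeTrace_pair c s h he.isPlot_symm r u w
  simp only [h2]

end GaugeTrace

theorem IsFullChart.contMDiffAt_of_contDiffAt {M : Type*} [TopologicalSpace M]
    [ChartedSpace E3 M] {e : OpenPartialHomeomorph M E3}
    (he : IsFullChart e) {f : M → ℂ} {x : M} (hx : x ∈ e.source)
    (hf : ContDiffAt ℝ ∞ (fun t => f (e.symm t)) (e x)) : ContMDiffAt (𝓡 3) 𝓘(ℝ, ℂ) ∞ f x := by
  have h1 : ContMDiffAt (𝓡 3) (𝓡 3) ∞ e x :=
    (contMDiffOn_of_mem_maximalAtlas he.1).contMDiffAt (e.open_source.mem_nhds hx)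
  refine (hf.contMDiffAt.comp x h1).congr_of_eventuallyEq ?_
  filter_upwards [e.open_source.mem_nhds hx] with y hy
  exact congrArg f (e.left_inv hy).symm

/-! ### Existence of smooth local gauges. -/

section LocalGauge

variable {M : Type*} [TopologicalSpace M] [ChartedSpace E3 M] [IsManifold (𝓡 3) ∞ M]
variable {F : FlagStructure M}

theorem eq_scaleCot {z z' : CotC M} {l : ℂ} (hp : z'.proj = z.proj)
    (hf : ∀ u, cotForm z' u = l * cotForm z u) : z' = scaleCot l z := by
  obtain ⟨x, f⟩ := z
  obtain ⟨x', f'⟩ := z'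
  obtain rfl : x' = x := hp
  have h : f' = l • f := ContinuousLinearMap.ext hf
  rw [h]
  rfl

/-- The coefficients which relate the coframes of two sections at a point. -/
theorem GlobalSection.compare (s s' : GlobalSection F) (x : M) : ∃ l μ ν α β κ : ℂ,
    μ ≠ 0 ∧ ν ≠ 0 ∧ l = μ * ν ∧ (s'.toFun x).base = scaleCot l (s.toFun x).base ∧
      (∀ u, (s'.toFun x).form₁ u = μ * (s.toFun x).form₁ u + α * (s.toFun x).form₀ u) ∧
      (∀ u, (s'.toFun x).form₂ u = ν * (s.toFun x).form₂ u + β * (s.toFun x).form₀ u) ∧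
      ∀ w ∈ F.tangentE (s.toFun x).base, (s'.toFun x).phiAt (w.1, l • w.2)
        = (s.toFun x).phiAt w + μ * β / l * (s.toFun x).form₁ w.1
          - α * ν / l * (s.toFun x).form₂ w.1 + κ * (s.toFun x).form₀ w.1 := by
  have h := (s.toFun x).isFlagCoframe
  have h' := (s'.toFun x).isFlagCoframe
  rw [s.pt_eq] at h
  rw [s'.pt_eq] at h'
  obtain ⟨l, μ, ν, α, β, hl, hμ, hν, h0, h1, h2⟩ := h.compare h'
  have hb : (s'.toFun x).base = scaleCot l (s.toFun x).base :=
    eq_scaleCot ((s'.pt_eq x).trans (s.pt_eq x).symm) h0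
  obtain ⟨hlμ, κ, hκ⟩ := AdaptedCoframe.compare_phi hl hb (exists_mem_tangentE s x) h1 h2
  exact ⟨l, μ, ν, α, β, κ, hμ, hν, hlμ, hb, h1, h2, hκ⟩

theorem contDiffAt_of_mul_eq {E : Type*} [NormedAddCommGroup E] [NormedSpace ℝ E]
    {f g k : E → ℂ} {t : E} (hg : ContDiffAt ℝ ∞ g t) (hk : ContDiffAt ℝ ∞ k t) (h0 : g t ≠ 0)
    (h : ∀ r, k r = f r * g r) : ContDiffAt ℝ ∞ f t := by
  refine (hk.mul (hg.inv h0)).congr_of_eventuallyEq ?_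
  filter_upwards [hg.continuousAt.eventually_ne h0] with r hr
  change f r = k r * (g r)⁻¹
  rw [h r, mul_assoc, mul_inv_cancel₀ hr, mul_one]

/-- A smooth cube root near a point where a smooth function does not vanish. -/
theorem exists_cubeRoot {E : Type*} [NormedAddCommGroup E] [NormedSpace ℝ E] {f : E → ℂ}
    (hf : ContDiff ℝ ∞ f) {t₀ : E} (h0 : f t₀ ≠ 0) :
    ∃ (W : Set E) (a : E → ℂ), IsOpen W ∧ t₀ ∈ W ∧ ContDiffOn ℝ ∞ a W ∧
      ∀ t ∈ W, a t ≠ 0 ∧ a t ^ 3 = f t := by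
  obtain ⟨a₀, ha₀⟩ := IsAlgClosed.exists_pow_nat_eq (f t₀) (n := 3) (by norm_num)
  -- Dividing by the value at t₀ moves the function to 1 there, where the principal logarithm is
  -- smooth.
  have hq : ContDiff ℝ ∞ (fun t => f t * (f t₀)⁻¹) := hf.mul contDiff_const
  refine ⟨(fun t => f t * (f t₀)⁻¹) ⁻¹' Complex.slitPlane,
    fun t => a₀ * Complex.exp ((1 / 3 : ℂ) * Complex.log (f t * (f t₀)⁻¹)),
    Complex.isOpen_slitPlane.preimage hq.continuous, ?_, ?_, fun t ht => ⟨?_, ?_⟩⟩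
  · change f t₀ * (f t₀)⁻¹ ∈ Complex.slitPlane
    rw [mul_inv_cancel₀ h0]
    exact Complex.one_mem_slitPlane
  · intro t ht
    have h1 : ContDiffAt ℝ ∞ Complex.log (f t * (f t₀)⁻¹) :=
      (Complex.contDiffAt_log (n := ∞) ht).restrict_scalars ℝ
    exact (contDiffAt_const.mul ((contDiffAt_const.mul
      (h1.comp t hq.contDiffAt)).cexp)).contDiffWithinAt
  · refine mul_ne_zero ?_ (Complex.exp_ne_zero _)
    rintro rfl
    exact h0 (by rw [← ha₀]; norm_num)
  · have h1 : f t * (f t₀)⁻¹ ≠ 0 := Complex.slitPlane_ne_zero ht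
    rw [mul_pow, ha₀, ← Complex.exp_nat_mul]
    rw [show ((3 : ℕ) : ℂ) * (1 / 3 * Complex.log (f t * (f t₀)⁻¹))
      = Complex.log (f t * (f t₀)⁻¹) by push_cast; ring, Complex.exp_log h1]
    field_simp

/-- The coefficients relating the two coframes are chosen pointwise, with no regularity. They are
unique, however: evaluating the relations on suitable constant vectors writes each one as a quotient
of smooth functions, in the order l, μ, ν, α, β, κ. Only the cube root of lμ needs a smaller
neighbourhood. -/
theorem exists_isGaugeOn (c : CanonicalForms F) (s s' : GlobalSection F) (x : M) :
    ∃ (U : Set M) (h : M → Mat3), IsOpen U ∧ x ∈ U ∧ IsGaugeOn s s' U h := by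
  choose l μ ν α β κ hμ hν hlμ hb h₁ h₂ hφ using s.compare s'
  have hl : ∀ y, l y ≠ 0 := fun y => hlμ y ▸ mul_ne_zero (hμ y) (hν y)
  obtain ⟨e, he, hx, -⟩ := exists_isFullChart isOpen_univ (Set.mem_univ x)
  let A := sectionMatrix c s he.isPlot_symm
  let A' := sectionMatrix c s' he.isPlot_symm
  have hA : ∀ i j t u, ContDiffAt ℝ ∞ (fun r => A r u i j) t := fun i j t u =>
    (plotMatrix_smooth c.connection (s.smooth 3 _ he.isPlot_symm) u i j).contDiffAt
  have hA' : ∀ i j t u, ContDiffAt ℝ ∞ (fun r => A' r u i j) t := fun i j t u =>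
    (plotMatrix_smooth c.connection (s'.smooth 3 _ he.isPlot_symm) u i j).contDiffAt
  have a20 : ∀ t u, A t u 2 0 = _ := sectionMatrix_20 c s he.isPlot_symm
  have a10 : ∀ t u, A t u 1 0 = _ := sectionMatrix_10 c s he.isPlot_symm
  have a21 : ∀ t u, A t u 2 1 = _ := sectionMatrix_21 c s he.isPlot_symm
  have ad : ∀ t u, A t u 2 2 - A t u 0 0 = _ := sectionMatrix_diag c s he.isPlot_symm
  have b20 : ∀ t u, A' t u 2 0 = _ := sectionMatrix_20 c s' he.isPlot_symm
  have b10 : ∀ t u, A' t u 1 0 = _ := sectionMatrix_10 c s' he.isPlot_symm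
  have b21 : ∀ t u, A' t u 2 1 = _ := sectionMatrix_21 c s' he.isPlot_symm
  have bd : ∀ t u, A' t u 2 2 - A' t u 0 0 = _ := sectionMatrix_diag c s' he.isPlot_symm
  have e₀ : ∀ t u, A' t u 2 0 = l (e.symm t) * A t u 2 0 := fun t u => by
    have e1 := congrArg (fun z => cotForm z (mfderiv (𝓡 3) (𝓡 3) e.symm t u)) (hb (e.symm t))
    change (s'.toFun (e.symm t)).form₀ _ = l (e.symm t) * (s.toFun (e.symm t)).form₀ _ at e1
    rw [a20, b20, e1]
    ring
  have e₁ : ∀ t u, A' t u 1 0 = μ (e.symm t) * A t u 1 0 + α (e.symm t) * (A t u 2 0 / 2) :=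
    fun t u => by
      rw [a10, b10, a20]
      refine (h₁ _ _).trans ?_
      ring
  have e₂ : ∀ t u, A' t u 2 1 = ν (e.symm t) * A t u 2 1 + β (e.symm t) * A t u 2 0 :=
    fun t u => by
      rw [a21, b21, a20]
      refine (congrArg (2 * ·) (h₂ _ _)).trans ?_
      beta_reduce
      ring
  have hu : ∀ t, ∃ u, A t u 2 0 ≠ 0 := fun t => by
    by_contra! h0
    exact one_ne_zero ((isCoframe_sectionMatrix c s he t).indep (c := 1) (c₁ := 0) (c₂ := 0)
      fun u => by simp [show sectionMatrix c s he.isPlot_symm t u 2 0 = 0 from h0 u]).1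
  -- A nonzero value of ω¹ ∧ ω up to a constant; multiplying the relation for ω¹ by ω eliminates α
  -- and isolates μ.
  have huv : ∀ t, ∃ u v, A t u 1 0 * A t v 2 0 - A t v 1 0 * A t u 2 0 ≠ 0 := fun t => by
    by_contra! h0
    refine one_ne_zero ((isCoframe_sectionMatrix c s he t).wedge_indep (c := 1) (c₁ := 0)
      (c₂ := 0) fun u v => ?_).1
    linear_combination -(h0 u v)
  have sl : ContDiff ℝ ∞ (fun t => l (e.symm t)) := contDiff_iff_contDiffAt.2 fun t => by
    obtain ⟨u, h0⟩ := hu t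
    exact contDiffAt_of_mul_eq (hA 2 0 t u) (hA' 2 0 t u) h0 fun r => e₀ r u
  have sμ : ContDiff ℝ ∞ (fun t => μ (e.symm t)) := contDiff_iff_contDiffAt.2 fun t => by
    obtain ⟨u, v, h0⟩ := huv t
    refine contDiffAt_of_mul_eq
      (((hA 1 0 t u).mul (hA 2 0 t v)).sub ((hA 1 0 t v).mul (hA 2 0 t u)))
      (((hA' 1 0 t u).mul (hA 2 0 t v)).sub ((hA' 1 0 t v).mul (hA 2 0 t u))) h0 fun r => ?_
    rw [e₁, e₁]
    ring
  have sν : ContDiff ℝ ∞ (fun t => ν (e.symm t)) := contDiff_iff_contDiffAt.2 fun t =>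
    contDiffAt_of_mul_eq sμ.contDiffAt sl.contDiffAt (hμ _) fun r => by rw [hlμ]; ring
  have sα : ContDiff ℝ ∞ (fun t => α (e.symm t)) := contDiff_iff_contDiffAt.2 fun t => by
    obtain ⟨u, h0⟩ := hu t
    refine contDiffAt_of_mul_eq ((hA 2 0 t u).div_const 2)
      ((hA' 1 0 t u).sub (sμ.contDiffAt.mul (hA 1 0 t u))) (div_ne_zero h0 two_ne_zero)
      fun r => ?_
    rw [e₁]
    ring
  have sβ : ContDiff ℝ ∞ (fun t => β (e.symm t)) := contDiff_iff_contDiffAt.2 fun t => by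
    obtain ⟨u, h0⟩ := hu t
    refine contDiffAt_of_mul_eq (hA 2 0 t u)
      ((hA' 2 1 t u).sub (sν.contDiffAt.mul (hA 2 1 t u))) h0 fun r => ?_
    rw [e₂]
    ring
  have sl' : ContDiff ℝ ∞ (fun t => (l (e.symm t))⁻¹) := sl.inv fun t => hl _
  -- The relation for φ solved for κ. The term with the derivative of l compensates the vertical
  -- motion in E, and the halves come from the entries 2ω and 2ω².
  have e₃ : ∀ t u, (A' t u 2 2 - A' t u 0 0) - (A t u 2 2 - A t u 0 0)
      + fderiv ℝ (fun r => l (e.symm r)) t u * (l (e.symm t))⁻¹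
      - μ (e.symm t) * β (e.symm t) * (l (e.symm t))⁻¹ * A t u 1 0
      + α (e.symm t) * ν (e.symm t) * (l (e.symm t))⁻¹ * (A t u 2 1 / 2)
      = κ (e.symm t) * (A t u 2 0 / 2) := fun t u => by
    have g1 := phiAt_velocity_of_scale (s := s) (s' := s') he.isPlot_symm (t := t)
      sl.contDiffAt (hl _) (Filter.Eventually.of_forall fun r => hb _) u
    have g2 := hφ (e.symm t) _ (velocity_section_mem s he.isPlot_symm t u)
    rw [velocity_section_fst he.isPlot_symm] at g1 g2
    rw [ad, bd, a10, a20, a21, g1, g2]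
    ring
  have sκ : ContDiff ℝ ∞ (fun t => κ (e.symm t)) := contDiff_iff_contDiffAt.2 fun t => by
    obtain ⟨u, h0⟩ := hu t
    have sD : ContDiffAt ℝ ∞ (fun t => fderiv ℝ (fun r => l (e.symm r)) t u) t :=
      ((sl.fderiv_right (m := ∞) (by simp)).clm_apply contDiff_const).contDiffAt
    exact contDiffAt_of_mul_eq ((hA 2 0 t u).div_const 2)
      ((((((hA' 2 2 t u).sub (hA' 0 0 t u)).sub ((hA 2 2 t u).sub (hA 0 0 t u))).add
        (sD.mul sl'.contDiffAt)).sub (((sμ.mul sβ).mul sl').contDiffAt.mul (hA 1 0 t u))).add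
        (((sα.mul sν).mul sl').contDiffAt.mul ((hA 2 1 t u).div_const 2)))
      (div_ne_zero h0 two_ne_zero) fun r => e₃ r u
  obtain ⟨W, a, hW, hxW, sa, ha⟩ := exists_cubeRoot (sl.mul sμ) (t₀ := e x)
    (mul_ne_zero (hl _) (hμ _))
  have hU : IsOpen (e.source ∩ e ⁻¹' W) := e.isOpen_inter_preimage hW
  refine ⟨e.source ∩ e ⁻¹' W,
    fun y => borelMatrix (a (e y)) (l y) (α y) (β y) (κ y), hU, ⟨hx, hxW⟩, ?_, ?_⟩
  · intro i j y hy
    refine (he.contMDiffAt_of_contDiffAt hy.1 ?_).contMDiffWithinAt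
    simp only [he.right_inv]
    have da : ContDiffAt ℝ ∞ a (e y) := sa.contDiffAt (hW.mem_nhds hy.2)
    have dl := sl.contDiffAt (x := e y)
    have dα := sα.contDiffAt (x := e y)
    have dβ := sβ.contDiffAt (x := e y)
    have dκ := sκ.contDiffAt (x := e y)
    have di : ContDiffAt ℝ ∞ (fun t => a t * (l (e.symm t))⁻¹) (e y) :=
      da.mul sl'.contDiffAt
    have dr : ContDiffAt ℝ ∞ (fun t => (a t ^ 2)⁻¹) (e y) :=
      (da.pow 2).inv (pow_ne_zero 2 (ha _ hy.2).1)
    fin_cases i <;> fin_cases j <;>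
      simp only [borelMatrix, Matrix.of_apply, Matrix.cons_val, Fin.zero_eta, Fin.mk_one,
        Fin.reduceFinMk, div_eq_mul_inv]
    · exact da
    · exact di.mul dβ
    · exact (di.mul contDiffAt_const).mul
        (dκ.sub (((da.mul (di.mul dβ)).mul dα).mul dr))
    · exact contDiffAt_const
    · exact dl.mul dr
    · refine dα.neg.mul ?_
      simp only [mul_inv]
      exact contDiffAt_const.mul dr
    · exact contDiffAt_const
    · exact contDiffAt_const
    · exact di
  · intro y hy
    obtain ⟨ha0, ha3⟩ := ha _ hy.2
    rw [e.left_inv hy.1] at ha3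
    exact ⟨borelMatrix_mem ha0 (hl y) _ _ _, isRightTranslate_borelMatrix ha0 (hμ y) (hν y)
      (hlμ y) ha3 (hb y) (h₁ y) (h₂ y) (hφ y)⟩

end LocalGauge

/-! ### Change of variables and integration by parts on ℝ³. -/

section EuclideanIntegration

/-- The effect of an endomorphism on a complex valued form of top degree. -/
theorem alternating_comp_eq_det (f : E3 [⋀^Fin 3]→L[ℝ] ℂ) (L : E3 →L[ℝ] E3) (v : Fin 3 → E3) :
    f (fun i => L (v i)) = (L.det : ℂ) * f v := by
  let b : Module.Basis (Fin 3) ℝ E3 := (EuclideanSpace.basisFun (Fin 3) ℝ).toBasis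
  -- Real and imaginary parts reduce the claim to real valued forms, which are multiples of the
  -- determinant of a basis.
  have key : ∀ r : ℂ →L[ℝ] ℝ, r (f (fun i => L (v i))) = L.det * r (f v) := fun r => by
    let g : E3 [⋀^Fin 3]→ₗ[ℝ] ℝ :=
      (r : ℂ →ₗ[ℝ] ℝ).compAlternatingMap f.toAlternatingMap
    have hg := g.eq_smul_basis_det b
    have h1 : ∀ w, r (f w) = g b * b.det w := fun w =>
      congrArg (fun a : E3 [⋀^Fin 3]→ₗ[ℝ] ℝ => a w) hg
    rw [h1, h1, show (fun i => L (v i)) = (L : E3 →ₗ[ℝ] E3) ∘ v from rfl, b.det_comp]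
    change _ = LinearMap.det (L : E3 →ₗ[ℝ] E3) * _
    ring
  refine Complex.ext ?_ ?_
  · rw [Complex.re_ofReal_mul]
    exact key Complex.reCLM
  · rw [Complex.im_ofReal_mul]
    exact key Complex.imCLM

/-- Integration by parts against the constant function 1, which is admissible because g has compact
support. -/
theorem integral_fderiv_eq_zero {g : E3 → ℂ} (hg : ContDiff ℝ ∞ g) (hc : HasCompactSupport g)
    (v : E3) : ∫ y, fderiv ℝ g y v = 0 := by
  have hc' : HasCompactSupport (fun y => fderiv ℝ g y v) := hc.fderiv_apply ℝ v
  have h1 : Continuous (fun y => fderiv ℝ g y v) :=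
    ((hg.fderiv_right (m := ∞) (by simp)).clm_apply contDiff_const).continuous
  have h := integral_mul_fderiv_eq_neg_fderiv_mul_of_integrable (𝕜 := ℂ)
    (μ := MeasureTheory.volume) (f := fun _ : E3 => (1 : ℂ)) (g := g) (v := v)
    (by simp) (by simpa using h1.integrable_of_hasCompactSupport hc')
    (by simpa using hg.continuous.integrable_of_hasCompactSupport hc)
    (fun _ _ => differentiableAt_const _) (fun y _ => hg.differentiable (by simp) y)
  simpa using h

theorem extDeriv_zero_form {E : Type*} [NormedAddCommGroup E] [NormedSpace ℝ E] {k : ℕ} (t : E) :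
    extDeriv (0 : E → E [⋀^Fin k]→L[ℝ] ℂ) t = 0 := by
  simpa using extDeriv_smul (x := t) (0 : ℝ) (0 : E → E [⋀^Fin k]→L[ℝ] ℂ)

/-- The integral of the exterior derivative of a compactly supported form vanishes. -/
theorem integral_extDeriv_eq_zero {b : E3 → E3 [⋀^Fin 2]→L[ℝ] ℂ} (hb : ContDiff ℝ ∞ b)
    (hc : HasCompactSupport b) (v : Fin 3 → E3) : ∫ y, extDeriv b y v = 0 := by
  have hs : ∀ u w, ContDiff ℝ ∞ (fun y => b y ![u, w]) := fun u w => ContDiff.alternating_apply hb _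
  have hcs : ∀ u w, HasCompactSupport (fun y => b y ![u, w]) := fun u w =>
    hc.comp_left (g := fun a : E3 [⋀^Fin 2]→L[ℝ] ℂ => a ![u, w]) rfl
  have hi : ∀ u w x, MeasureTheory.Integrable (fun y => fderiv ℝ (fun y => b y ![u, w]) y x) :=
    fun u w x => (((hs u w).fderiv_right (m := ∞) (by simp)).clm_apply
      contDiff_const).continuous.integrable_of_hasCompactSupport ((hcs u w).fderiv_apply ℝ x)
  simp only [extDeriv_two_apply (hb.differentiable (by simp) _)]
  refine (MeasureTheory.integral_add ((hi (v 1) (v 2) (v 0)).sub (hi (v 0) (v 2) (v 1)))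
    (hi (v 0) (v 1) (v 2))).trans ?_
  rw [MeasureTheory.integral_sub' (hi _ _ _) (hi _ _ _), integral_fderiv_eq_zero (hs _ _) (hcs _ _),
    integral_fderiv_eq_zero (hs _ _) (hcs _ _), integral_fderiv_eq_zero (hs _ _) (hcs _ _)]
  simp

end EuclideanIntegration

theorem DiffForm.d_add {X : Type*} [DiffeologicalSpace X] {k : ℕ} (α β : DiffForm X k) :
    (α + β).d = α.d + β.d :=
  ext_onPlot fun p hp t => extDeriv_fun_add ((α.contDiff p hp).differentiable (by simp) t)
    ((β.contDiff p hp).differentiable (by simp) t)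

/-! ### Top degree coefficients and products of functions with forms. -/

section Charts

variable {M : Type*} [TopologicalSpace M] [ChartedSpace E3 M]

theorem OrientedAtlas.isFullChart (O : OrientedAtlas M) (e : O.charts) : IsFullChart e.1 :=
  ⟨O.smooth e.2, O.target_eq e.1 e.2⟩

theorem hasCompactSupport_of_isCompact {e : OpenPartialHomeomorph M E3} (he : IsFullChart e)
    {K : Set M} (hK : IsCompact K) (hKe : K ⊆ e.source) {A : Type*} [Zero A] {g : E3 → A}
    (hg : ∀ y, e.symm y ∉ K → g y = 0) : HasCompactSupport g := by
  refine HasCompactSupport.intro (hK.image_of_continuousOn (e.continuousOn.mono hKe))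
    fun y hy => hg y fun h => hy ⟨_, h, he.right_inv y⟩

/-- A form of degree three in the coordinates given by a plot. -/
def topCoeff (γ : DiffForm M 3) {p : E3 → M} (hp : IsPlot p) (y : E3) : ℂ :=
  γ.onPlot p hp y (fun i => EuclideanSpace.basisFun (Fin 3) ℝ i)

theorem topCoeff_contDiff (γ : DiffForm M 3) {p : E3 → M} (hp : IsPlot p) :
    ContDiff ℝ ∞ (topCoeff γ hp) := ContDiff.alternating_apply (γ.contDiff p hp) _

/-- The product of a smooth function and a form. -/
def mulForm {k : ℕ} (χ : C^∞⟮𝓡 3, M; 𝓘(ℝ, ℝ), ℝ⟯) (β : DiffForm M k) : DiffForm M k where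
  onPlot p hp t := χ (p t) • β.onPlot p hp t
  contDiff {n} p hp := by
    have h : ContMDiff (𝓡 n) (𝓡 3) ∞ p := hp
    exact (χ.contMDiff.comp h).contDiff.smul (β.contDiff p hp)
  reparam p hp f hf t := by
    rw [β.reparam p hp f hf]
    rfl

/-- The form vanishes near the point and not just at it, so its exterior derivative vanishes there
too. -/
theorem mulForm_onPlot_eventually {k : ℕ} (χ : C^∞⟮𝓡 3, M; 𝓘(ℝ, ℝ), ℝ⟯) (β : DiffForm M k) {n : ℕ}
    {p : EuclideanSpace ℝ (Fin n) → M} (hp : IsPlot p) {t : EuclideanSpace ℝ (Fin n)}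
    (ht : p t ∉ tsupport χ) : (mulForm χ β).onPlot p hp =ᶠ[𝓝 t] 0 := by
  filter_upwards [eventually_mem_of_isPlot (isClosed_tsupport χ).isOpen_compl hp ht] with r hr
  have h : χ (p r) = (0 : ℝ) := image_eq_zero_of_notMem_tsupport hr
  change (χ (p r) : ℝ) • β.onPlot p hp r = 0
  rw [h]
  ext v
  exact zero_smul ℝ (β.onPlot p hp r v)

end Charts

/-! ### The integral on a compact oriented three-manifold and Stokes' theorem. -/

section Stokes

variable {M : Type*} [TopologicalSpace M] [ChartedSpace E3 M] [IsManifold (𝓡 3) ∞ M]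

variable (O : OrientedAtlas M)

theorem OrientedAtlas.topCoeff_change (γ : DiffForm M 3) (e e' : O.charts) {y : E3}
    (hy : y ∈ (e.1.symm.trans e'.1).source) :
    topCoeff γ (O.isPlot_symm e) y = |(fderiv ℝ (e.1.symm.trans e'.1) y).det|
      • topCoeff γ (O.isPlot_symm e') (e.1.symm.trans e'.1 y) := by
  rw [abs_of_pos (O.positive e.1 e.2 e'.1 e'.2 y hy)]
  have hf : ContDiffOn ℝ ∞ (e.1.symm.trans e'.1) (e.1.symm.trans e'.1).source := by
    rw [← contMDiffOn_iff_contDiffOn]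
    refine (contMDiffOn_of_mem_maximalAtlas (O.smooth e'.2)).comp
      ((O.isFullChart e).contMDiff_symm.contMDiffOn) fun r hr => ?_
    rw [OpenPartialHomeomorph.trans_source] at hr
    exact hr.2
  have hfac : ∀ r ∈ (e.1.symm.trans e'.1).source,
      e.1.symm r = e'.1.symm (e.1.symm.trans e'.1 r) := fun r hr => by
    rw [OpenPartialHomeomorph.trans_source] at hr
    exact (e'.1.left_inv hr.2).symm
  have h1 := γ.onPlot_of_factor (O.isPlot_symm e) (O.isPlot_symm e')
    (e.1.symm.trans e'.1).open_source hf hfac hy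
  rw [topCoeff, h1]
  exact alternating_comp_eq_det _ _ _

/-- The supports confine both integrals to the overlap of the charts. There the change of variables
formula applies, and the positive orientation identifies the Jacobian determinant with its absolute
value. -/
theorem OrientedAtlas.integral_change (γ : DiffForm M 3) (χ : M → ℝ) (e e' : O.charts)
    (hχ : ∀ x, x ∉ e.1.source → χ x = 0)
    (hγ : ∀ (p : E3 → M) (hp : IsPlot p) y, p y ∉ e'.1.source → topCoeff γ hp y = 0) :
    ∫ y, (χ (e.1.symm y) : ℂ) * topCoeff γ (O.isPlot_symm e) y
      = ∫ y, (χ (e'.1.symm y) : ℂ) * topCoeff γ (O.isPlot_symm e') y := by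
  let T := e.1.symm.trans e'.1
  have hTs : ∀ y, y ∈ T.source ↔ e.1.symm y ∈ e'.1.source := fun y => by
    rw [OpenPartialHomeomorph.trans_source, OpenPartialHomeomorph.symm_source,
      O.target_eq e.1 e.2, Set.univ_inter, Set.mem_preimage]
  have hTt : ∀ y, y ∈ T.target ↔ e'.1.symm y ∈ e.1.source := fun y => by
    rw [OpenPartialHomeomorph.trans_target, O.target_eq e'.1 e'.2, Set.univ_inter,
      Set.mem_preimage, OpenPartialHomeomorph.symm_target]
  have hd : ∀ y ∈ T.source, HasFDerivWithinAt T (fderiv ℝ T y) T.source y := fun y hy => by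
    have hf : ContMDiffAt (𝓡 3) (𝓡 3) ∞ T y :=
      ((contMDiffOn_of_mem_maximalAtlas (O.smooth e'.2)).contMDiffAt
        (e'.1.open_source.mem_nhds ((hTs y).1 hy))).comp y
        ((O.isFullChart e).contMDiff_symm y)
    exact (hf.contDiffAt.differentiableAt (by simp)).hasFDerivAt.hasFDerivWithinAt
  have h1 : ∫ y, (χ (e.1.symm y) : ℂ) * topCoeff γ (O.isPlot_symm e) y
      = ∫ y in T.source, (χ (e.1.symm y) : ℂ) * topCoeff γ (O.isPlot_symm e) y := by
    refine (MeasureTheory.setIntegral_eq_integral_of_forall_compl_eq_zero fun y hy => ?_).symm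
    rw [hγ _ _ y fun h => hy ((hTs y).2 h), mul_zero]
  have h2 : ∫ y, (χ (e'.1.symm y) : ℂ) * topCoeff γ (O.isPlot_symm e') y
      = ∫ y in T.target, (χ (e'.1.symm y) : ℂ) * topCoeff γ (O.isPlot_symm e') y := by
    refine (MeasureTheory.setIntegral_eq_integral_of_forall_compl_eq_zero fun y hy => ?_).symm
    rw [hχ _ fun h => hy ((hTt y).2 h), Complex.ofReal_zero, zero_mul]
  rw [h1, h2, ← T.image_source_eq_target,
    MeasureTheory.integral_image_eq_integral_abs_det_fderiv_smul _ T.open_source.measurableSet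
      hd T.injOn]
  refine MeasureTheory.setIntegral_congr_fun T.open_source.measurableSet fun y hy => ?_
  have h3 : e'.1.symm (T y) = e.1.symm y := e'.1.left_inv ((hTs y).1 hy)
  change (χ (e.1.symm y) : ℂ) * _ = |(fderiv ℝ T y).det| • ((χ (e'.1.symm (T y)) : ℂ) * _)
  rw [O.topCoeff_change γ e e' hy, h3, mul_smul_comm]

variable [CompactSpace M] [T2Space M]

theorem OrientedAtlas.tsupport_subset (e : O.charts) : tsupport (O.partition e) ⊆ e.1.source :=
  O.exists_partition.choose_spec e

theorem OrientedAtlas.partition_eq_zero {e : O.charts} {x : M} (hx : x ∉ tsupport (O.partition e)) :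
    O.partition e x = 0 := image_eq_zero_of_notMem_tsupport hx

theorem OrientedAtlas.finite_support :
    {e : O.charts | (Function.support (O.partition e)).Nonempty}.Finite :=
  O.partition.locallyFinite.finite_nonempty_of_compact

/-- The charts which contribute to the integral. -/
def OrientedAtlas.indices : Finset O.charts := O.finite_support.toFinset

theorem OrientedAtlas.eq_zero_of_notMem_indices {e : O.charts} (he : e ∉ O.indices) (x : M) :
    O.partition e x = 0 := by
  by_contra h
  exact he (O.finite_support.mem_toFinset.2 ⟨x, h⟩)

theorem OrientedAtlas.sum_partition (x : M) : ∑ e ∈ O.indices, O.partition e x = 1 := by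
  rw [← O.partition.sum_eq_one (Set.mem_univ x)]
  refine (finsum_eq_sum_of_support_subset _ fun e he => ?_).symm
  by_contra h
  exact he (O.eq_zero_of_notMem_indices h x)

theorem OrientedAtlas.integral_eq_sum (γ : DiffForm M 3) : O.integral γ = ∑ e ∈ O.indices,
    ∫ y, (O.partition e (e.1.symm y) : ℂ) * topCoeff γ (O.isPlot_symm e) y := by
  refine finsum_eq_sum_of_support_subset _ fun e he => ?_
  by_contra h
  exact he (by simp [O.eq_zero_of_notMem_indices h])

theorem OrientedAtlas.integrable (γ : DiffForm M 3) (e : O.charts) : MeasureTheory.Integrable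
    fun y => (O.partition e (e.1.symm y) : ℂ) * topCoeff γ (O.isPlot_symm e) y := by
  refine Continuous.integrable_of_hasCompactSupport ?_
    (hasCompactSupport_of_isCompact (O.isFullChart e) (isClosed_tsupport _).isCompact
      (O.tsupport_subset e) fun y hy => ?_)
  · exact (Complex.continuous_ofReal.comp ((O.partition e).contMDiff.continuous.comp
      (O.isFullChart e).contMDiff_symm.continuous)).mul (topCoeff_contDiff γ _).continuous
  · rw [O.partition_eq_zero hy, Complex.ofReal_zero, zero_mul]

theorem OrientedAtlas.integral_add (γ γ' : DiffForm M 3) :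
    O.integral (γ + γ') = O.integral γ + O.integral γ' := by
  simp only [O.integral_eq_sum, ← Finset.sum_add_distrib]
  refine Finset.sum_congr rfl fun e _ => ?_
  rw [← MeasureTheory.integral_add (O.integrable γ e) (O.integrable γ' e)]
  refine MeasureTheory.integral_congr_ae (Filter.Eventually.of_forall fun y => ?_)
  exact mul_add _ _ _

theorem OrientedAtlas.integral_smul (c : ℂ) (γ : DiffForm M 3) :
    O.integral (c • γ) = c * O.integral γ := by
  simp only [O.integral_eq_sum, Finset.mul_sum, ← MeasureTheory.integral_const_mul]
  refine Finset.sum_congr rfl fun e _ =>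
    MeasureTheory.integral_congr_ae (Filter.Eventually.of_forall fun y => ?_)
  exact mul_left_comm _ c _

/-- A form of degree three which is supported in a chart may be integrated in this chart. -/
theorem OrientedAtlas.integral_of_support (γ : DiffForm M 3) (e' : O.charts) {K : Set M}
    (hK : IsCompact K) (hKe : K ⊆ e'.1.source)
    (hγ : ∀ (p : E3 → M) (hp : IsPlot p) y, p y ∉ K → topCoeff γ hp y = 0) :
    O.integral γ = ∫ y, topCoeff γ (O.isPlot_symm e') y := by
  have h1 : ∀ e, ∫ y, (O.partition e (e.1.symm y) : ℂ) * topCoeff γ (O.isPlot_symm e) y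
      = ∫ y, (O.partition e (e'.1.symm y) : ℂ) * topCoeff γ (O.isPlot_symm e') y := fun e =>
    O.integral_change γ (O.partition e) e e'
      (fun x hx => O.partition_eq_zero fun h => hx (O.tsupport_subset e h))
      fun p hp y hy => hγ p hp y fun h => hy (hKe h)
  -- Once all summands are written in the chart `e'`, the partition functions add up to 1.
  rw [O.integral_eq_sum, Finset.sum_congr rfl fun e _ => h1 e, ← MeasureTheory.integral_finsetSum]
  · refine MeasureTheory.integral_congr_ae (Filter.Eventually.of_forall fun y => ?_)
    simp only [← Finset.sum_mul]
    rw [← Complex.ofReal_sum, O.sum_partition, Complex.ofReal_one, one_mul]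
  · refine fun e _ => Continuous.integrable_of_hasCompactSupport ?_
      (hasCompactSupport_of_isCompact (O.isFullChart e') hK hKe fun y hy => ?_)
    · exact (Complex.continuous_ofReal.comp ((O.partition e).contMDiff.continuous.comp
        (O.isFullChart e').contMDiff_symm.continuous)).mul (topCoeff_contDiff γ _).continuous
    · rw [hγ _ _ y hy, mul_zero]

/-- The product is supported in a single chart, where Stokes' theorem is the vanishing of the
integral of a compactly supported exact form on ℝ³. -/
theorem OrientedAtlas.integral_d_mulForm (β : DiffForm M 2) (e : O.charts) :
    O.integral (mulForm (O.partition e) β).d = 0 := by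
  have hK : IsCompact (tsupport (O.partition e)) := (isClosed_tsupport _).isCompact
  rw [O.integral_of_support _ e hK (O.tsupport_subset e)]
  · exact integral_extDeriv_eq_zero ((mulForm (O.partition e) β).contDiff _ _)
      (hasCompactSupport_of_isCompact (O.isFullChart e) hK (O.tsupport_subset e) fun y hy =>
        (mulForm_onPlot_eventually _ β (O.isPlot_symm e) hy).self_of_nhds) _
  · intro p hp y hy
    have h : extDeriv ((mulForm (O.partition e) β).onPlot p hp) y = 0 := by
      rw [(mulForm_onPlot_eventually _ β hp hy).extDeriv_eq]
      exact extDeriv_zero_form y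
    exact congrArg (fun a : E3 [⋀^Fin 3]→L[ℝ] ℂ => a _) h

theorem d_sum_mulForm (β : DiffForm M 2) :
    ∑ e ∈ O.indices, (mulForm (O.partition e) β).d = β.d := by
  -- Summing before differentiating avoids the product rule: the exterior derivative is additive and
  -- the partition functions add up to 1.
  have h1 := map_sum (AddMonoidHom.mk' (DiffForm.d (X := M) (k := 2)) DiffForm.d_add)
    (fun e => mulForm (O.partition e) β) O.indices
  refine Eq.trans h1.symm (congrArg DiffForm.d ?_)
  refine DiffForm.ext_onPlot fun {n} p hp t => ?_
  have h2 := map_sum (AddMonoidHom.mk' (fun α : DiffForm M 2 => α.onPlot p hp t)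
    fun α β => rfl) (fun e => mulForm (O.partition e) β) O.indices
  refine h2.trans ?_
  change ∑ e ∈ O.indices, (O.partition e (p t) : ℝ) • β.onPlot p hp t = _
  rw [← Finset.sum_smul, O.sum_partition, one_smul]

/-- Stokes' theorem on a compact oriented three-manifold. -/
theorem OrientedAtlas.integral_d (β : DiffForm M 2) : O.integral β.d = 0 := by
  have h0 : O.integral (0 : DiffForm M 3) = 0 := by
    have := O.integral_smul 0 (0 : DiffForm M 3)
    rwa [zero_smul, zero_mul] at this
  have h : ∀ S : Finset O.charts, O.integral (∑ e ∈ S, (mulForm (O.partition e) β).d) = 0 := by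
    classical
    intro S
    induction S using Finset.induction_on with
    | empty => exact h0
    | insert e S he hS => rw [Finset.sum_insert he, O.integral_add, hS, O.integral_d_mulForm, add_zero]
  rw [← d_sum_mulForm O]
  exact h _

end Stokes

/-! ### Conclusion: independence of the section. -/

theorem mu_eq_of_TC₂_sub {M : Type*} [TopologicalSpace M]
    [ChartedSpace E3 M] [IsManifold (𝓡 3) ∞ M] [T2Space M] [CompactSpace M]
    {F : FlagStructure M} (O : OrientedAtlas M)
    (c : CanonicalForms F) {s s' : GlobalSection F} {r : ℂ}
    {β : DiffForm M 2}
    (h : c.TC₂.pullback s'.toFun s'.smooth - c.TC₂.pullback s.toFun s.smooth = r • β.d) :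
    mu O c s' = mu O c s := by
  rw [mu, mu, sub_eq_iff_eq_add.1 h, O.integral_add, O.integral_smul,
    O.integral_d, mul_zero, zero_add]

end

end FlagGeometry

theorem proposition6p2 {M : Type*} [TopologicalSpace M]
    [ChartedSpace FlagGeometry.E3 M] [IsManifold (𝓡 3) ∞ M] [T2Space M]
    [SecondCountableTopology M]
    (F : FlagGeometry.FlagStructure M) (c : FlagGeometry.CanonicalForms F)
    (s s' : FlagGeometry.GlobalSection F) :
    (∃ β : FlagGeometry.DiffForm M 2,
      (∀ x : M, ∃ (U : Set M) (h : M → Matrix (Fin 3) (Fin 3) ℂ),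
        IsOpen U ∧ x ∈ U ∧ FlagGeometry.IsGaugeOn s s' U h) ∧
      (∀ (U : Set M) (h : M → Matrix (Fin 3) (Fin 3) ℂ),
        IsOpen U → FlagGeometry.IsGaugeOn s s' U h →
        ∀ (n : ℕ) (q : EuclideanSpace ℝ (Fin n) → M) (hq : Diffeology.IsPlot q),
          (∀ t, q t ∈ U) → ∀ t, β.onPlot q hq t = FlagGeometry.gaugeTrace c s h q hq t) ∧
      c.TC₂.pullback s'.toFun s'.smooth - c.TC₂.pullback s.toFun s.smooth
        = (-(1 / (8 * (Real.pi : ℂ) ^ 2))) • β.d) ∧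
    (∀ [CompactSpace M] (O : FlagGeometry.OrientedAtlas M),
      FlagGeometry.mu O c s' = FlagGeometry.mu O c s) := by
  obtain ⟨β, hβ⟩ := FlagGeometry.exists_gaugeForm c (FlagGeometry.exists_isGaugeOn c s s')
  have hd := FlagGeometry.TC₂_sub_eq c (FlagGeometry.exists_isGaugeOn c s s') hβ
  exact ⟨⟨β, FlagGeometry.exists_isGaugeOn c s s',
    fun U h hU hh n q hq hqU t => hβ U h hU hh n q hq t (hqU t), hd⟩,
    fun O => FlagGeometry.mu_eq_of_TC₂_sub O c hd⟩
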